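/- For integers $d\ge 1$ and $n\ge 1$ and a set $P$ of $n$ points in $\mathbb{R}^d$, let $H_P$ be the set of all hyperplanes of $\mathbb{R}^d$ that are spanned by $d$ affinely independent points of $P$ (so $|H_P|=\binom{n}{d}$ when no $d+1$ points of $P$ lie on a common hyperplane). The hyperplane distance depth (HDD) of a point $q\in\mathbb{R}^d$ relative to $P$ is $D_P(q)=\sum_{h\in H_P}\operatorname{dist}(q,h)$, where $\operatorname{dist}$ is the Euclidean distance, and an HDD median of $P$ is a point of $\mathbb{R}^d$ at which $D_P$ attains its minimum over $\mathbb{R}^d$. Consider the real RAM: a deterministic random access machine that stores natural numbers (for counting and addressing) and exact real numbers, and that performs each of the following in one step: $+,-,\times,\div,\sqrt{\ }$ on reals; addition, truncated subtraction and halving with rounding down on natural numbers; comparisons; access to a memory cell with a computed address; integer constants. **Theorem.** There are a single real-RAM program and a constant $C$, independent of $n$, $d$ and $P$, such that for all $d\ge 1$, $n\ge 1$ and every set $P$ of $n$ points in $\mathbb{R}^d$, the program, given $n$, $d$ and the coordinates of the points of $P$ in any order, halts and outputs the coordinates of an HDD median of $P$; and if $n\ge 2$, it halts after at most $C\, d\,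 n^{d^2}\log n$ steps. In short: an HDD median of $n$ points in $\mathbb{R}^d$ can be found in $O(d\,n^{d^2}\log n)$ time. -/

import Mathlib

/-! ## Hyperplane distance depth -/

namespace HDD

open Classical in
/-- The set of all hyperplanes determined by `P`: the affine spans of the `d`-element affinely
independent subsets of `P`. It is a set, so a hyperplane spanned by several such subsets occurs
once; if no `d + 1` points of `P` lie on a common hyperplane, it has exactly `(#P).choose d`
elements. -/
noncomputable def hyperplanes {d : ℕ} (P : Finset (EuclideanSpace ℝ (Fin d))) :
    Finset (AffineSubspace ℝ (EuclideanSpace ℝ (Fin d))) :=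
  ((P.powersetCard d).filter
      (fun s : Finset (EuclideanSpace ℝ (Fin d)) =>
        AffineIndependent ℝ (fun x : s => (x : EuclideanSpace ℝ (Fin d))))).image
    (fun s : Finset (EuclideanSpace ℝ (Fin d)) => affineSpan ℝ (s : Set (EuclideanSpace ℝ (Fin d))))

/-- The hyperplane distance depth of `q` relative to `P`: the sum of the Euclidean distances
from `q` to all hyperplanes determined by `P`. -/
noncomputable def depth {d : ℕ} (P : Finset (EuclideanSpace ℝ (Fin d)))
    (q : EuclideanSpace ℝ (Fin d)) : ℝ :=
  ∑ h ∈ hyperplanes P, Metric.infDist q (h : Set (EuclideanSpace ℝ (Fin d)))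

/-- An HDD median of `P` is a point of `ℝ^d` that minimizes the depth. -/
def IsMedian {d : ℕ} (P : Finset (EuclideanSpace ℝ (Fin d)))
    (q : EuclideanSpace ℝ (Fin d)) : Prop :=
  ∀ x : EuclideanSpace ℝ (Fin d), depth P q ≤ depth P x

end HDD

/-! ## The real RAM

A deterministic random access machine with exact real arithmetic (including square roots) at unit
cost. Its memory consists of arrays of natural numbers (used for counting and for addressing) and
arrays of real numbers; a program mentions finitely many arrays by name, and every array cell can
be accessed by a computed index. There is no operation that turns a real number into a natural
number (no floor), and natural numbers cannot be multiplied in one step. Real constants in a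
program are integers. -/

namespace RealRAM

/-- The memory: `s.nat a i` and `s.real a i` are the `i`-th cells of the arrays with name `a`. -/
structure State where
  nat : ℕ → ℕ → ℕ
  real : ℕ → ℕ → ℝ

/-- Natural-number expressions. -/
inductive NatExp where
  | const (k : ℕ)
  | load (a : ℕ) (i : NatExp)
  | add (x y : NatExp)
  | sub (x y : NatExp)
  | half (x : NatExp)

namespace NatExp

def eval (s : State) : NatExp → ℕ
  | const k => k
  | load a i => s.nat a (i.eval s)
  | add x y => x.eval s + y.eval s
  | sub x y => x.eval s - y.eval s
  | half x => x.eval s / 2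

/-- The number of operations (constants, memory accesses, arithmetic) in an expression. -/
def cost : NatExp → ℕ
  | const _ => 1
  | load _ i => i.cost + 1
  | add x y => x.cost + y.cost + 1
  | sub x y => x.cost + y.cost + 1
  | half x => x.cost + 1

end NatExp

/-- Real-number expressions. -/
inductive RealExp where
  | const (k : ℤ)
  | load (a : ℕ) (i : NatExp)
  | add (x y : RealExp)
  | sub (x y : RealExp)
  | mul (x y : RealExp)
  | div (x y : RealExp)
  | sqrt (x : RealExp)

namespace RealExp

/-- Division by zero and the square root of a negative number return `0`; a program can test for
both. -/
noncomputable def eval (s : State) : RealExp → ℝ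
  | const k => (k : ℝ)
  | load a i => s.real a (i.eval s)
  | add x y => x.eval s + y.eval s
  | sub x y => x.eval s - y.eval s
  | mul x y => x.eval s * y.eval s
  | div x y => x.eval s / y.eval s
  | sqrt x => Real.sqrt (x.eval s)

def cost : RealExp → ℕ
  | const _ => 1
  | load _ i => i.cost + 1
  | add x y => x.cost + y.cost + 1
  | sub x y => x.cost + y.cost + 1
  | mul x y => x.cost + y.cost + 1
  | div x y => x.cost + y.cost + 1
  | sqrt x => x.cost + 1

end RealExp

/-- Tests. -/
inductive Test where
  | natEq (x y : NatExp)
  | natLt (x y : NatExp)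
  | realEq (x y : RealExp)
  | realLt (x y : RealExp)
  | not (b : Test)
  | and (b c : Test)
  | or (b c : Test)

namespace Test

def Holds (s : State) : Test → Prop
  | natEq x y => x.eval s = y.eval s
  | natLt x y => x.eval s < y.eval s
  | realEq x y => x.eval s = y.eval s
  | realLt x y => x.eval s < y.eval s
  | not b => ¬ b.Holds s
  | and b c => b.Holds s ∧ c.Holds s
  | or b c => b.Holds s ∨ c.Holds s

def cost : Test → ℕ
  | natEq x y => x.cost + y.cost + 1
  | natLt x y => x.cost + y.cost + 1
  | realEq x y => x.cost + y.cost + 1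
  | realLt x y => x.cost + y.cost + 1
  | not b => b.cost + 1
  | and b c => b.cost + c.cost + 1
  | or b c => b.cost + c.cost + 1

end Test

/-- Programs. -/
inductive Program where
  | skip
  /-- `a[i] := x` for the natural-number array `a` -/
  | storeNat (a : ℕ) (i : NatExp) (x : NatExp)
  /-- `a[i] := x` for the real-number array `a` -/
  | storeReal (a : ℕ) (i : NatExp) (x : RealExp)
  | seq (p q : Program)
  /-- if `b` then `p` else `q` -/
  | ite (b : Test) (p q : Program)
  /-- while `b` do `p` -/
  | loop (b : Test) (p : Program)

namespace State

def setNat (s : State) (a i v : ℕ) : State :=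
  { s with nat := Function.update s.nat a (Function.update (s.nat a) i v) }

noncomputable def setReal (s : State) (a i : ℕ) (v : ℝ) : State :=
  { s with real := Function.update s.real a (Function.update (s.real a) i v) }

end State

/-- `Runs p s t s'`: started in the memory `s`, the program `p` halts after `t` steps with the
memory `s'`. -/
inductive Runs : Program → State → ℕ → State → Prop where
  | skip (s : State) : Runs .skip s 1 s
  | storeNat (s : State) (a : ℕ) (i x : NatExp) :
      Runs (.storeNat a i x) s (i.cost + x.cost + 1) (s.setNat a (i.eval s) (x.eval s))
  | storeReal (s : State) (a : ℕ) (i : NatExp) (x : RealExp) :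
      Runs (.storeReal a i x) s (i.cost + x.cost + 1) (s.setReal a (i.eval s) (x.eval s))
  | seq {p q : Program} {s s' s'' : State} {t t' : ℕ} :
      Runs p s t s' → Runs q s' t' s'' → Runs (.seq p q) s (t + t') s''
  | iteTrue {b : Test} {p q : Program} {s s' : State} {t : ℕ} :
      b.Holds s → Runs p s t s' → Runs (.ite b p q) s (b.cost + 1 + t) s'
  | iteFalse {b : Test} {p q : Program} {s s' : State} {t : ℕ} :
      ¬ b.Holds s → Runs q s t s' → Runs (.ite b p q) s (b.cost + 1 + t) s'
  | loopFalse {b : Test} {p : Program} {s : State} :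
      ¬ b.Holds s → Runs (.loop b p) s (b.cost + 1) s
  | loopTrue {b : Test} {p : Program} {s s' s'' : State} {t t' : ℕ} :
      b.Holds s → Runs p s t s' → Runs (.loop b p) s' t' s'' →
      Runs (.loop b p) s (b.cost + 1 + t + t') s''

/-- The initial memory for the points `p 0, …, p (n - 1)` of `ℝ^d`: the natural-number array `0`
holds `n, d`, the real array `0` holds the `n * d` coordinates, point after point, and all other
cells hold `0`. -/
noncomputable def input {n d : ℕ} (p : Fin n → EuclideanSpace ℝ (Fin d)) : State where
  nat a i := if a = 0 ∧ i = 0 then n else if a = 0 ∧ i = 1 then d else 0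
  real a i := if h : a = 0 ∧ i < n * d then p (Fin.divNat ⟨i, h.2⟩) (Fin.modNat ⟨i, h.2⟩) else 0

/-- The point of `ℝ^d` whose coordinates are the first `d` cells of the real array `1`. -/
noncomputable def output (d : ℕ) (s : State) : EuclideanSpace ℝ (Fin d) :=
  WithLp.toLp 2 (fun j : Fin d => s.real 1 j)

end RealRAM

/-!
The idea is that the depth is piecewise linear and that some median is a vertex of the arrangement
of hyperplanes, which can be found by searching all intersection lines.

*Geometry.* With unit normals `a h` and offsets `b h`, the depth of `y` is `distSum`, the sum of the
`|⟪a h, y⟫ - b h|` (`Enumerates.depth_eq`). On a line, it is up to a constant a weighted sum of the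
distances to the points where the line meets the hyperplanes (`distSum_line`), and it is minimized
at a weighted median of these points. Hence every point can be moved, without increasing the depth,
to a point that lies on hyperplanes whose normals span the space (`exists_vertex`); the process ends
because the number of hyperplanes through the point grows. Such a vertex lies on a line that is the
intersection of `d - 1` hyperplanes with linearly independent normals (`exists_tuple_finrank`). So a
point that is at least as good as all points of all these lines is a median
(`Enumerates.isMedian`). This needs that the normals of all hyperplanes span the space, which holds
if the points of `P` do so (`span_normals_eq_top`). Otherwise the points of `P` have depth zero
(`depth_eq_zero`), and for that reason the search starts at a point of `P`.

*The program.* The first stage runs through all `d`-tuples of points. Orthogonal projections,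
computed by rank-one updates of the residuals of the standard basis vectors (`residual_sup`), give
the rank of the differences and a normal; a hyperplane that is not yet in the list is appended
(`WP.collectHyperplanes`). The second stage runs through all `(d - 1)`-tuples of hyperplanes. The
same updates give a common point and the direction of the intersection line, and the best point on
this line is a weighted median of `m` numbers, where `m` is the number of hyperplanes
(`WP.searchAll`). The weighted median is found by extracting minima from a tournament tree, in
`O(m log m)` steps (`WP.selectMedian`). No case distinction is made for tuples with dependent
normals: the points computed for them are harmless candidates.

*Running time.* There are at most `n ^ d / d!` hyperplanes
(`card_hyperplanes_mul_factorial_le`), hence at most `m ^ (d - 1)` tuples, each with `d` line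
searches of `O(m (d + log m))` steps. The surplus factors `d` are compensated by `(d!) ^ d`, and
`log m` is at most `d log n`, in which the factor `d` is compensated likewise. The first stage
compares each of the `n ^ d` tuples with up to `n ^ d / d!` hyperplanes. This is at most
`n ^ (d ^ 2)` for `d ≥ 2`; in dimension one, the comparison would take quadratic time, but there it
is superfluous, because distinct points are distinct hyperplanes (`tupleSpan_ne_of_dim_one`).

*Program verification.* `WP p s T Q` says that the program `p`, started in the memory `s`, halts
after at most `T` steps with a memory that satisfies `Q`. Its rules add up the step bounds, which
are generous. The array names are numerals: those that start with `n` denote arrays of natural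
numbers, those that start with `r` arrays of reals, and a scalar variable occupies cell `0` of an
array of its own. That a program leaves an array unchanged is read off from its text (`Runs.agree`).
-/

/-! ### A program logic for the real RAM -/

namespace RealRAM

open Finset

namespace NatExp

/-- The names of the arrays that an expression reads. -/
def reads : NatExp → List ℕ
  | const _ => []
  | load a i => a :: i.reads
  | add x y => x.reads ++ y.reads
  | sub x y => x.reads ++ y.reads
  | half x => x.reads

/-- The scalar variable stored in cell `0` of the array `a`. -/
abbrev var (a : ℕ) : NatExp := load a (const 0)

theorem eval_congr {s s' : State} (e : NatExp) (h : ∀ a ∈ e.reads, s'.nat a = s.nat a) :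
    e.eval s' = e.eval s := by
  induction e with
  | const k => rfl
  | load a i ih =>
    simp only [reads, List.mem_cons] at h
    simp only [eval]
    rw [ih fun b hb => h b (Or.inr hb), h a (Or.inl rfl)]
  | add x y hx hy =>
    simp only [reads, List.mem_append] at h
    simp only [eval]
    rw [hx fun b hb => h b (Or.inl hb), hy fun b hb => h b (Or.inr hb)]
  | sub x y hx hy =>
    simp only [reads, List.mem_append] at h
    simp only [eval]
    rw [hx fun b hb => h b (Or.inl hb), hy fun b hb => h b (Or.inr hb)]
  | half x hx => simp only [eval]; rw [hx h]

end NatExp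

namespace RealExp

/-- The names of the natural-number arrays that an expression reads. -/
def natReads : RealExp → List ℕ
  | const _ => []
  | load _ i => i.reads
  | add x y => x.natReads ++ y.natReads
  | sub x y => x.natReads ++ y.natReads
  | mul x y => x.natReads ++ y.natReads
  | div x y => x.natReads ++ y.natReads
  | sqrt x => x.natReads

/-- The names of the real arrays that an expression reads. -/
def realReads : RealExp → List ℕ
  | const _ => []
  | load a _ => [a]
  | add x y => x.realReads ++ y.realReads
  | sub x y => x.realReads ++ y.realReads
  | mul x y => x.realReads ++ y.realReads
  | div x y => x.realReads ++ y.realReads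
  | sqrt x => x.realReads

/-- The scalar variable stored in cell `0` of the array `a`. -/
abbrev var (a : ℕ) : RealExp := load a (NatExp.const 0)

theorem eval_congr {s s' : State} (e : RealExp) (h : ∀ a ∈ e.natReads, s'.nat a = s.nat a)
    (h' : ∀ a ∈ e.realReads, s'.real a = s.real a) : e.eval s' = e.eval s := by
  induction e with
  | const k => rfl
  | load a i =>
    simp only [eval]
    rw [NatExp.eval_congr i h, h' a (by simp [realReads])]
  | sqrt x hx => simp only [eval]; rw [hx h h']
  | _ x y hx hy =>
    simp only [natReads, realReads, List.mem_append] at h h'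
    simp only [eval]
    rw [hx (fun b hb => h b (Or.inl hb)) fun b hb => h' b (Or.inl hb),
      hy (fun b hb => h b (Or.inr hb)) fun b hb => h' b (Or.inr hb)]

end RealExp

namespace Program

/-- The names of the natural-number arrays that a program may write. -/
def natWrites : Program → List ℕ
  | skip => []
  | storeNat a _ _ => [a]
  | storeReal _ _ _ => []
  | seq p q => p.natWrites ++ q.natWrites
  | ite _ p q => p.natWrites ++ q.natWrites
  | loop _ p => p.natWrites

/-- The names of the real arrays that a program may write. -/
def realWrites : Program → List ℕ
  | skip => []
  | storeNat _ _ _ => []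
  | storeReal a _ _ => [a]
  | seq p q => p.realWrites ++ q.realWrites
  | ite _ p q => p.realWrites ++ q.realWrites
  | loop _ p => p.realWrites

end Program

namespace State

theorem setNat_nat_of_ne {s : State} {a b i v : ℕ} (h : b ≠ a) :
    (s.setNat a i v).nat b = s.nat b := by
  simp [setNat, Function.update_of_ne h]

theorem setNat_nat_same {s : State} {a i v j : ℕ} :
    (s.setNat a i v).nat a j = if j = i then v else s.nat a j := by
  simp [setNat, Function.update_apply]

@[simp] theorem setNat_real {s : State} {a i v : ℕ} : (s.setNat a i v).real = s.real := rfl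

theorem setReal_real_of_ne {s : State} {a b i : ℕ} {v : ℝ} (h : b ≠ a) :
    (s.setReal a i v).real b = s.real b := by
  simp [setReal, Function.update_of_ne h]

theorem setReal_real_same {s : State} {a i j : ℕ} {v : ℝ} :
    (s.setReal a i v).real a j = if j = i then v else s.real a j := by
  simp [setReal, Function.update_apply]

@[simp] theorem setReal_nat {s : State} {a i : ℕ} {v : ℝ} : (s.setReal a i v).nat = s.nat := rfl

end State

/-- The memories `s` and `s'` agree on all arrays that `p` does not write. -/
structure Agree (p : Program) (s s' : State) : Prop where
  nat : ∀ a, a ∉ p.natWrites → s'.nat a = s.nat a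
  real : ∀ a, a ∉ p.realWrites → s'.real a = s.real a

theorem Agree.refl (p : Program) (s : State) : Agree p s s := ⟨fun _ _ => rfl, fun _ _ => rfl⟩

theorem Agree.trans {p : Program} {s s' s'' : State} (h : Agree p s s') (h' : Agree p s' s'') :
    Agree p s s'' :=
  ⟨fun a ha => (h'.nat a ha).trans (h.nat a ha), fun a ha => (h'.real a ha).trans (h.real a ha)⟩

theorem Agree.mono {p q : Program} {s s' : State} (h : Agree p s s')
    (hn : p.natWrites ⊆ q.natWrites) (hr : p.realWrites ⊆ q.realWrites) : Agree q s s' :=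
  ⟨fun a ha => h.nat a fun h => ha (hn h), fun a ha => h.real a fun h => ha (hr h)⟩

theorem Agree.natEval {p : Program} {s s' : State} (h : Agree p s s') (e : NatExp)
    (he : ∀ a ∈ e.reads, a ∉ p.natWrites) : e.eval s' = e.eval s :=
  e.eval_congr fun a ha => h.nat a (he a ha)

theorem Agree.realEval {p : Program} {s s' : State} (h : Agree p s s') (e : RealExp)
    (he : ∀ a ∈ e.natReads, a ∉ p.natWrites) (he' : ∀ a ∈ e.realReads, a ∉ p.realWrites) :
    e.eval s' = e.eval s :=
  e.eval_congr (fun a ha => h.nat a (he a ha)) fun a ha => h.real a (he' a ha)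

/-- The frame property: a run changes only arrays that the program mentions as targets. -/
theorem Runs.agree {p : Program} {s s' : State} {t : ℕ} (h : Runs p s t s') : Agree p s s' := by
  induction h with
  | skip s => exact Agree.refl _ _
  | storeNat s a i x =>
    exact ⟨fun b hb => State.setNat_nat_of_ne (by simpa [Program.natWrites] using hb),
      fun b _ => rfl⟩
  | storeReal s a i x =>
    exact ⟨fun b _ => rfl,
      fun b hb => State.setReal_real_of_ne (by simpa [Program.realWrites] using hb)⟩
  | seq _ _ h h' =>
    exact (h.mono (by simp [Program.natWrites]) (by simp [Program.realWrites])).trans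
      (h'.mono (by simp [Program.natWrites]) (by simp [Program.realWrites]))
  | iteTrue _ _ h => exact h.mono (by simp [Program.natWrites]) (by simp [Program.realWrites])
  | iteFalse _ _ h => exact h.mono (by simp [Program.natWrites]) (by simp [Program.realWrites])
  | loopFalse _ => exact Agree.refl _ _
  | loopTrue _ _ _ h h' => exact Agree.trans ⟨h.nat, h.real⟩ h'

/-- Total correctness with a time bound: started in the memory `s`, the program `p` halts after at
most `T` steps with a memory that satisfies `Q`. -/
def WP (p : Program) (s : State) (T : ℕ) (Q : State → Prop) : Prop :=
  ∃ t s', Runs p s t s' ∧ t ≤ T ∧ Q s'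

namespace WP

variable {p q : Program} {s : State} {T T' : ℕ} {Q Q' : State → Prop}

theorem le (h : WP p s T Q) (hT : T ≤ T') : WP p s T' Q := by
  obtain ⟨t, s', hr, ht, hq⟩ := h
  exact ⟨t, s', hr, ht.trans hT, hq⟩

/-- The rule of consequence. The frame condition `Agree p s s'` is available for free. -/
theorem post (h : WP p s T Q) (hQ : ∀ s', Agree p s s' → Q s' → Q' s') : WP p s T Q' := by
  obtain ⟨t, s', hr, ht, hq⟩ := h
  exact ⟨t, s', hr, ht, hQ s' hr.agree hq⟩

theorem skip (h : Q s) : WP .skip s 1 Q := ⟨1, s, .skip s, le_rfl, h⟩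

theorem storeNat {a : ℕ} {i x : NatExp} (h : Q (s.setNat a (i.eval s) (x.eval s))) :
    WP (.storeNat a i x) s (i.cost + x.cost + 1) Q := ⟨_, _, .storeNat s a i x, le_rfl, h⟩

theorem storeReal {a : ℕ} {i : NatExp} {x : RealExp}
    (h : Q (s.setReal a (i.eval s) (x.eval s))) :
    WP (.storeReal a i x) s (i.cost + x.cost + 1) Q := ⟨_, _, .storeReal s a i x, le_rfl, h⟩

theorem seq (h : WP p s T Q') (h' : ∀ s', Agree p s s' → Q' s' → WP q s' T' Q) :
    WP (.seq p q) s (T + T') Q := by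
  obtain ⟨t, s', hr, ht, hq⟩ := h
  obtain ⟨t', s'', hr', ht', hq'⟩ := h' s' hr.agree hq
  exact ⟨_, _, .seq hr hr', add_le_add ht ht', hq'⟩

theorem ite {b : Test} (h : b.Holds s → WP p s T Q) (h' : ¬ b.Holds s → WP q s T Q) :
    WP (.ite b p q) s (b.cost + 1 + T) Q := by
  by_cases hb : b.Holds s
  · obtain ⟨t, s', hr, ht, hq⟩ := h hb
    exact ⟨_, _, .iteTrue hb hr, by omega, hq⟩
  · obtain ⟨t, s', hr, ht, hq⟩ := h' hb
    exact ⟨_, _, .iteFalse hb hr, by omega, hq⟩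

/-- The rule for a loop with at most `N` rounds, of at most `B` steps each: `I k` holds after `k`
rounds. -/
theorem loop {b : Test} {N B : ℕ} (I : ℕ → State → Prop) (h0 : I 0 s)
    (hstep : ∀ k s', Agree p s s' → I k s' → b.Holds s' → k < N ∧ WP p s' B (I (k + 1)))
    (hexit : ∀ k s', Agree p s s' → I k s' → ¬ b.Holds s' → Q s') :
    WP (.loop b p) s (N * (b.cost + 1 + B) + (b.cost + 1)) Q := by
  suffices H : ∀ r k s', N = k + r → Agree p s s' → I k s' →
      WP (.loop b p) s' (r * (b.cost + 1 + B) + (b.cost + 1)) Q from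
    H N 0 s (by simp) (Agree.refl _ _) h0
  intro r
  induction r with
  | zero =>
    intro k s' hk ha hI
    by_cases hb : b.Holds s'
    · exact absurd (hstep k s' ha hI hb).1 (by omega)
    · exact ⟨_, _, .loopFalse hb, by omega, hexit k s' ha hI hb⟩
  | succ r ih =>
    intro k s' hk ha hI
    by_cases hb : b.Holds s'
    · obtain ⟨t, s1, hr, ht, hI1⟩ := (hstep k s' ha hI hb).2
      obtain ⟨t', s2, hr', ht', hq⟩ := ih (k + 1) s1 (by omega) (ha.trans hr.agree) hI1
      refine ⟨_, _, .loopTrue hb hr hr', ?_, hq⟩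
      rw [add_mul, one_mul]
      omega
    · exact ⟨_, _, .loopFalse hb, by nlinarith [Nat.zero_le ((r + 1) * (b.cost + 1 + B))],
        hexit k s' ha hI hb⟩

end WP

/-- `for i = 0, …, N - 1 do p` -/
def forLoop (i : ℕ) (N : NatExp) (p : Program) : Program :=
  .seq (.storeNat i (.const 0) (.const 0))
    (.loop (.natLt (.var i) N)
      (.seq p (.storeNat i (.const 0) (.add (.var i) (.const 1)))))

@[simp] theorem natWrites_forLoop (i : ℕ) (N : NatExp) (p : Program) :
    (forLoop i N p).natWrites = i :: (p.natWrites ++ [i]) := rfl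

@[simp] theorem realWrites_forLoop (i : ℕ) (N : NatExp) (p : Program) :
    (forLoop i N p).realWrites = p.realWrites := by
  simp [forLoop, Program.realWrites]

/-- The rule for a counting loop: `I k` holds before the round with counter value `k`. The constants
`10` leave room for the test and for the update of the counter. -/
theorem WP.forLoop {i : ℕ} {N : NatExp} {p : Program} {s : State} {n B : ℕ} (I : ℕ → State → Prop)
    (hn : N.eval s = n) (hi : i ∉ p.natWrites) (hN : ∀ a ∈ N.reads, a ∉ (forLoop i N p).natWrites)
    (hI : ∀ k s' v, I k s' → I k (s'.setNat i 0 v)) (h0 : I 0 s)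
    (hp : ∀ k s', k < n → Agree (RealRAM.forLoop i N p) s s' → s'.nat i 0 = k → I k s' →
      WP p s' B (I (k + 1))) :
    WP (forLoop i N p) s (n * (N.cost + B + 10) + (N.cost + 10)) (I n) := by
  have hloop : ∀ s', Agree (RealRAM.forLoop i N p) s s' → s'.nat i 0 = 0 → I 0 s' →
      WP (.loop (.natLt (.var i) N)
        (.seq p (.storeNat i (.const 0) (.add (.var i) (.const 1))))) s'
        (n * ((Test.natLt (.var i) N).cost + 1 + (B + 6)) +
          ((Test.natLt (.var i) N).cost + 1)) (I n) := by
    intro s0 ha0 hi0 hI0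
    refine WP.loop (fun k s' => s'.nat i 0 = k ∧ k ≤ n ∧ I k s')
      (show _ ∧ _ ∧ _ from ⟨hi0, Nat.zero_le _, hI0⟩) ?_ ?_
    · rintro k s' ha ⟨hk, hkn, hIk⟩ hb
      have ha' : Agree (RealRAM.forLoop i N p) s s' :=
        ha0.trans (ha.mono (by simp [Program.natWrites]) (by simp [Program.realWrites]))
      have hlt : k < n := by
        have : s'.nat i 0 < N.eval s' := hb
        rwa [ha'.natEval N hN, hn, hk] at this
      refine ⟨hlt, WP.seq (T' := 6) (hp k s' hlt ha' hk hIk) fun s1 ha1 hI1 => ?_⟩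
      refine WP.storeNat ?_
      refine ⟨?_, hlt, hI _ _ _ hI1⟩
      simp [State.setNat_nat_same, NatExp.eval, ha1.nat i hi, hk]
    · rintro k s' ha ⟨hk, hkn, hIk⟩ hb
      have ha' : Agree (RealRAM.forLoop i N p) s s' :=
        ha0.trans (ha.mono (by simp [Program.natWrites]) (by simp [Program.realWrites]))
      have hge : ¬ s'.nat i 0 < N.eval s' := hb
      rw [ha'.natEval N hN, hn, hk] at hge
      rwa [show n = k by omega]
  refine WP.le (WP.seq (T' := (n * ((Test.natLt (.var i) N).cost + 1 + (B + 6)) +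
          ((Test.natLt (.var i) N).cost + 1)))
    (WP.storeNat (Q := fun s' => s'.nat i 0 = 0 ∧ I 0 s') ⟨?_, hI _ _ _ h0⟩) ?_) ?_
  · simp [State.setNat_nat_same, NatExp.eval]
  · rintro s' ha ⟨h1, h2⟩
    refine hloop s' (ha.mono ?_ ?_) h1 h2
    · simp [Program.natWrites]
    · simp [Program.realWrites]
  · simp only [Test.cost, NatExp.cost]
    nlinarith [Nat.zero_le n]

/-- `x := ∑ i < N, e`, accumulated in the scalar variable `x` -/
def sumLoop (i : ℕ) (N : NatExp) (x : ℕ) (e : RealExp) : Program :=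
  .seq (.storeReal x (.const 0) (.const 0))
    (forLoop i N (.storeReal x (.const 0) (.add (.var x) e)))

/-- The value of the expression in round `k` has to be `v k`, whatever the partial sum is. -/
theorem WP.sumLoop {i : ℕ} {N : NatExp} {x : ℕ} {e : RealExp} {s : State} (v : ℕ → ℝ)
    (hN : i ∉ N.reads)
    (he : ∀ k s', k < N.eval s → Agree (sumLoop i N x e) s s' → s'.nat i 0 = k →
      e.eval s' = v k) :
    WP (sumLoop i N x e) s (N.eval s * (N.cost + e.cost + 20) + (N.cost + 20))
      (fun s' => s'.real x 0 = ∑ k ∈ range (N.eval s), v k) := by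
  refine WP.le (WP.seq (T' := N.eval s * (N.cost + (e.cost + 5) + 10) + (N.cost + 10))
    (WP.storeReal (Q := fun s' => s'.real x 0 = 0) ?_) fun s1 ha1 h1 => ?_) ?_
  · simp [State.setReal_real_same, NatExp.eval, RealExp.eval]
  · have hN1 : N.eval s1 = N.eval s := ha1.natEval N (by simp [Program.natWrites])
    have := WP.forLoop (i := i) (N := N) (p := .storeReal x (.const 0) (.add (.var x) e)) (s := s1)
      (B := e.cost + 5) (fun k s' => s'.real x 0 = ∑ k ∈ range k, v k) rfl (by simp [Program.natWrites])
      (by simpa [Program.natWrites] using fun a ha (h : a = i) => hN (h ▸ ha)) (fun _ _ _ h => h)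
      (by simpa using h1) ?_
    · rwa [hN1] at this
    · intro k s' hk ha hi hI
      refine WP.le (WP.storeReal ?_) (by simp [NatExp.cost, RealExp.cost]; omega)
      have hev : e.eval s' = v k := he k s' (hN1 ▸ hk)
        ((ha1.mono (by simp [Program.natWrites]) (by simp [RealRAM.sumLoop, Program.realWrites])).trans
          (ha.mono (by simp [RealRAM.sumLoop, Program.natWrites])
            (by simp [RealRAM.sumLoop, Program.realWrites]))) hi
      simp [State.setReal_real_same, NatExp.eval, RealExp.eval, hev, hI, sum_range_succ]
  · simp only [NatExp.cost, RealExp.cost]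
    nlinarith [Nat.zero_le (N.eval s)]

/-- `A[o + i] := e` for all `i < N` -/
def mapLoop (i : ℕ) (N : NatExp) (A : ℕ) (o : NatExp) (e : RealExp) : Program :=
  forLoop i N (.storeReal A (.add o (.var i)) e)

/-- The expression `e` may read the array `A`, but its value in round `k` has to be determined by
the cells that are not yet overwritten. -/
theorem WP.mapLoop {i : ℕ} {N : NatExp} {A : ℕ} {o : NatExp} {e : RealExp} {s : State} (v : ℕ → ℝ)
    (hN : i ∉ N.reads) (ho : i ∉ o.reads)
    (he : ∀ k s', k < N.eval s → Agree (mapLoop i N A o e) s s' → s'.nat i 0 = k →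
      (∀ j, o.eval s + k ≤ j → s'.real A j = s.real A j) → e.eval s' = v k) :
    WP (mapLoop i N A o e) s (N.eval s * (N.cost + o.cost + e.cost + 20) + (N.cost + 20))
      (fun s' => ∀ j, s'.real A j =
        if o.eval s ≤ j ∧ j < o.eval s + N.eval s then v (j - o.eval s) else s.real A j) := by
  refine WP.le (WP.forLoop (B := o.cost + e.cost + 10) (fun k s' => ∀ j, s'.real A j =
        if o.eval s ≤ j ∧ j < o.eval s + k then v (j - o.eval s) else s.real A j)
      rfl (by simp [Program.natWrites])
      (by simpa [Program.natWrites] using fun a ha (h : a = i) => hN (h ▸ ha)) (fun _ _ _ h => h)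
      (fun j => by rw [if_neg]; omega) ?_) (by nlinarith [Nat.zero_le (N.eval s)])
  intro k s' hk ha hi hI
  refine WP.le (WP.storeReal ?_) (by simp [NatExp.cost]; omega)
  have ho' : o.eval s' = o.eval s :=
    ha.natEval o (by simpa [Program.natWrites] using fun a ha (h : a = i) => ho (h ▸ ha))
  have hev : e.eval s' = v k := he k s' hk ha hi fun j hj => by rw [hI, if_neg]; omega
  intro j
  simp only [State.setReal_real_same, NatExp.eval, hev, hi, ho', hI]
  by_cases hj : j = o.eval s + k
  · simp [hj]
  · rw [if_neg hj]
    by_cases h1 : o.eval s ≤ j ∧ j < o.eval s + k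
    · rw [if_pos h1, if_pos (by omega)]
    · rw [if_neg h1, if_neg (by omega)]

end RealRAM

/-! ### Vector operations -/

namespace RealRAM

open Finset

/-- The name of the array with the input sizes: cell `0` holds the number of points and cell `1`
holds the dimension. -/
abbrev nIn : ℕ := 0

/-- The loop variable of the vector operations. -/
abbrev nL : ℕ := 1

/-- The dimension. -/
abbrev dimE : NatExp := .load nIn (.const 1)

/-- The vector stored in the cells `o, …, o + d - 1` of the real array `A`. -/
noncomputable def vec (d : ℕ) (s : State) (A o : ℕ) : EuclideanSpace ℝ (Fin d) :=
  WithLp.toLp 2 fun j => s.real A (o + j)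

@[simp] theorem vec_apply (d : ℕ) (s : State) (A o : ℕ) (j : Fin d) :
    vec d s A o j = s.real A (o + j) := rfl

theorem vec_congr {d : ℕ} {s s' : State} {A o : ℕ} (h : s'.real A = s.real A) :
    vec d s' A o = vec d s A o := by
  simp only [vec, h]

theorem inner_vec {d : ℕ} {s s' : State} {A o B o' : ℕ} :
    inner ℝ (vec d s A o) (vec d s' B o') =
      ∑ k ∈ range d, s.real A (o + k) * s'.real B (o' + k) := by
  rw [sum_range, PiLp.inner_apply]
  simp [mul_comm]

/-- `x := ⟨u, v⟩` for the vectors `u` at `A[oa]` and `v` at `B[ob]` -/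
def dotLoop (A : ℕ) (oa : NatExp) (B : ℕ) (ob : NatExp) (x : ℕ) : Program :=
  sumLoop nL dimE x (.mul (.load A (.add oa (.var nL))) (.load B (.add ob (.var nL))))

@[simp] theorem natWrites_dotLoop (A : ℕ) (oa : NatExp) (B : ℕ) (ob : NatExp) (x : ℕ) :
    (dotLoop A oa B ob x).natWrites = [nL, nL] := rfl

@[simp] theorem realWrites_dotLoop (A : ℕ) (oa : NatExp) (B : ℕ) (ob : NatExp) (x : ℕ) :
    (dotLoop A oa B ob x).realWrites = [x, x] := rfl

/-- The step bounds of the vector operations are linear in the dimension, because the offsets are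
expressions of bounded cost: there is no multiplication of natural numbers, so offsets of the form
`i * d` are loaded from tables. -/
theorem WP.dotLoop {d : ℕ} {s : State} (hd : s.nat nIn 1 = d) {A B x : ℕ} {oa ob : NatExp}
    (ha : nL ∉ oa.reads) (hb : nL ∉ ob.reads) (hA : A ≠ x) (hB : B ≠ x)
    (hc : oa.cost + ob.cost ≤ 10) :
    WP (dotLoop A oa B ob x) s (50 * d + 30) (fun s' =>
      s'.real x 0 = inner ℝ (vec d s A (oa.eval s)) (vec d s B (ob.eval s))) := by
  have hN : dimE.eval s = d := hd
  refine WP.le (WP.post (WP.sumLoop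
    (fun k => s.real A (oa.eval s + k) * s.real B (ob.eval s + k)) (by decide) ?_) ?_) ?_
  · intro k s' hk hag hi
    have hag : Agree (RealRAM.dotLoop A oa B ob x) s s' := hag
    have h1 := hag.natEval oa (by simpa using fun a h (e : a = nL) => ha (e ▸ h))
    have h2 := hag.natEval ob (by simpa using fun a h (e : a = nL) => hb (e ▸ h))
    simp [RealExp.eval, NatExp.eval, h1, h2, hi, hag.real A (by simpa using hA),
      hag.real B (by simpa using hB)]
  · intro s' _ h
    rw [h, inner_vec, hN]
  · rw [hN]
    simp only [NatExp.cost, RealExp.cost]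
    nlinarith [Nat.zero_le d]

/-- `w := u + c • v` for the vectors `u` at `A[oa]`, `v` at `B[ob]` and `w` at `W[ow]` -/
def axpyLoop (W : ℕ) (ow : NatExp) (A : ℕ) (oa : NatExp) (c : RealExp) (B : ℕ) (ob : NatExp) :
    Program :=
  mapLoop nL dimE W ow
    (.add (.load A (.add oa (.var nL))) (.mul c (.load B (.add ob (.var nL)))))

@[simp] theorem natWrites_axpyLoop (W : ℕ) (ow : NatExp) (A : ℕ) (oa : NatExp) (c : RealExp)
    (B : ℕ) (ob : NatExp) : (axpyLoop W ow A oa c B ob).natWrites = [nL, nL] := rfl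

@[simp] theorem realWrites_axpyLoop (W : ℕ) (ow : NatExp) (A : ℕ) (oa : NatExp) (c : RealExp)
    (B : ℕ) (ob : NatExp) : (axpyLoop W ow A oa c B ob).realWrites = [W] := rfl

/-- The vector `u` may be overwritten in place, the vector `v` may not. -/
theorem WP.axpyLoop {d : ℕ} {s : State} (hd : s.nat nIn 1 = d) {W A B : ℕ} {ow oa ob : NatExp}
    {c : RealExp} (hw : nL ∉ ow.reads) (ha : nL ∉ oa.reads) (hb : nL ∉ ob.reads)
    (hcn : nL ∉ c.natReads) (hcr : W ∉ c.realReads) (hA : A ≠ W ∨ A = W ∧ oa = ow) (hB : B ≠ W)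
    (hc : ow.cost + oa.cost + ob.cost + c.cost ≤ 30) :
    WP (axpyLoop W ow A oa c B ob) s (70 * d + 30) (fun s' =>
      vec d s' W (ow.eval s) =
        vec d s A (oa.eval s) + c.eval s • vec d s B (ob.eval s) ∧
      ∀ j, (j < ow.eval s ∨ ow.eval s + d ≤ j) → s'.real W j = s.real W j) := by
  have hN : dimE.eval s = d := hd
  refine WP.le (WP.post (WP.mapLoop (fun k => s.real A (oa.eval s + k) +
    c.eval s * s.real B (ob.eval s + k)) (by decide) hw ?_) ?_) ?_
  · intro k s' hk hag hi hj
    have hag : Agree (RealRAM.axpyLoop W ow A oa c B ob) s s' := hag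
    have h1 := hag.natEval oa (by simpa using fun a h (e : a = nL) => ha (e ▸ h))
    have h2 := hag.natEval ob (by simpa using fun a h (e : a = nL) => hb (e ▸ h))
    have h3 := hag.realEval c (by simpa using fun a h (e : a = nL) => hcn (e ▸ h))
      (by simpa using fun a h (e : a = W) => hcr (e ▸ h))
    simp only [RealExp.eval, NatExp.eval, h1, h2, h3, hi, hag.real B (by simpa using hB)]
    rcases hA with hA | ⟨rfl, rfl⟩
    · rw [hag.real A (by simpa using hA)]
    · rw [hj _ le_rfl]
  · intro s' _ h
    rw [hN] at h
    refine ⟨?_, fun j hj => ?_⟩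
    · ext j
      have := h (ow.eval s + j)
      rw [if_pos ⟨by omega, by omega⟩] at this
      simp [this]
    · rw [h, if_neg]
      omega
  · rw [hN]
    simp only [NatExp.cost, RealExp.cost]
    nlinarith [Nat.zero_le d]

/-- `w := c • v` for the vectors `v` at `B[ob]` and `w` at `W[ow]` -/
def scaleLoop (W : ℕ) (ow : NatExp) (c : RealExp) (B : ℕ) (ob : NatExp) : Program :=
  mapLoop nL dimE W ow (.mul c (.load B (.add ob (.var nL))))

@[simp] theorem natWrites_scaleLoop (W : ℕ) (ow : NatExp) (c : RealExp) (B : ℕ) (ob : NatExp) :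
    (scaleLoop W ow c B ob).natWrites = [nL, nL] := rfl

@[simp] theorem realWrites_scaleLoop (W : ℕ) (ow : NatExp) (c : RealExp) (B : ℕ) (ob : NatExp) :
    (scaleLoop W ow c B ob).realWrites = [W] := rfl

theorem WP.scaleLoop {d : ℕ} {s : State} (hd : s.nat nIn 1 = d) {W B : ℕ} {ow ob : NatExp}
    {c : RealExp} (hw : nL ∉ ow.reads) (hb : nL ∉ ob.reads)
    (hcn : nL ∉ c.natReads) (hcr : W ∉ c.realReads) (hB : B ≠ W)
    (hc : ow.cost + ob.cost + c.cost ≤ 30) :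
    WP (scaleLoop W ow c B ob) s (70 * d + 30) (fun s' =>
      vec d s' W (ow.eval s) = c.eval s • vec d s B (ob.eval s) ∧
      ∀ j, (j < ow.eval s ∨ ow.eval s + d ≤ j) → s'.real W j = s.real W j) := by
  have hN : dimE.eval s = d := hd
  refine WP.le (WP.post (WP.mapLoop (fun k =>
    c.eval s * s.real B (ob.eval s + k)) (by decide) hw ?_) ?_) ?_
  · intro k s' hk hag hi hj
    have hag : Agree (RealRAM.scaleLoop W ow c B ob) s s' := hag
    have h2 := hag.natEval ob (by simpa using fun a h (e : a = nL) => hb (e ▸ h))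
    have h3 := hag.realEval c (by simpa using fun a h (e : a = nL) => hcn (e ▸ h))
      (by simpa using fun a h (e : a = W) => hcr (e ▸ h))
    simp only [RealExp.eval, NatExp.eval, h2, h3, hi, hag.real B (by simpa using hB)]
  · intro s' _ h
    rw [hN] at h
    refine ⟨?_, fun j hj => ?_⟩
    · ext j
      have := h (ow.eval s + j)
      rw [if_pos ⟨by omega, by omega⟩] at this
      simp [this]
    · rw [h, if_neg]
      omega
  · rw [hN]
    simp only [NatExp.cost, RealExp.cost]
    nlinarith [Nat.zero_le d]

end RealRAM

/-! ### Orthogonal residuals -/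

namespace HDD

open Finset Module

section Residual

variable {E : Type*} [NormedAddCommGroup E] [InnerProductSpace ℝ E] [FiniteDimensional ℝ E]

/-- The component of `v` that is orthogonal to the subspace `S`. -/
noncomputable def residual (S : Submodule ℝ E) (v : E) : E := Sᗮ.starProjection v

theorem residual_mem (S : Submodule ℝ E) (v : E) : residual S v ∈ Sᗮ :=
  Submodule.starProjection_apply_mem _ _

theorem sub_residual_mem (S : Submodule ℝ E) (v : E) : v - residual S v ∈ S := by
  have := Submodule.sub_starProjection_mem_orthogonal (K := Sᗮ) v
  rwa [Submodule.orthogonal_orthogonal] at this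

theorem residual_eq_of_mem {S : Submodule ℝ E} {u v : E} (h : u ∈ Sᗮ) (h' : v - u ∈ S) :
    residual S v = u :=
  Submodule.eq_starProjection_of_mem_orthogonal h
    (by rwa [Submodule.orthogonal_orthogonal])

theorem residual_bot (v : E) : residual (⊥ : Submodule ℝ E) v = v :=
  residual_eq_of_mem (by simp) (by simp)

theorem residual_eq_zero_iff {S : Submodule ℝ E} {v : E} : residual S v = 0 ↔ v ∈ S := by
  refine ⟨fun h => ?_, fun h => residual_eq_of_mem (zero_mem _) (by simpa using h)⟩
  simpa [h] using sub_residual_mem S v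

theorem inner_residual_left {S : Submodule ℝ E} (v : E) {w : E} (hw : w ∈ Sᗮ) :
    inner ℝ (residual S v) w = inner ℝ v w := by
  have := Submodule.inner_right_of_mem_orthogonal (sub_residual_mem S v) hw
  rw [inner_sub_left] at this
  linarith

theorem inner_residual_comm (S : Submodule ℝ E) (v w : E) :
    inner ℝ (residual S v) w = inner ℝ v (residual S w) := by
  rw [← inner_residual_left v (residual_mem S w), real_inner_comm,
    ← inner_residual_left w (residual_mem S v), real_inner_comm]

/-- If `r` is the residual of `a`, then subtracting the component along `r` makes a vector that is
orthogonal to `S` orthogonal to `a` as well. This also holds for `r = 0`, where the coefficient is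
a quotient by zero. -/
theorem sub_smul_residual_mem {S : Submodule ℝ E} (a : E) {w : E} (hw : w ∈ Sᗮ) :
    w - (inner ℝ a w / inner ℝ (residual S a) (residual S a)) • residual S a ∈
      (S ⊔ Submodule.span ℝ {a})ᗮ := by
  rw [← Submodule.inf_orthogonal]
  refine ⟨sub_mem hw (Submodule.smul_mem _ _ (residual_mem _ _)), ?_⟩
  rw [SetLike.mem_coe, Submodule.mem_orthogonal_singleton_iff_inner_right, inner_sub_right,
    inner_smul_right, ← inner_residual_left a (residual_mem S a)]
  by_cases hr : residual S a = 0
  · have : inner ℝ a w = 0 := Submodule.inner_right_of_mem_orthogonal (residual_eq_zero_iff.1 hr) hw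
    simp [hr, this]
  · rw [div_mul_cancel₀ _ (by simpa using hr), sub_self]

/-- The rank-one update of a residual for one more spanning vector `a`. If `a` already lies in `S`,
the quotient is `0 / 0 = 0` and nothing changes. -/
theorem residual_sup (S : Submodule ℝ E) (a v : E) :
    residual (S ⊔ Submodule.span ℝ {a}) v = residual S v -
      (inner ℝ (residual S a) v / inner ℝ (residual S a) (residual S a)) • residual S a := by
  rw [inner_residual_comm S a v]
  refine residual_eq_of_mem (sub_smul_residual_mem a (residual_mem S v)) ?_
  have h1 : v - residual S v ∈ S ⊔ Submodule.span ℝ {a} :=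
    Submodule.mem_sup_left (sub_residual_mem S v)
  have h2 : residual S a ∈ S ⊔ Submodule.span ℝ {a} := by
    have h3 : a - residual S a ∈ S ⊔ Submodule.span ℝ {a} :=
      Submodule.mem_sup_left (sub_residual_mem S a)
    have h4 : a ∈ S ⊔ Submodule.span ℝ {a} :=
      Submodule.mem_sup_right (Submodule.mem_span_singleton_self a)
    simpa using sub_mem h4 h3
  rw [sub_sub_eq_add_sub, add_sub_right_comm]
  exact add_mem h1 (Submodule.smul_mem _ _ h2)

theorem finrank_sup_span_singleton (S : Submodule ℝ E) (a : E) [Decidable (residual S a = 0)] :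
    finrank ℝ (S ⊔ Submodule.span ℝ {a} : Submodule ℝ E) =
      finrank ℝ S + if residual S a = 0 then 0 else 1 := by
  split_ifs with h
  · rw [residual_eq_zero_iff] at h
    rw [sup_eq_left.2 (by simpa using h), add_zero]
  · have ha : a ∉ S := fun h' => h (residual_eq_zero_iff.2 h')
    have ha0 : a ≠ 0 := fun h' => ha (h' ▸ zero_mem S)
    have h1 := Submodule.finrank_sup_add_finrank_inf_eq S (Submodule.span ℝ {a})
    have h2 : S ⊓ Submodule.span ℝ {a} = ⊥ :=
      (Submodule.disjoint_span_singleton' ha0).2 ha |>.eq_bot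
    rw [h2, finrank_bot, finrank_span_singleton ha0] at h1
    omega

theorem finrank_orthogonal_eq_one {S : Submodule ℝ E} (h : finrank ℝ S + 1 = finrank ℝ E) :
    finrank ℝ Sᗮ = 1 := by
  have := Submodule.finrank_add_finrank_orthogonal S
  omega

theorem exists_smul_of_finrank {S : Submodule ℝ E} (h : finrank ℝ S + 1 = finrank ℝ E) {v w : E}
    (hv : v ∈ Sᗮ) (hv0 : v ≠ 0) (hw : w ∈ Sᗮ) : ∃ t : ℝ, w = t • v := by
  have h1 := (finrank_eq_one_iff_of_nonzero' (⟨v, hv⟩ : Sᗮ) (by simpa using hv0)).1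
    (finrank_orthogonal_eq_one h) ⟨w, hw⟩
  obtain ⟨t, ht⟩ := h1
  exact ⟨t, by simpa using congrArg Subtype.val ht.symm⟩

end Residual

/-- The `k`-th standard basis vector (zero for `d ≤ k`). -/
noncomputable def unitVec (d k : ℕ) : EuclideanSpace ℝ (Fin d) :=
  WithLp.toLp 2 fun j => if (j : ℕ) = k then 1 else 0

theorem unitVec_apply {d k : ℕ} (j : Fin d) : unitVec d k j = if (j : ℕ) = k then 1 else 0 := rfl

theorem inner_unitVec {d : ℕ} (v : EuclideanSpace ℝ (Fin d)) (j : Fin d) :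
    inner ℝ v (unitVec d j) = v j := by
  simp [PiLp.inner_apply, unitVec_apply, Fin.val_inj]

/-- If all standard basis vectors have residual zero, then so has every vector. -/
theorem exists_residual_ne_zero {d : ℕ} {S : Submodule ℝ (EuclideanSpace ℝ (Fin d))}
    (h : S ≠ ⊤) : ∃ k < d, residual S (unitVec d k) ≠ 0 := by
  by_contra! hk
  apply h
  rw [eq_top_iff]
  intro v _
  rw [← residual_eq_zero_iff]
  ext j
  rw [← inner_unitVec, inner_residual_comm, hk j j.2]
  simp

/-! ### Weighted medians -/

/-- If the elements up to `τ` carry at least half of the weight, and so do those from `τ` on, then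
`τ` minimizes the weighted sum of distances. The sets `A` and `B` witness the two conditions. -/
theorem weightedMedian_le {ι : Type*} [DecidableEq ι] {s A B : Finset ι} {w t : ι → ℝ} {τ : ℝ}
    (hw : ∀ i ∈ s, 0 ≤ w i) (hA : A ⊆ s) (hB : B ⊆ s)
    (hA1 : ∀ i ∈ A, t i ≤ τ) (hA2 : ∑ i ∈ s, w i ≤ 2 * ∑ i ∈ A, w i)
    (hB1 : ∀ i ∈ s \ B, τ ≤ t i) (hB2 : 2 * ∑ i ∈ B, w i ≤ ∑ i ∈ s, w i) (x : ℝ) :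
    ∑ i ∈ s, w i * |τ - t i| ≤ ∑ i ∈ s, w i * |x - t i| := by
  rcases le_total τ x with h | h
  · have h1 : ∑ i ∈ A, w i * |τ - t i| + (x - τ) * ∑ i ∈ A, w i ≤ ∑ i ∈ A, w i * |x - t i| := by
      rw [mul_sum, ← sum_add_distrib]
      refine sum_le_sum fun i hi => ?_
      rw [abs_of_nonneg (by linarith [hA1 i hi]), abs_of_nonneg (by linarith [hA1 i hi])]
      linarith
    have h2 : ∑ i ∈ s \ A, w i * |τ - t i| - (x - τ) * ∑ i ∈ s \ A, w i ≤
        ∑ i ∈ s \ A, w i * |x - t i| := by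
      rw [mul_sum, ← sum_sub_distrib]
      refine sum_le_sum fun i hi => ?_
      have h3 : |τ - t i| - (x - τ) ≤ |x - t i| := by
        have := abs_sub_abs_le_abs_sub (τ - t i) (x - t i)
        rw [show τ - t i - (x - t i) = -(x - τ) by ring, abs_neg,
          abs_of_nonneg (sub_nonneg.2 h)] at this
        linarith
      nlinarith [hw i (sdiff_subset hi)]
    rw [← sum_sdiff hA, ← sum_sdiff (f := fun i => w i * |x - t i|) hA]
    rw [← sum_sdiff hA] at hA2
    nlinarith
  · have h1 : ∑ i ∈ s \ B, w i * |τ - t i| + (τ - x) * ∑ i ∈ s \ B, w i ≤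
        ∑ i ∈ s \ B, w i * |x - t i| := by
      rw [mul_sum, ← sum_add_distrib]
      refine sum_le_sum fun i hi => ?_
      rw [abs_of_nonpos (by linarith [hB1 i hi]), abs_of_nonpos (by linarith [hB1 i hi])]
      linarith
    have h2 : ∑ i ∈ B, w i * |τ - t i| - (τ - x) * ∑ i ∈ B, w i ≤
        ∑ i ∈ B, w i * |x - t i| := by
      rw [mul_sum, ← sum_sub_distrib]
      refine sum_le_sum fun i hi => ?_
      have h3 : |τ - t i| - (τ - x) ≤ |x - t i| := by
        have := abs_sub_abs_le_abs_sub (τ - t i) (x - t i)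
        rw [show τ - t i - (x - t i) = τ - x by ring, abs_of_nonneg (sub_nonneg.2 h)] at this
        linarith
      nlinarith [hw i (hB hi)]
    rw [← sum_sdiff hB, ← sum_sdiff (f := fun i => w i * |x - t i|) hB]
    rw [← sum_sdiff hB] at hB2
    nlinarith

/-- A weighted sum of distances on the real line is minimized at one of the points. -/
theorem exists_weightedMedian {ι : Type*} [DecidableEq ι] (s : Finset ι) (w t : ι → ℝ)
    (hw : ∀ i ∈ s, 0 ≤ w i) (hne : ∃ i ∈ s, 0 < w i) :
    ∃ j ∈ s, 0 < w j ∧ ∀ x, ∑ i ∈ s, w i * |t j - t i| ≤ ∑ i ∈ s, w i * |x - t i| := by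
  set W := ∑ i ∈ s, w i with hW
  set c : ℝ → ℝ := fun y => ∑ i ∈ s with t i ≤ y, w i with hc
  have hsum : ∀ y, (∀ i ∈ s, 0 < w i → t i ≤ y) → c y = W := by
    intro y hy
    rw [hc, hW]
    refine sum_subset (filter_subset _ _) fun i hi hi' => ?_
    by_contra h0
    exact hi' (mem_filter.2 ⟨hi, hy i hi (lt_of_le_of_ne (hw i hi) (Ne.symm h0))⟩)
  have hWpos : 0 ≤ W := sum_nonneg hw
  obtain ⟨j, hj, hmin⟩ := exists_min_image {j ∈ s | 0 < w j ∧ W ≤ 2 * c (t j)} t (by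
    obtain ⟨j, hj, hmax⟩ := exists_max_image {i ∈ s | 0 < w i} t
      (by simpa [Finset.Nonempty] using hne)
    simp only [mem_filter, and_imp] at hj hmax
    exact ⟨j, mem_filter.2 ⟨hj.1, hj.2, by rw [hsum (t j) hmax]; linarith⟩⟩)
  simp only [mem_filter, and_imp] at hj hmin
  refine ⟨j, hj.1, hj.2.1, fun x => weightedMedian_le (A := {i ∈ s | t i ≤ t j})
    (B := {i ∈ s | t i < t j}) hw (filter_subset _ _) (filter_subset _ _)
    (fun i hi => (mem_filter.1 hi).2) hj.2.2 (fun i hi => ?_) ?_ x⟩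
  · simp only [mem_sdiff, mem_filter, not_and, not_lt] at hi
    exact hi.2 hi.1
  · by_contra! hlt
    have hpos : 0 < ∑ i ∈ s with t i < t j, w i := by linarith
    obtain ⟨i0, hi0, hw0⟩ := exists_lt_of_sum_lt (s := {i ∈ s | t i < t j}) (f := fun _ => (0 : ℝ))
      (g := w) (by simpa using hpos)
    obtain ⟨i, hi, hmax⟩ := exists_max_image {i ∈ s | t i < t j ∧ 0 < w i} t
      ⟨i0, by simpa [mem_filter, and_assoc] using And.intro hi0 hw0⟩
    simp only [mem_filter, and_imp] at hi hmax
    have hci : c (t i) = ∑ i ∈ s with t i < t j, w i := by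
      refine sum_subset (fun k hk => ?_) fun k hk hk' => ?_
      · simp only [mem_filter] at hk ⊢
        exact ⟨hk.1, hk.2.trans_lt hi.2.1⟩
      · simp only [mem_filter, not_and, not_le] at hk hk'
        by_contra h0
        exact absurd (hmax k hk.1 hk.2 (lt_of_le_of_ne (hw k hk.1) (Ne.symm h0)))
          (not_le.2 (hk' hk.1))
    exact absurd (hmin i hi.1 hi.2.2 (by rw [hci]; linarith)) (not_le.2 hi.2.1)

/-! ### Sums of distances to hyperplanes -/

/-- The sum of the distances from `y` to the hyperplanes `⟪a h, ·⟫ = b h`, for `h < m`, if the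
normals `a h` are unit vectors. -/
noncomputable def distSum {d : ℕ} (m : ℕ) (a : ℕ → EuclideanSpace ℝ (Fin d)) (b : ℕ → ℝ)
    (y : EuclideanSpace ℝ (Fin d)) : ℝ :=
  ∑ h ∈ range m, |inner ℝ (a h) y - b h|

variable {d : ℕ} {m : ℕ} {a : ℕ → EuclideanSpace ℝ (Fin d)} {b : ℕ → ℝ}

/-- On a line, the sum of distances is, up to a constant, a weighted sum of distances to the points
where the line meets the hyperplanes. Hyperplanes parallel to the line have weight zero. -/
theorem distSum_line (x v : EuclideanSpace ℝ (Fin d)) : ∃ C : ℝ, ∀ t : ℝ,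
    distSum m a b (x + t • v) = C + ∑ h ∈ range m,
      |inner ℝ (a h) v| * |t - (b h - inner ℝ (a h) x) / inner ℝ (a h) v| := by
  refine ⟨∑ h ∈ range m, if inner ℝ (a h) v = 0 then |inner ℝ (a h) x - b h| else 0, fun t => ?_⟩
  rw [distSum, ← sum_add_distrib]
  refine sum_congr rfl fun h _ => ?_
  rw [inner_add_right, inner_smul_right]
  split_ifs with h0
  · simp [h0]
  · rw [← abs_mul, mul_sub, mul_div_cancel₀ _ h0, zero_add]
    congr 1
    ring

/-- Every point can be moved, without increasing the sum of distances, to a point where the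
hyperplanes that contain it have normals that span the whole space. -/
theorem exists_vertex (hspan : Submodule.span ℝ (a '' (range m : Set ℕ)) = ⊤)
    (x : EuclideanSpace ℝ (Fin d)) : ∃ y, distSum m a b y ≤ distSum m a b x ∧
      Submodule.span ℝ (a '' {h | h < m ∧ inner ℝ (a h) y = b h}) = ⊤ := by
  classical
  suffices H : ∀ (r : ℕ) (x : EuclideanSpace ℝ (Fin d)),
      m ≤ #{h ∈ range m | inner ℝ (a h) x = b h} + r →
      ∃ y, distSum m a b y ≤ distSum m a b x ∧
        Submodule.span ℝ (a '' {h | h < m ∧ inner ℝ (a h) y = b h}) = ⊤ from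
    H m x (by omega)
  -- induction on the number of hyperplanes that do not contain `x`
  intro r
  induction r with
  | zero =>
    intro x hx
    refine ⟨x, le_rfl, ?_⟩
    have h1 : {h ∈ range m | inner ℝ (a h) x = b h} = range m :=
      eq_of_subset_of_card_le (filter_subset _ _) (by simpa using hx)
    rw [← hspan]
    congr 2
    ext h
    have := congrArg (h ∈ ·) h1
    simpa using this
  | succ r ih =>
    intro x hx
    by_cases htop : Submodule.span ℝ (a '' {h | h < m ∧ inner ℝ (a h) x = b h}) = ⊤
    · exact ⟨x, le_rfl, htop⟩
    set S := Submodule.span ℝ (a '' {h | h < m ∧ inner ℝ (a h) x = b h}) with hS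
    obtain ⟨v, hv, hv0⟩ := Submodule.exists_mem_ne_zero_of_ne_bot
      (mt Submodule.orthogonal_eq_bot_iff.1 htop)
    have horth : ∀ h, h < m → inner ℝ (a h) x = b h → inner ℝ (a h) v = 0 := fun h hm hb =>
      Submodule.inner_right_of_mem_orthogonal (Submodule.subset_span (Set.mem_image_of_mem a
        (show h ∈ {h | h < m ∧ inner ℝ (a h) x = b h} from ⟨hm, hb⟩))) hv
    have hex : ∃ h ∈ range m, 0 < |inner ℝ (a h) v| := by
      by_contra! hcon
      apply hv0
      have : v ∈ (⊤ : Submodule ℝ (EuclideanSpace ℝ (Fin d)))ᗮ := by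
        rw [← hspan, Submodule.mem_orthogonal]
        intro u hu
        induction hu using Submodule.span_induction with
        | mem u hu =>
          obtain ⟨h, hh, rfl⟩ := hu
          simpa using hcon h (by simpa using hh)
        | zero => simp
        | add u u' _ _ h h' => rw [inner_add_left, h, h', add_zero]
        | smul c u _ h => rw [inner_smul_left, h, mul_zero]
      simpa using this
    -- moving along `v` keeps `x` on its hyperplanes, and the best point in this direction lies on
    -- one more hyperplane
    obtain ⟨C, hC⟩ := distSum_line (m := m) (a := a) (b := b) x v
    obtain ⟨j, hj, hwj, hmin⟩ := exists_weightedMedian (range m) (fun h => |inner ℝ (a h) v|)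
      (fun h => (b h - inner ℝ (a h) x) / inner ℝ (a h) v) (fun _ _ => abs_nonneg _) hex
    set τ := (b j - inner ℝ (a j) x) / inner ℝ (a j) v with hτ
    have hle : distSum m a b (x + τ • v) ≤ distSum m a b x := by
      have h0 := hC 0
      rw [zero_smul, add_zero] at h0
      rw [h0, hC]
      linarith [hmin 0]
    obtain ⟨y, hy, hy'⟩ := ih (x + τ • v) (by
      have hvj : inner ℝ (a j) v ≠ 0 := abs_pos.1 hwj
      have : #{h ∈ range m | inner ℝ (a h) x = b h} <
          #{h ∈ range m | inner ℝ (a h) (x + τ • v) = b h} := by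
        refine card_lt_card ⟨fun h hh => ?_, fun hsub => ?_⟩
        · simp only [mem_filter, mem_range] at hh ⊢
          rw [inner_add_right, inner_smul_right, horth h hh.1 hh.2]
          exact ⟨hh.1, by simpa using hh.2⟩
        · have hjm : j ∈ ({h ∈ range m | inner ℝ (a h) (x + τ • v) = b h} : Finset ℕ) := by
            rw [mem_filter]
            refine ⟨hj, ?_⟩
            rw [inner_add_right, inner_smul_right, hτ, div_mul_cancel₀ _ hvj]
            ring
          exact hvj (horth j (mem_range.1 hj) (mem_filter.1 (hsub hjm)).2)
      omega)
    exact ⟨y, hy.trans hle, hy'⟩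

/-- A family that spans the whole space contains `d - 1` vectors whose span is a hyperplane. -/
theorem exists_tuple_finrank (hd : 1 ≤ d) {A : Set ℕ} (hA : Submodule.span ℝ (a '' A) = ⊤) :
    ∃ f : Fin (d - 1) → ℕ, (∀ j, f j ∈ A) ∧
      finrank ℝ (Submodule.span ℝ (Set.range fun j => a (f j))) + 1 = d := by
  obtain ⟨g, hg, hgA⟩ : ∃ g : Fin d → EuclideanSpace ℝ (Fin d), LinearIndependent ℝ g ∧
      ∀ j, g j ∈ a '' A := by
    obtain ⟨B, hBA, hspan, hli⟩ := exists_linearIndependent ℝ (a '' A)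
    have hb : Basis B ℝ (EuclideanSpace ℝ (Fin d)) := Basis.mk hli (by
      rw [Subtype.range_coe, hspan, hA])
    have : Finite B := Module.Finite.finite_basis hb
    have : Fintype B := Fintype.ofFinite B
    have hcard : Fintype.card B = d := by
      rw [← Module.finrank_eq_card_basis hb]; simp
    let e : Fin d ≃ B := (finCongr hcard.symm).trans (Fintype.equivFin B).symm
    exact ⟨fun j => (e j : EuclideanSpace ℝ (Fin d)), hli.comp _ e.injective,
      fun j => hBA (e j).2⟩
  choose f hf hfg using hgA
  refine ⟨fun j => f (j.castLE (Nat.sub_le d 1)), fun j => hf _, ?_⟩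
  have : (fun j : Fin (d - 1) => a (f (j.castLE (Nat.sub_le d 1)))) =
      g ∘ fun j : Fin (d - 1) => j.castLE (Nat.sub_le d 1) := by
    ext1 j
    simp [hfg]
  rw [this, finrank_span_eq_card (hg.comp _ (Fin.castLE_injective _)), Fintype.card_fin]
  omega

end HDD

/-! ### The hyperplanes determined by a point set -/

namespace HDD

open Finset Module

/-- The span of the first `k` vectors of a sequence. -/
noncomputable def spanBefore {E : Type*} [NormedAddCommGroup E] [InnerProductSpace ℝ E]
    (a : ℕ → E) (k : ℕ) : Submodule ℝ E :=
  Submodule.span ℝ (a '' Set.Iio k)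

section SpanBefore

variable {E : Type*} [NormedAddCommGroup E] [InnerProductSpace ℝ E]

@[simp] theorem spanBefore_zero (a : ℕ → E) : spanBefore a 0 = ⊥ := by
  simp [spanBefore]

theorem spanBefore_succ (a : ℕ → E) (k : ℕ) :
    spanBefore a (k + 1) = spanBefore a k ⊔ Submodule.span ℝ {a k} := by
  rw [spanBefore, spanBefore, ← Submodule.span_union]
  congr 1
  ext x
  simp only [Set.mem_image, Set.mem_Iio, Set.mem_union, Set.mem_singleton_iff, Order.lt_add_one_iff]
  constructor
  · rintro ⟨j, hj, rfl⟩
    rcases hj.lt_or_eq with h | rfl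
    · exact Or.inl ⟨j, h, rfl⟩
    · exact Or.inr rfl
  · rintro (⟨j, hj, rfl⟩ | rfl)
    · exact ⟨j, hj.le, rfl⟩
    · exact ⟨k, le_rfl, rfl⟩

theorem spanBefore_congr {a a' : ℕ → E} {k : ℕ} (h : ∀ j < k, a j = a' j) :
    spanBefore a k = spanBefore a' k := by
  rw [spanBefore, spanBefore,
    show a '' Set.Iio k = a' '' Set.Iio k from Set.image_congr fun j hj => h j hj]

end SpanBefore

variable {d : ℕ}

/-- `h` is the hyperplane `⟪a, ·⟫ = b`, and its normal `a` is a unit vector. -/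
def IsHyperplane (h : AffineSubspace ℝ (EuclideanSpace ℝ (Fin d))) (a : EuclideanSpace ℝ (Fin d))
    (b : ℝ) : Prop :=
  ‖a‖ = 1 ∧ ∀ x, x ∈ h ↔ inner ℝ a x = b

theorem IsHyperplane.infDist_eq {h : AffineSubspace ℝ (EuclideanSpace ℝ (Fin d))}
    {a : EuclideanSpace ℝ (Fin d)} {b : ℝ} (hh : IsHyperplane h a b)
    (q : EuclideanSpace ℝ (Fin d)) :
    Metric.infDist q (h : Set (EuclideanSpace ℝ (Fin d))) = |inner ℝ a q - b| := by
  have hmem : q - (inner ℝ a q - b) • a ∈ h := by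
    rw [hh.2, inner_sub_right, inner_smul_right, real_inner_self_eq_norm_sq, hh.1]
    ring
  refine le_antisymm ?_ ?_
  · refine (Metric.infDist_le_dist_of_mem (SetLike.mem_coe.2 hmem)).trans ?_
    rw [dist_eq_norm, sub_sub_cancel, norm_smul, hh.1, mul_one, Real.norm_eq_abs]
  · refine (Metric.le_infDist ⟨_, SetLike.mem_coe.2 hmem⟩).2 fun y hy => ?_
    rw [← (hh.2 y).1 hy, ← inner_sub_right, dist_eq_norm]
    simpa [hh.1] using abs_real_inner_le_norm a (q - y)

/-- Two unit normals describe the same hyperplane if and only if they agree up to a sign, and the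
offsets up to the same sign. The criterion is a test of bounded cost, given the inner product. -/
theorem IsHyperplane.eq_iff {h h' : AffineSubspace ℝ (EuclideanSpace ℝ (Fin d))}
    {a a' : EuclideanSpace ℝ (Fin d)} {b b' : ℝ} (hh : IsHyperplane h a b)
    (hh' : IsHyperplane h' a' b') :
    h = h' ↔ inner ℝ a a' * inner ℝ a a' = (1 : ℝ) ∧ b = inner ℝ a a' * b' := by
  set σ : ℝ := inner ℝ a a' with hσ
  have haa : inner ℝ a a = (1 : ℝ) := by rw [real_inner_self_eq_norm_sq, hh.1]; norm_num
  have haa' : inner ℝ a' a' = (1 : ℝ) := by rw [real_inner_self_eq_norm_sq, hh'.1]; norm_num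
  constructor
  · rintro rfl
    have hmem : ∀ x : EuclideanSpace ℝ (Fin d), inner ℝ a x = b ↔ inner ℝ a' x = b' := fun x =>
      (hh.2 x).symm.trans (hh'.2 x)
    -- the foot of the perpendicular from the origin, and its translate by the part of `a'`
    -- orthogonal to `a`, both lie on the hyperplane
    have h0 : inner ℝ a' (b • a) = b' := (hmem _).1 (by rw [inner_smul_right, haa, mul_one])
    have h1 : inner ℝ a' (b • a + (a' - σ • a)) = b' := (hmem _).1 (by
      rw [inner_add_right, inner_sub_right, inner_smul_right, inner_smul_right, haa, ← hσ]; ring)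
    rw [inner_add_right, h0, inner_sub_right, inner_smul_right, haa', real_inner_comm, ← hσ] at h1
    rw [inner_smul_right, real_inner_comm, ← hσ] at h0
    have h2 : σ * σ = 1 := by linarith
    refine ⟨h2, ?_⟩
    rw [← h0]
    linear_combination (-b) * h2
  · rintro ⟨h2, hb⟩
    have ha : a = σ • a' := by
      rw [← sub_eq_zero, ← inner_self_eq_zero (𝕜 := ℝ), inner_sub_left, inner_sub_right,
        inner_sub_right, inner_smul_right, inner_smul_left, inner_smul_left, inner_smul_right, haa,
        haa', real_inner_comm a a', ← hσ]
      simp only [conj_trivial]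
      linear_combination (-1 : ℝ) * h2
    have hσ0 : σ ≠ 0 := by
      intro h
      simp [h] at h2
    ext x
    rw [hh.2, hh'.2, ha, inner_smul_left, hb]
    simp only [conj_trivial]
    exact ⟨fun h => mul_left_cancel₀ hσ0 h, fun h => by rw [h]⟩

/-- The span of the differences of the points `pt (g j)`, `j < d`. -/
noncomputable def tupleDir (pt : ℕ → EuclideanSpace ℝ (Fin d)) (g : ℕ → ℕ) :
    Submodule ℝ (EuclideanSpace ℝ (Fin d)) :=
  spanBefore (fun j => pt (g j) - pt (g 0)) d

/-- The affine span of the points `pt (g j)`, `j < d`. -/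
noncomputable def tupleSpan (pt : ℕ → EuclideanSpace ℝ (Fin d)) (g : ℕ → ℕ) :
    AffineSubspace ℝ (EuclideanSpace ℝ (Fin d)) :=
  affineSpan ℝ ((fun j => pt (g j)) '' Set.Iio d)

theorem tupleSpan_direction (hd : 1 ≤ d) (pt : ℕ → EuclideanSpace ℝ (Fin d)) (g : ℕ → ℕ) :
    (tupleSpan pt g).direction = tupleDir pt g := by
  rw [tupleSpan, direction_affineSpan, vectorSpan_eq_span_vsub_set_right ℝ
    (Set.mem_image_of_mem _ (show 0 ∈ Set.Iio d from hd)), tupleDir, spanBefore, Set.image_image]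
  rfl

theorem mem_tupleSpan (hd : 1 ≤ d) (pt : ℕ → EuclideanSpace ℝ (Fin d)) (g : ℕ → ℕ) :
    pt (g 0) ∈ tupleSpan pt g :=
  subset_affineSpan ℝ _ (Set.mem_image_of_mem _ (show 0 ∈ Set.Iio d from hd))

theorem isHyperplane_tupleSpan (hd : 1 ≤ d) {pt : ℕ → EuclideanSpace ℝ (Fin d)} {g : ℕ → ℕ}
    (hg : finrank ℝ (tupleDir pt g) + 1 = d) {u : EuclideanSpace ℝ (Fin d)}
    (hu : u ∈ (tupleDir pt g)ᗮ) (hu1 : ‖u‖ = 1) :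
    IsHyperplane (tupleSpan pt g) u (inner ℝ u (pt (g 0))) := by
  refine ⟨hu1, fun x => ?_⟩
  have hx : x ∈ tupleSpan pt g ↔ x - pt (g 0) ∈ tupleDir pt g := by
    rw [← tupleSpan_direction hd, ← vsub_eq_sub,
      AffineSubspace.vsub_right_mem_direction_iff_mem (mem_tupleSpan hd pt g)]
  have hu0 : u ≠ 0 := by
    rintro rfl
    simp at hu1
  rw [hx, ← sub_eq_zero, ← inner_sub_right]
  refine ⟨fun h => Submodule.inner_left_of_mem_orthogonal h hu, fun h => ?_⟩
  rw [← Submodule.orthogonal_orthogonal (tupleDir pt g), Submodule.mem_orthogonal]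
  intro w hw
  obtain ⟨t, rfl⟩ := exists_smul_of_finrank (by simpa using hg) hu hu0 hw
  rw [inner_smul_left, h, mul_zero]

theorem affineIndependent_tuple (hd : 1 ≤ d) (pt : ℕ → EuclideanSpace ℝ (Fin d)) (g : ℕ → ℕ) :
    AffineIndependent ℝ (fun j : Fin d => pt (g j)) ↔ finrank ℝ (tupleDir pt g) + 1 = d := by
  rw [affineIndependent_iff_finrank_vectorSpan_eq ℝ _ (n := d - 1) (by simp; omega),
    ← tupleSpan_direction hd, tupleSpan, direction_affineSpan]
  have : Set.range (fun j : Fin d => pt (g j)) = (fun j => pt (g j)) '' Set.Iio d := by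
    ext x
    simp only [Set.mem_range, Set.mem_image, Set.mem_Iio]
    exact ⟨fun ⟨j, hj⟩ => ⟨j, j.2, hj⟩, fun ⟨j, hj, hx⟩ => ⟨⟨j, hj⟩, hx⟩⟩
  rw [this]
  omega

/-- The hyperplanes are the spans of the `d`-tuples of points whose differences have rank `d - 1`.
Tuples may be ordered in any way, so that each hyperplane arises several times. -/
theorem mem_hyperplanes (hd : 1 ≤ d) {n : ℕ} {P : Finset (EuclideanSpace ℝ (Fin d))}
    {pt : ℕ → EuclideanSpace ℝ (Fin d)} (hP : P = (range n).image pt)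
    {h : AffineSubspace ℝ (EuclideanSpace ℝ (Fin d))} :
    h ∈ hyperplanes P ↔ ∃ g : ℕ → ℕ, (∀ j < d, g j < n) ∧
      finrank ℝ (tupleDir pt g) + 1 = d ∧ h = tupleSpan pt g := by
  classical
  rw [hyperplanes]
  simp only [mem_image, mem_filter, mem_powersetCard]
  constructor
  · rintro ⟨s, ⟨⟨hsP, hcard⟩, hs⟩, rfl⟩
    have e : Fin d ≃ s := (s.equivFinOfCardEq hcard).symm
    have hex : ∀ j : Fin d, ∃ i < n, pt i = e j := fun j => by
      have := hsP (e j).2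
      rw [hP] at this
      simpa using this
    choose i hi hpt using hex
    have hfun : (fun j : Fin d => pt (if hj : (j : ℕ) < d then i ⟨j, hj⟩ else 0)) =
        fun j => (e j : EuclideanSpace ℝ (Fin d)) := by
      ext1 j
      simp [hpt]
    refine ⟨fun j => if hj : j < d then i ⟨j, hj⟩ else 0, fun j hj => by simp [hj, hi], ?_, ?_⟩
    · rw [← affineIndependent_tuple hd, hfun]
      exact hs.comp_embedding e.toEmbedding
    · rw [tupleSpan]
      congr 1
      ext x
      simp only [Set.mem_image, Set.mem_Iio, mem_coe]
      constructor
      · intro hx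
        refine ⟨e.symm ⟨x, hx⟩, (e.symm ⟨x, hx⟩).2, ?_⟩
        have := congrFun hfun (e.symm ⟨x, hx⟩)
        simpa using this
      · rintro ⟨j, hj, rfl⟩
        have := congrFun hfun ⟨j, hj⟩
        simp only at this
        rw [this]
        exact (e _).2
  · rintro ⟨g, hg, hrank, rfl⟩
    have hai := (affineIndependent_tuple hd pt g).2 hrank
    refine ⟨univ.image fun j : Fin d => pt (g j), ⟨⟨?_, ?_⟩, ?_⟩, ?_⟩
    · intro x hx
      obtain ⟨j, -, rfl⟩ := mem_image.1 hx
      rw [hP]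
      exact mem_image_of_mem _ (mem_range.2 (hg j j.2))
    · rw [card_image_of_injective _ hai.injective]
      simp
    · have := hai.range
      refine (this.mono (s := ((univ.image fun j : Fin d => pt (g j) : Finset _) : Set _)) ?_)
      simp
    · rw [tupleSpan]
      congr 1
      ext x
      simp only [coe_image, coe_univ, Set.image_univ, Set.mem_range, Set.mem_image, Set.mem_Iio]
      exact ⟨fun ⟨j, hj⟩ => ⟨j, j.2, hj⟩, fun ⟨j, hj, hx⟩ => ⟨⟨j, hj⟩, hx⟩⟩

theorem card_hyperplanes_mul_factorial_le (P : Finset (EuclideanSpace ℝ (Fin d))) :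
    #(hyperplanes P) * d.factorial ≤ #P ^ d := by
  classical
  have h1 : #(hyperplanes P) ≤ (#P).choose d := by
    refine card_image_le.trans ((card_filter_le _ _).trans ?_)
    rw [card_powersetCard]
  calc #(hyperplanes P) * d.factorial ≤ (#P).choose d * d.factorial := Nat.mul_le_mul_right _ h1
    _ = (#P).descFactorial d := by rw [Nat.descFactorial_eq_factorial_mul_choose, mul_comm]
    _ ≤ #P ^ d := Nat.descFactorial_le_pow _ _

/-! ### Optimality of the best candidate -/

/-- If the points span the whole space, then so do the normals of their hyperplanes: a vector
parallel to all facets of a simplex is zero. -/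
theorem span_normals_eq_top (hd : 1 ≤ d) {P : Finset (EuclideanSpace ℝ (Fin d))}
    (hP : affineSpan ℝ (P : Set (EuclideanSpace ℝ (Fin d))) = ⊤)
    {A : Set (EuclideanSpace ℝ (Fin d))}
    (hA : ∀ h ∈ hyperplanes P, ∃ a ∈ A, ∃ b, IsHyperplane h a b) :
    Submodule.span ℝ A = ⊤ := by
  classical
  rw [← Submodule.orthogonal_eq_bot_iff, Submodule.eq_bot_iff]
  intro v hv
  obtain ⟨t, htP, hspan, hind⟩ := exists_affineIndependent ℝ (EuclideanSpace ℝ (Fin d))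
    (P : Set (EuclideanSpace ℝ (Fin d)))
  have htfin : t.Finite := P.finite_toSet.subset htP
  have : Fintype t := htfin.fintype
  let B : AffineBasis t ℝ (EuclideanSpace ℝ (Fin d)) :=
    ⟨(↑), hind, by rw [Subtype.range_coe, hspan, hP]⟩
  have hB : ∀ i : t, B i = i := fun i => rfl
  have hcard : Fintype.card t = d + 1 := by
    rw [B.card_eq_finrank_add_one]; simp
  have hlin : ∀ i : t, (B.coord i).linear v = 0 := by
    intro i
    let F : Finset (EuclideanSpace ℝ (Fin d)) := htfin.toFinset.erase i
    have hFcard : #F = d := by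
      rw [card_erase_of_mem (by simp), Set.Finite.card_toFinset, hcard, Nat.add_sub_cancel]
    have hFt : ∀ x ∈ F, x ∈ t ∧ x ≠ i := fun x hx => by
      simpa [F, and_comm] using hx
    have hF : affineSpan ℝ (F : Set (EuclideanSpace ℝ (Fin d))) ∈ hyperplanes P := by
      rw [hyperplanes]
      refine mem_image.2 ⟨F, mem_filter.2 ⟨mem_powersetCard.2 ⟨fun x hx => ?_, hFcard⟩, ?_⟩, rfl⟩
      · exact htP (hFt x hx).1
      · exact hind.mono (s := (F : Set _)) fun x hx => (hFt x hx).1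
    have hzero : ∀ x ∈ affineSpan ℝ (F : Set (EuclideanSpace ℝ (Fin d))), B.coord i x = 0 := by
      intro x hx
      refine affineSpan_induction (p := fun x => B.coord i x = 0) hx (fun x hx => ?_) ?_
      · have h1 := hFt x hx
        have := B.coord_apply_ne (i := i) (j := ⟨x, h1.1⟩) fun h => h1.2 (by rw [h])
        rwa [hB] at this
      · intro c u v w hu hv hw
        rw [AffineMap.map_vadd, map_smul, AffineMap.linearMap_vsub, hu, hv, hw]
        simp
    obtain ⟨a, ha, b, hab⟩ := hA _ hF
    obtain ⟨x, hx⟩ : F.Nonempty := card_pos.1 (by omega)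
    have hx : x ∈ affineSpan ℝ (F : Set (EuclideanSpace ℝ (Fin d))) := subset_affineSpan ℝ _ hx
    have hxv : v +ᵥ x ∈ affineSpan ℝ (F : Set (EuclideanSpace ℝ (Fin d))) := by
      rw [hab.2, vadd_eq_add, inner_add_right, (hab.2 x).1 hx,
        Submodule.inner_right_of_mem_orthogonal (Submodule.subset_span ha) hv, zero_add]
    have h1 := hzero _ hxv
    rwa [AffineMap.map_vadd, hzero x hx, vadd_eq_add, add_zero] at h1
  obtain ⟨i⟩ : Nonempty t := Fintype.card_pos_iff.1 (by omega)
  have : v +ᵥ (i : EuclideanSpace ℝ (Fin d)) = i := by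
    refine B.ext_elem fun j => ?_
    rw [AffineMap.map_vadd, hlin, zero_vadd]
  simpa using this

/-- If the points lie in a hyperplane, then no other hyperplane is determined by them, so that the
depth of every point of the set is zero. -/
theorem depth_eq_zero (hd : 1 ≤ d) {n : ℕ} {P : Finset (EuclideanSpace ℝ (Fin d))}
    {pt : ℕ → EuclideanSpace ℝ (Fin d)} (hP : P = (range n).image pt)
    (hspan : affineSpan ℝ (P : Set (EuclideanSpace ℝ (Fin d))) ≠ ⊤)
    {q : EuclideanSpace ℝ (Fin d)} (hq : q ∈ P) : depth P q = 0 := by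
  refine sum_eq_zero fun h hh => ?_
  obtain ⟨g, hg, hrank, rfl⟩ := (mem_hyperplanes hd hP).1 hh
  have hle : tupleSpan pt g ≤ affineSpan ℝ (P : Set (EuclideanSpace ℝ (Fin d))) := by
    refine affineSpan_mono ℝ ?_
    rintro _ ⟨j, hj, rfl⟩
    rw [hP]
    simpa using ⟨g j, hg j hj, rfl⟩
  have heq : tupleSpan pt g = affineSpan ℝ (P : Set (EuclideanSpace ℝ (Fin d))) := by
    refine AffineSubspace.eq_of_direction_eq_of_nonempty_of_le ?_ ⟨_, mem_tupleSpan hd pt g⟩ hle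
    refine Submodule.eq_of_le_of_finrank_le (AffineSubspace.direction_le hle) ?_
    rw [tupleSpan_direction hd]
    have hlt : finrank ℝ (affineSpan ℝ (P : Set (EuclideanSpace ℝ (Fin d)))).direction <
        finrank ℝ (EuclideanSpace ℝ (Fin d)) := by
      refine Submodule.finrank_lt fun htop => hspan ?_
      exact (AffineSubspace.direction_eq_top_iff_of_nonempty
        ⟨_, hle (mem_tupleSpan hd pt g)⟩).1 htop
    rw [finrank_euclideanSpace_fin] at hlt
    omega
  rw [heq]
  exact Metric.infDist_zero_of_mem (subset_affineSpan ℝ _ hq)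

theorem depth_nonneg (P : Finset (EuclideanSpace ℝ (Fin d))) (q : EuclideanSpace ℝ (Fin d)) :
    0 ≤ depth P q :=
  sum_nonneg fun _ _ => Metric.infDist_nonneg

/-- The list of hyperplanes `⟪a i, ·⟫ = b i`, `i < m`, is an enumeration of the hyperplanes
determined by `P`. -/
def Enumerates (P : Finset (EuclideanSpace ℝ (Fin d))) (m : ℕ) (a : ℕ → EuclideanSpace ℝ (Fin d))
    (b : ℕ → ℝ) : Prop :=
  ∃ hs : ℕ → AffineSubspace ℝ (EuclideanSpace ℝ (Fin d)),
    (∀ i < m, IsHyperplane (hs i) (a i) (b i)) ∧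
    (∀ i < m, ∀ j < m, hs i = hs j → i = j) ∧
    ∀ h, h ∈ hyperplanes P ↔ ∃ i < m, hs i = h

variable {P : Finset (EuclideanSpace ℝ (Fin d))} {m : ℕ} {a : ℕ → EuclideanSpace ℝ (Fin d)}
  {b : ℕ → ℝ}

theorem Enumerates.depth_eq (h : Enumerates P m a b) (q : EuclideanSpace ℝ (Fin d)) :
    depth P q = distSum m a b q := by
  classical
  obtain ⟨hs, h1, h2, h3⟩ := h
  have : hyperplanes P = (range m).image hs := by
    ext x
    simp [h3]
  rw [depth, this, sum_image fun i hi j hj => h2 i (by simpa using hi) j (by simpa using hj)]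
  exact sum_congr rfl fun i hi => (h1 i (mem_range.1 hi)).infDist_eq q

/-- A point `y` is a median if its sum of distances is at most that of a point of `P`, and at most
that of every point on certain lines: for each tuple of `d - 1` hyperplanes, the lines through `x`
in the directions of the residuals of the standard basis vectors. When the normals of the tuple are
linearly independent, the nonzero residuals all point along the intersection line, and the condition
on `x` places `x` there. The point of `P` is needed when all points lie on one hyperplane, because
then there may be no tuple with linearly independent normals. -/
theorem Enumerates.isMedian (h : Enumerates P m a b) (hd : 1 ≤ d) {n : ℕ}
    {pt : ℕ → EuclideanSpace ℝ (Fin d)} (hP : P = (range n).image pt)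
    {q y : EuclideanSpace ℝ (Fin d)} (hq : q ∈ P) (hyq : distSum m a b y ≤ distSum m a b q)
    (hy : ∀ g : ℕ → ℕ, (∀ j < d - 1, g j < m) → ∀ k < d,
      ∃ x, (∀ z, (∀ j < d - 1, inner ℝ (a (g j)) z = b (g j)) →
          z - x ∈ (spanBefore (fun j => a (g j)) (d - 1))ᗮ) ∧
        ∀ t : ℝ, distSum m a b y ≤
          distSum m a b (x + t • residual (spanBefore (fun j => a (g j)) (d - 1)) (unitVec d k))) :
    IsMedian P y := by
  intro z
  by_cases hspan : affineSpan ℝ (P : Set (EuclideanSpace ℝ (Fin d))) = ⊤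
  · -- some minimizer is a vertex, and every vertex lies on one of the lines
    rw [h.depth_eq, h.depth_eq]
    have htop : Submodule.span ℝ (a '' (range m : Set ℕ)) = ⊤ := by
      obtain ⟨hs, h1, h2, h3⟩ := h
      refine span_normals_eq_top hd hspan fun x hx => ?_
      obtain ⟨i, hi, rfl⟩ := (h3 x).1 hx
      exact ⟨a i, ⟨i, by simpa using hi, rfl⟩, b i, h1 i hi⟩
    obtain ⟨w, hwz, hw⟩ := exists_vertex (b := b) htop z
    obtain ⟨f, hf, hrank⟩ := exists_tuple_finrank hd hw
    refine le_trans ?_ hwz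
    set g : ℕ → ℕ := fun j => if hj : j < d - 1 then f ⟨j, hj⟩ else 0 with hg
    have hgf : ∀ j (hj : j < d - 1), g j = f ⟨j, hj⟩ := fun j hj => by simp [hg, hj]
    have hS : spanBefore (fun j => a (g j)) (d - 1) =
        Submodule.span ℝ (Set.range fun j => a (f j)) := by
      rw [spanBefore]
      congr 1
      ext x
      simp only [Set.mem_image, Set.mem_Iio, Set.mem_range]
      constructor
      · rintro ⟨j, hj, rfl⟩
        exact ⟨⟨j, hj⟩, by rw [hgf j hj]⟩
      · rintro ⟨j, rfl⟩
        exact ⟨j, j.2, by rw [hgf j j.2]⟩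
    have hfr : finrank ℝ (spanBefore (fun j => a (g j)) (d - 1)) + 1 =
        finrank ℝ (EuclideanSpace ℝ (Fin d)) := by
      rw [hS, hrank, finrank_euclideanSpace_fin]
    obtain ⟨k, hk, hk0⟩ := exists_residual_ne_zero (S := spanBefore (fun j => a (g j)) (d - 1))
      (by
        intro htop
        rw [htop, finrank_top] at hfr
        omega)
    obtain ⟨x, hx, hxt⟩ := hy g (fun j hj => by rw [hgf j hj]; exact (hf _).1) k hk
    obtain ⟨t, ht⟩ := exists_smul_of_finrank hfr (residual_mem _ _) hk0
      (hx w fun j hj => by rw [hgf j hj]; exact (hf _).2)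
    have : w = x + t • residual (spanBefore (fun j => a (g j)) (d - 1)) (unitVec d k) := by
      rw [← ht]; abel
    rw [this]
    exact hxt t
  · have h0 := depth_eq_zero hd hP hspan hq
    rw [h.depth_eq] at h0
    rw [h.depth_eq]
    linarith [depth_nonneg P z]

end HDD

/-! ### Enumeration of tuples -/

namespace RealRAM

open Finset

/-- The position at which the enumeration of tuples increments the current tuple. -/
abbrev nO : ℕ := 2

/-- The current tuple. -/
abbrev nIdx : ℕ := 3

/-- The flag that ends the enumeration of tuples. -/
abbrev nDone : ℕ := 4

/-- If the last `j` digits of `c` are all `N - 1`, then adding `1` carries into the digit number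
`j`. -/
theorem succ_eq_of_digits {N c : ℕ} {j : ℕ} (h : ∀ i < j, c / N ^ i % N + 1 = N) :
    c + 1 = (c / N ^ j + 1) * N ^ j := by
  induction j with
  | zero => simp
  | succ j ih =>
    have h1 := ih fun i hi => h i (by omega)
    have h2 := h j (by omega)
    have h3 := Nat.div_add_mod (c / N ^ j) N
    rw [pow_succ, ← Nat.div_div_eq_div_mul]
    calc c + 1 = (c / N ^ j + 1) * N ^ j := h1
      _ = (N * (c / N ^ j / N) + (c / N ^ j % N + 1)) * N ^ j := by rw [← add_assoc, h3]
      _ = (c / N ^ j / N + 1) * (N ^ j * N) := by rw [h2]; ring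

/-- The effect of adding `1` on the base-`N` digits: trailing digits `N - 1` become `0`, and the
digit after them is incremented. -/
theorem digits_succ {N c j k : ℕ} (hc : c < N ^ k) (hj : j < k)
    (h : ∀ i < j, c / N ^ i % N + 1 = N) (hj1 : c / N ^ j % N + 1 < N) :
    c + 1 < N ^ k ∧ (∀ i < j, (c + 1) / N ^ i % N = 0) ∧
      (c + 1) / N ^ j % N = c / N ^ j % N + 1 ∧
      ∀ i, j < i → (c + 1) / N ^ i % N = c / N ^ i % N := by
  have hN : 0 < N := by omega
  have hs := succ_eq_of_digits h
  set q := c / N ^ j with hq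
  have hdj : (c + 1) / N ^ j = q + 1 := by rw [hs, Nat.mul_div_cancel _ (by positivity)]
  have hmod : (q + 1) % N = q % N + 1 := by
    rw [Nat.add_mod, Nat.mod_eq_of_lt (a := 1) (by omega), Nat.mod_eq_of_lt hj1]
  refine ⟨lt_of_le_of_ne hc fun heq => ?_, fun i hi => ?_, ?_, fun i hi => ?_⟩
  · obtain ⟨e, rfl⟩ : ∃ e, k = j + (e + 1) := ⟨k - j - 1, by omega⟩
    have heq' : c + 1 = N ^ (j + (e + 1)) := heq
    rw [heq', pow_add, Nat.mul_div_cancel_left _ (by positivity)] at hdj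
    rw [← hdj, pow_succ, Nat.mul_mod_left] at hmod
    omega
  · obtain ⟨e, rfl⟩ : ∃ e, j = i + (e + 1) := ⟨j - i - 1, by omega⟩
    rw [hs, pow_add, mul_comm (N ^ i), ← mul_assoc, Nat.mul_div_cancel _ (by positivity), pow_succ,
      ← mul_assoc, Nat.mul_mod_left]
  · rw [hdj, hmod]
  · obtain ⟨e, rfl⟩ : ∃ e, i = j + (1 + e) := ⟨i - j - 1, by omega⟩
    have hdiv : (q + 1) / N = q / N := by
      rw [Nat.add_div hN, Nat.mod_eq_of_lt (a := 1) (by omega), if_neg (by omega),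
        Nat.div_eq_of_lt (a := 1) (by omega), add_zero, add_zero]
    rw [pow_add, ← Nat.div_div_eq_div_mul, hdj, ← Nat.div_div_eq_div_mul, pow_add, pow_one,
      ← Nat.div_div_eq_div_mul, hdiv, ← Nat.div_div_eq_div_mul]

theorem exists_digits (N k : ℕ) (g : ℕ → ℕ) (hg : ∀ j < k, g j < N) :
    ∃ c < N ^ k, ∀ j < k, c / N ^ j % N = g j := by
  induction k with
  | zero => exact ⟨0, by simp, by simp⟩
  | succ k ih =>
    obtain ⟨c, hc, hcg⟩ := ih fun j hj => hg j (by omega)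
    have hgk := hg k (by omega)
    refine ⟨c + N ^ k * g k, ?_, fun j hj => ?_⟩
    · calc c + N ^ k * g k < N ^ k * (g k + 1) := by rw [mul_add]; omega
        _ ≤ N ^ k * N := Nat.mul_le_mul_left _ hgk
        _ = N ^ (k + 1) := (pow_succ _ _).symm
    · rcases (Nat.lt_succ_iff.1 hj).lt_or_eq with hj | rfl
      · obtain ⟨e, rfl⟩ : ∃ e, k = j + (e + 1) := ⟨k - j - 1, by omega⟩
        have hN : 0 < N := (Nat.zero_le _).trans_lt hgk
        rw [pow_add, mul_assoc, Nat.add_mul_div_left _ _ (by positivity), pow_succ', mul_assoc,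
          Nat.add_mul_mod_self_left, hcg j hj]
      · rw [Nat.add_mul_div_left _ _ (by omega), Nat.div_eq_of_lt hc, zero_add,
          Nat.mod_eq_of_lt hgk]

/-- Replaces the tuple of length `K` with entries below `N` by its successor, or sets the flag
`nDone` if there is none. -/
def nextTuple (K N : NatExp) : Program :=
  .seq (.storeNat nO (.const 0) (.const 0)) <|
  .seq (.loop (.and (.natLt (.var nO) K) (.natEq (.add (.load nIdx (.var nO)) (.const 1)) N))
    (.seq (.storeNat nIdx (.var nO) (.const 0))
      (.storeNat nO (.const 0) (.add (.var nO) (.const 1))))) <|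
  .ite (.natLt (.var nO) K)
    (.storeNat nIdx (.var nO) (.add (.load nIdx (.var nO)) (.const 1)))
    (.storeNat nDone (.const 0) (.const 1))

@[simp] theorem natWrites_nextTuple (K N : NatExp) :
    (nextTuple K N).natWrites = [nO, nIdx, nO, nIdx, nDone] := rfl

@[simp] theorem realWrites_nextTuple (K N : NatExp) : (nextTuple K N).realWrites = [] := rfl

theorem WP.nextTuple {K N : NatExp} {s : State} {c : ℕ}
    (hK : ∀ a ∈ K.reads, a ∉ [nO, nIdx, nDone]) (hN : ∀ a ∈ N.reads, a ∉ [nO, nIdx, nDone])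
    (hcost : K.cost + N.cost ≤ 10) (hc : c < N.eval s ^ K.eval s)
    (hdig : ∀ j < K.eval s, s.nat nIdx j = c / N.eval s ^ j % N.eval s)
    (hdone : s.nat nDone 0 = 0) :
    WP (nextTuple K N) s (K.eval s * 50 + 60) (fun s' =>
      (s'.nat nDone 0 = 0 ∧ c + 1 < N.eval s ^ K.eval s ∧
        ∀ j < K.eval s, s'.nat nIdx j = (c + 1) / N.eval s ^ j % N.eval s) ∨
      (s'.nat nDone 0 = 1 ∧ c + 1 = N.eval s ^ K.eval s)) := by
  set k := K.eval s with hk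
  set n := N.eval s with hn
  have hK' : ∀ s', Agree (RealRAM.nextTuple K N) s s' → K.eval s' = k := fun s' h =>
    h.natEval K fun a ha => by
      have := hK a ha
      simp only [natWrites_nextTuple, List.mem_cons, not_or] at this ⊢
      tauto
  have hN' : ∀ s', Agree (RealRAM.nextTuple K N) s s' → N.eval s' = n := fun s' h =>
    h.natEval N fun a ha => by
      have := hN a ha
      simp only [natWrites_nextTuple, List.mem_cons, not_or] at this ⊢
      tauto
  refine WP.le (WP.seq (WP.storeNat (Q := fun s' => s'.nat nO 0 = 0 ∧
      (∀ j < k, s'.nat nIdx j = c / n ^ j % n) ∧ s'.nat nDone 0 = 0)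
      ⟨by simp [State.setNat_nat_same, NatExp.eval], fun j hj => ?_, ?_⟩) fun s1 ha1 h1 =>
    WP.seq (WP.loop (N := k) (B := 14) (fun j s' => s'.nat nO 0 = j ∧ j ≤ k ∧
      (∀ i < j, s'.nat nIdx i = 0) ∧ (∀ i, j ≤ i → i < k → s'.nat nIdx i = c / n ^ i % n) ∧
      (∀ i < j, c / n ^ i % n + 1 = n) ∧ s'.nat nDone 0 = 0)
      ⟨h1.1, by omega, by omega, fun i _ hi => h1.2.1 i hi, by omega, h1.2.2⟩ ?_
      (Q := fun s' => ∃ j, s'.nat nO 0 = j ∧ j ≤ k ∧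
      (∀ i < j, s'.nat nIdx i = 0) ∧ (∀ i, j ≤ i → i < k → s'.nat nIdx i = c / n ^ i % n) ∧
      (∀ i < j, c / n ^ i % n + 1 = n) ∧ s'.nat nDone 0 = 0 ∧ (j < k → c / n ^ j % n + 1 ≠ n)) ?_)
      fun s2 ha2 h2 => WP.ite (T := 10) ?_ ?_) ?_
  · rw [State.setNat_nat_of_ne (by decide)]; exact hdig j hj
  · rw [State.setNat_nat_of_ne (by decide)]; exact hdone
  · rintro j s' ha ⟨hO, hjk, hz, hd, hmax, hdn⟩ ⟨hb1, hb2⟩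
    have hag : Agree (RealRAM.nextTuple K N) s s' :=
      (ha1.mono (by simp [Program.natWrites]) (by simp [Program.realWrites])).trans
        (ha.mono (by simp [Program.natWrites]) (by simp [Program.realWrites]))
    have hlt : j < k := by
      have : s'.nat nO 0 < K.eval s' := hb1
      rwa [hK' s' hag, hO] at this
    have hdj : c / n ^ j % n + 1 = n := by
      have : s'.nat nIdx (s'.nat nO 0) + 1 = N.eval s' := hb2
      rwa [hN' s' hag, hO, hd j le_rfl hlt] at this
    refine ⟨hlt, WP.le (WP.seq (WP.storeNat (Q := fun s'' => s'' = s'.setNat nIdx j 0) ?_)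
      (fun s'' _ h => WP.storeNat ?_)) (T := 4 + 6) (by norm_num)⟩
    · simp [NatExp.eval, hO]
    · subst h
      refine ⟨?_, hlt, fun i hi => ?_, fun i hi hik => ?_, fun i hi => ?_, ?_⟩
      · rw [State.setNat_nat_same]
        simp [NatExp.eval, State.setNat_nat_of_ne (show nO ≠ nIdx by decide), hO]
      · rw [State.setNat_nat_of_ne (by decide), State.setNat_nat_same]
        split_ifs with h
        · rfl
        · exact hz i (by omega)
      · rw [State.setNat_nat_of_ne (by decide), State.setNat_nat_same, if_neg (by omega)]
        exact hd i (by omega) hik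
      · rcases (Nat.lt_succ_iff.1 hi).lt_or_eq with h | rfl
        · exact hmax i h
        · exact hdj
      · rw [State.setNat_nat_of_ne (by decide), State.setNat_nat_of_ne (by decide), hdn]
  · rintro j s' ha ⟨hO, hjk, hz, hd, hmax, hdn⟩ hb
    have hag : Agree (RealRAM.nextTuple K N) s s' :=
      (ha1.mono (by simp [Program.natWrites]) (by simp [Program.realWrites])).trans
        (ha.mono (by simp [Program.natWrites]) (by simp [Program.realWrites]))
    refine ⟨j, hO, hjk, hz, hd, hmax, hdn, fun hlt heq => hb ⟨?_, ?_⟩⟩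
    · show s'.nat nO 0 < K.eval s'
      rwa [hK' s' hag, hO]
    · show s'.nat nIdx (s'.nat nO 0) + 1 = N.eval s'
      rwa [hN' s' hag, hO, hd j le_rfl hlt]
  all_goals
    try
      obtain ⟨j, hO, hjk, hz, hd, hmax, hdn, hne⟩ := h2
      have hag : Agree (RealRAM.nextTuple K N) s s2 :=
        (ha1.mono (by simp [Program.natWrites]) (by simp [Program.realWrites])).trans
          (ha2.mono (by simp [Program.natWrites]) (by simp [Program.realWrites]))
  · intro hb
    have hlt : j < k := by
      have : s2.nat nO 0 < K.eval s2 := hb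
      rwa [hK' s2 hag, hO] at this
    have hnpos : 0 < n := Nat.pos_of_ne_zero fun h0 => by
      rw [h0, zero_pow (by omega)] at hc
      omega
    have hlt' : c / n ^ j % n + 1 < n :=
      lt_of_le_of_ne (Nat.mod_lt _ hnpos) (hne hlt)
    obtain ⟨h3, h4, h5, h6⟩ := digits_succ hc hlt hmax hlt'
    refine WP.le (WP.storeNat (Or.inl ⟨?_, h3, fun i hi => ?_⟩)) (by simp [NatExp.cost])
    · rw [State.setNat_nat_of_ne (by decide), hdn]
    · rw [State.setNat_nat_same]
      simp only [NatExp.eval, hO]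
      rcases lt_trichotomy i j with h | rfl | h
      · rw [if_neg (by omega), hz i h, h4 i h]
      · rw [if_pos rfl, hd i le_rfl hi, h5]
      · rw [if_neg (by omega), hd i h.le hi, h6 i h]
  · intro hb
    have hjk : j = k := by
      have : ¬ s2.nat nO 0 < K.eval s2 := hb
      rw [hK' s2 hag, hO] at this
      omega
    subst hjk
    refine WP.le (WP.storeNat (Or.inr ⟨by simp [State.setNat_nat_same, NatExp.eval], ?_⟩))
      (by simp [NatExp.cost])
    have := succ_eq_of_digits hmax
    rwa [Nat.div_eq_of_lt hc, zero_add, one_mul] at this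
  · simp only [Test.cost, NatExp.cost]
    nlinarith

/-- Runs `p` for all tuples of length `K` with entries below `N`. -/
def forTuples (K N : NatExp) (p : Program) : Program :=
  .seq (forLoop nO K (.storeNat nIdx (.var nO) (.const 0))) <|
  .seq (.storeNat nDone (.const 0) (.const 0)) <|
  .loop (.natEq (.var nDone) (.const 0)) (.seq p (nextTuple K N))

@[simp] theorem natWrites_forTuples (K N : NatExp) (p : Program) :
    (forTuples K N p).natWrites =
      nO :: nIdx :: nO :: nDone :: (p.natWrites ++ [nO, nIdx, nO, nIdx, nDone]) := rfl

@[simp] theorem realWrites_forTuples (K N : NatExp) (p : Program) :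
    (forTuples K N p).realWrites = p.realWrites := by
  simp [forTuples, Program.realWrites]

/-- In the round number `c`, the current tuple consists of the base-`N` digits of `c`. -/
theorem WP.forTuples {K N : NatExp} {p : Program} {s : State} {B : ℕ} (I : ℕ → State → Prop)
    (hp : ∀ a ∈ [nO, nIdx, nDone], a ∉ p.natWrites)
    (hK : ∀ a ∈ K.reads, a ∉ (forTuples K N p).natWrites)
    (hN : ∀ a ∈ N.reads, a ∉ (forTuples K N p).natWrites)
    (hcost : K.cost + N.cost ≤ 10) (hNpos : 0 < N.eval s)
    (hI : ∀ c s' s'', I c s' → s''.real = s'.real →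
      (∀ a, a ∉ [nO, nIdx, nDone] → s''.nat a = s'.nat a) → I c s'')
    (h0 : I 0 s)
    (hstep : ∀ c s', c < N.eval s ^ K.eval s → Agree (forTuples K N p) s s' →
      (∀ j < K.eval s, s'.nat nIdx j = c / N.eval s ^ j % N.eval s) → I c s' →
      WP p s' B (I (c + 1))) :
    WP (forTuples K N p) s
      (N.eval s ^ K.eval s * (B + K.eval s * 50 + 70) + K.eval s * 50 + 70)
      (I (N.eval s ^ K.eval s)) := by
  set k := K.eval s with hk
  set n := N.eval s with hn
  have hK' : ∀ s', Agree (RealRAM.forTuples K N p) s s' → K.eval s' = k := fun s' h =>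
    h.natEval K hK
  have hN' : ∀ s', Agree (RealRAM.forTuples K N p) s s' → N.eval s' = n := fun s' h =>
    h.natEval N hN
  have hsub : ∀ {L : List ℕ} {e : NatExp}, (∀ a ∈ e.reads, a ∉ (RealRAM.forTuples K N p).natWrites) →
      (L ⊆ [nO, nIdx, nDone]) → ∀ a ∈ e.reads, a ∉ L := by
    intro L e he hL a ha haL
    have := he a ha
    have h3 := hL haL
    simp only [natWrites_forTuples, List.mem_cons, List.mem_append, not_or, List.not_mem_nil,
      or_false] at this h3
    tauto
  have hpsub : p.natWrites ⊆
      nO :: nIdx :: nO :: nDone :: (p.natWrites ++ [nO, nIdx, nO, nIdx, nDone]) := fun a ha => by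
    simp [ha]
  refine WP.le (WP.seq (WP.forLoop (B := 5) (fun j s' => (∀ i < j, s'.nat nIdx i = 0) ∧
      s'.real = s.real ∧ ∀ a, a ∉ [nO, nIdx, nDone] → s'.nat a = s.nat a)
      rfl (by decide) (hsub hK (by simp [Program.natWrites])) ?_
      ⟨by omega, rfl, fun _ _ => rfl⟩ ?_) (fun s1 ha1 h1 => ?_)
    (T' := 6 + (n ^ k * ((Test.natEq (.var nDone) (.const 0)).cost + 1 + (B + (k * 50 + 60))) +
      ((Test.natEq (.var nDone) (.const 0)).cost + 1)))) ?_
  · rintro j s' v ⟨h1, h2, h3⟩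
    refine ⟨fun i hi => ?_, h2, fun a ha => ?_⟩
    · rw [State.setNat_nat_of_ne (by decide)]; exact h1 i hi
    · rw [State.setNat_nat_of_ne (by rintro rfl; simp at ha)]; exact h3 a ha
  · rintro j s' hj ha hO ⟨h1, h2, h3⟩
    refine WP.le (WP.storeNat ⟨fun i hi => ?_, h2, fun a ha => ?_⟩) (by simp [NatExp.cost])
    · rw [State.setNat_nat_same]
      simp only [NatExp.eval, hO]
      split_ifs
      · rfl
      · exact h1 i (by omega)
    · rw [State.setNat_nat_of_ne (by rintro rfl; simp at ha)]; exact h3 a ha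
  · refine WP.seq (WP.le (WP.storeNat (Q := fun s' => s'.nat nDone 0 = 0 ∧ (∀ i < k, s'.nat nIdx i = 0) ∧
        I 0 s') ⟨?_, fun i hi => ?_, ?_⟩) (by simp [NatExp.cost])) fun s2 ha2 h2 => ?_
    · simp [State.setNat_nat_same, NatExp.eval]
    · rw [State.setNat_nat_of_ne (by decide)]; exact h1.1 i hi
    · refine hI 0 s _ h0 h1.2.1 fun a ha => ?_
      rw [State.setNat_nat_of_ne (by rintro rfl; simp at ha)]; exact h1.2.2 a ha
    · have hag2 : Agree (RealRAM.forTuples K N p) s s2 :=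
        (ha1.mono (by simp [Program.natWrites]) (by simp [Program.realWrites])).trans
          (ha2.mono (by simp [Program.natWrites]) (by simp [Program.realWrites]))
      refine WP.loop (N := n ^ k) (B := B + (k * 50 + 60)) (fun c s' => I c s' ∧
        ((s'.nat nDone 0 = 0 ∧ c < n ^ k ∧ ∀ j < k, s'.nat nIdx j = c / n ^ j % n) ∨
          (s'.nat nDone 0 = 1 ∧ c = n ^ k)))
        ⟨h2.2.2, Or.inl ⟨h2.1, by positivity, fun j hj => by simp [h2.2.1 j hj]⟩⟩ ?_ ?_
      · rintro c s' ha ⟨hIc, hor⟩ hb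
        have hb' : s'.nat nDone 0 = 0 := hb
        have hag : Agree (RealRAM.forTuples K N p) s s' :=
          hag2.trans (ha.mono (by simp [Program.natWrites, hpsub]) (by simp [Program.realWrites]))
        rcases hor with ⟨-, hc, hdig⟩ | ⟨h, -⟩
        · refine ⟨hc, WP.seq (hstep c s' hc hag hdig hIc) fun s3 ha3 hI3 => ?_⟩
          have hag3 : Agree (RealRAM.forTuples K N p) s s3 :=
            hag.trans (ha3.mono (by simp [hpsub]) (by simp))
          have e1 := hK' s3 hag3
          have e2 := hN' s3 hag3
          have := WP.nextTuple (K := K) (N := N) (s := s3) (c := c)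
            (hsub hK (by simp)) (hsub hN (by simp)) hcost
            (by rw [e1, e2]; exact hc)
            (by
              rw [e1, e2, ha3.nat nIdx (hp _ (by simp))]
              exact hdig) (by rw [ha3.nat nDone (hp _ (by simp)), hb'])
          rw [e1, e2] at this
          refine this.post fun s4 ha4 h4 => ⟨hI _ s3 s4 hI3 ?_ ?_, h4⟩
          · funext a
            exact ha4.real a (by simp)
          · intro a ha
            refine ha4.nat a ?_
            simp only [natWrites_nextTuple, List.mem_cons, not_or] at ha ⊢
            tauto
        · omega
      · rintro c s' ha ⟨hIc, hor⟩ hb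
        have hb' : ¬ s'.nat nDone 0 = 0 := hb
        rcases hor with ⟨h, -⟩ | ⟨-, rfl⟩
        · exact absurd h hb'
        · exact hIc
  · simp only [Test.cost, NatExp.cost]
    have : 1 ≤ n ^ k := Nat.one_le_pow _ _ hNpos
    have hKc : K.cost ≤ 10 := by omega
    rw [← hk]
    nlinarith [Nat.zero_le (n ^ k * k), Nat.zero_le (n ^ k * B), Nat.mul_le_mul_left k hKc]

end RealRAM

/-! ### Selection with a tournament tree -/

namespace RealRAM

open Finset

/-- The current node of the tree. -/
abbrev nV : ℕ := 5

/-- The extracted index. -/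
abbrev nE : ℕ := 6

/-- The number of hyperplanes. -/
abbrev nM : ℕ := 7

/-- The tournament tree: the children of the node `v` are `2 * v` and `2 * v + 1`, the root is `1`,
and the leaves are `m, …, 2 * m - 1`. A node holds the index of the smallest remaining key below
it, or `m` if there is none. -/
abbrev nTree : ℕ := 8

/-- The keys. -/
abbrev rKey : ℕ := 2

/-- The weights. -/
abbrev rWt : ℕ := 3

/-- The weight that has been extracted. -/
abbrev rAcc : ℕ := 4

/-- The total weight. -/
abbrev rW : ℕ := 5

/-- The key that was extracted last. -/
abbrev rTau : ℕ := 6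

open Classical in
/-- The winner among two nodes: the index with the smaller key, where `m` stands for no index. -/
noncomputable def winner (key : ℕ → ℝ) (m x y : ℕ) : ℕ :=
  if x = m then y else if y = m then x else if key y < key x then y else x

theorem winner_eq_or (key : ℕ → ℝ) (m x y : ℕ) : winner key m x y = x ∨ winner key m x y = y := by
  rw [winner]
  split_ifs <;> simp

theorem winner_le_left (key : ℕ → ℝ) {m x y : ℕ} (hx : x ≠ m) :
    winner key m x y ≠ m ∧ key (winner key m x y) ≤ key x := by
  rw [winner, if_neg hx]
  split_ifs with h1 h2
  · exact ⟨hx, le_rfl⟩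
  · exact ⟨h1, h2.le⟩
  · exact ⟨hx, le_rfl⟩

theorem winner_le_right (key : ℕ → ℝ) {m x y : ℕ} (hy : y ≠ m) :
    winner key m x y ≠ m ∧ key (winner key m x y) ≤ key y := by
  rw [winner]
  split_ifs with h1 h2
  · exact ⟨hy, le_rfl⟩
  · exact ⟨hy, le_rfl⟩
  · exact ⟨h1, not_lt.1 h2⟩

/-- The node `v` of the tree `T` holds the winner among its children. -/
def NodeOK (key : ℕ → ℝ) (m : ℕ) (T : ℕ → ℕ) (v : ℕ) : Prop :=
  T v = winner key m (T (2 * v)) (T (2 * v + 1))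

/-- The root of the tree holds the index of the smallest key that is not in `E`. -/
theorem root_spec {key : ℕ → ℝ} {m : ℕ} (hm : 1 ≤ m) {T : ℕ → ℕ} {E : Finset ℕ}
    (hT : ∀ v, 1 ≤ v → v < m → NodeOK key m T v)
    (hE : ∀ i < m, T (m + i) = if i ∈ E then m else i) :
    (T 1 = m ∨ T 1 < m ∧ T 1 ∉ E) ∧ ∀ i < m, i ∉ E → T 1 ≠ m ∧ key (T 1) ≤ key i := by
  constructor
  · suffices H : ∀ r v, 1 ≤ v → v < 2 * m → 2 * m - v ≤ r → T v = m ∨ T v < m ∧ T v ∉ E from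
      H (2 * m) 1 le_rfl (by omega) (by omega)
    intro r
    induction r with
    | zero => intro v _ _ _; omega
    | succ r ih =>
      intro v hv hvm hr
      by_cases hlt : v < m
      · rw [hT v hv hlt]
        rcases winner_eq_or key m (T (2 * v)) (T (2 * v + 1)) with h | h
        · rw [h]; exact ih _ (by omega) (by omega) (by omega)
        · rw [h]; exact ih _ (by omega) (by omega) (by omega)
      · obtain ⟨i, rfl⟩ : ∃ i, v = m + i := ⟨v - m, by omega⟩
        rw [hE i (by omega)]
        split_ifs with h
        · exact Or.inl rfl
        · exact Or.inr ⟨by omega, h⟩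
  · intro i hi hiE
    suffices H : ∀ v, 1 ≤ v → v < 2 * m → T v ≠ m ∧ key (T v) ≤ key i →
        T 1 ≠ m ∧ key (T 1) ≤ key i from
      H (m + i) (by omega) (by omega) (by rw [hE i hi, if_neg hiE]; exact ⟨by omega, le_rfl⟩)
    intro v
    induction v using Nat.strong_induction_on with
    | _ v ih =>
      intro hv hvm h
      rcases hv.eq_or_lt with rfl | hv1
      · exact h
      · refine ih (v / 2) (by omega) (by omega) (by omega) ?_
        rw [hT (v / 2) (by omega) (by omega)]
        rcases Nat.even_or_odd' v with ⟨u, rfl | rfl⟩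
        · rw [Nat.mul_div_cancel_left _ (by norm_num)]
          have := winner_le_left key (y := T (2 * u + 1)) h.1
          exact ⟨this.1, this.2.trans h.2⟩
        · rw [show (2 * u + 1) / 2 = u by omega]
          have := winner_le_right key (x := T (2 * u)) h.1
          exact ⟨this.1, this.2.trans h.2⟩

theorem NodeOK.update {key : ℕ → ℝ} {m : ℕ} {T : ℕ → ℕ} {u v x : ℕ} (h : NodeOK key m T u)
    (h0 : u ≠ v) (h1 : 2 * u ≠ v) (h2 : 2 * u + 1 ≠ v) :
    NodeOK key m (Function.update T v x) u := by
  rw [NodeOK, Function.update_of_ne h0, Function.update_of_ne h1, Function.update_of_ne h2]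
  exact h

theorem nodeOK_update_self {key : ℕ → ℝ} {m : ℕ} {T : ℕ → ℕ} {v : ℕ} (hv : 1 ≤ v) :
    NodeOK key m (Function.update T v (winner key m (T (2 * v)) (T (2 * v + 1)))) v := by
  rw [NodeOK, Function.update_self, Function.update_of_ne (by omega),
    Function.update_of_ne (by omega)]

/-- Recomputes the node `nV` from its children. -/
def updateNode : Program :=
  .ite (.natEq (.load nTree (.add (.var nV) (.var nV))) (.var nM))
    (.storeNat nTree (.var nV) (.load nTree (.add (.add (.var nV) (.var nV)) (.const 1)))) <|
  .ite (.natEq (.load nTree (.add (.add (.var nV) (.var nV)) (.const 1))) (.var nM))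
    (.storeNat nTree (.var nV) (.load nTree (.add (.var nV) (.var nV)))) <|
  .ite (.realLt (.load rKey (.load nTree (.add (.add (.var nV) (.var nV)) (.const 1))))
      (.load rKey (.load nTree (.add (.var nV) (.var nV)))))
    (.storeNat nTree (.var nV) (.load nTree (.add (.add (.var nV) (.var nV)) (.const 1))))
    (.storeNat nTree (.var nV) (.load nTree (.add (.var nV) (.var nV))))

theorem WP.updateNode {s : State} :
    WP updateNode s 70 (fun s' => s'.nat nTree =
      Function.update (s.nat nTree) (s.nat nV 0) (winner (s.real rKey) (s.nat nM 0)
        (s.nat nTree (2 * s.nat nV 0)) (s.nat nTree (2 * s.nat nV 0 + 1)))) := by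
  have hupd : ∀ x, ((s.setNat nTree (s.nat nV 0) x).nat nTree) =
      Function.update (s.nat nTree) (s.nat nV 0) x := fun x => by
    simp [State.setNat]
  refine WP.le (WP.ite (T := 60) (fun h1 => ?_) fun h1 => WP.le (WP.ite (T := 40) (fun h2 => ?_)
    fun h2 => WP.le (WP.ite (T := 15) (fun h3 => ?_) fun h3 => ?_) ?_) ?_) ?_
  all_goals try simp only [Test.Holds, NatExp.eval, RealExp.eval, ← two_mul] at *
  · refine WP.le (WP.storeNat ?_) (by simp [NatExp.cost])
    simp only [NatExp.eval, ← two_mul]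
    rw [hupd, winner, if_pos h1]
  · refine WP.le (WP.storeNat ?_) (by simp [NatExp.cost])
    simp only [NatExp.eval, ← two_mul]
    rw [hupd, winner, if_neg h1, if_pos h2]
  · refine WP.le (WP.storeNat ?_) (by simp [NatExp.cost])
    simp only [NatExp.eval, ← two_mul]
    rw [hupd, winner, if_neg h1, if_neg h2, if_pos h3]
  · refine WP.le (WP.storeNat ?_) (by simp [NatExp.cost])
    simp only [NatExp.eval, ← two_mul]
    rw [hupd, winner, if_neg h1, if_neg h2, if_neg h3]
  all_goals simp [Test.cost, NatExp.cost, RealExp.cost]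

/-- Computes all inner nodes from the leaves. -/
def buildTree : Program :=
  .seq (.storeNat nV (.const 0) (.sub (.var nM) (.const 1)))
    (.loop (.natLt (.const 0) (.var nV))
      (.seq updateNode (.storeNat nV (.const 0) (.sub (.var nV) (.const 1)))))

theorem WP.buildTree {s : State} {m : ℕ} (hm : s.nat nM 0 = m) :
    WP buildTree s (m * 100 + 20) (fun s' =>
      (∀ v, 1 ≤ v → v < m → NodeOK (s.real rKey) m (s'.nat nTree) v) ∧
      ∀ j, m ≤ j → s'.nat nTree j = s.nat nTree j) := by
  refine WP.le (WP.seq (WP.storeNat (Q := fun s' => s'.nat nV 0 = m - 1) ?_) fun s1 ha1 h1 =>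
    WP.loop (N := m) (B := 76) (fun k s' => s'.nat nV 0 = m - 1 - k ∧
      (∀ j, m ≤ j → s'.nat nTree j = s.nat nTree j) ∧
      ∀ u, s'.nat nV 0 < u → u < m → NodeOK (s.real rKey) m (s'.nat nTree) u) ?_ ?_ ?_) ?_
  · simp [State.setNat_nat_same, NatExp.eval, hm]
  · exact ⟨h1, fun j _ => by rw [ha1.nat nTree (by decide)], fun u h2 h3 => by omega⟩
  · rintro k s' ha ⟨hv, hleaf, hok⟩ hb
    have hpos : 0 < s'.nat nV 0 := hb
    refine ⟨by omega, WP.seq (T' := 6) WP.updateNode fun s2 ha2 h2 => WP.storeNat ?_⟩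
    have e1 : s2.nat nV 0 = s'.nat nV 0 := by rw [ha2.nat nV (by decide)]
    have e2 : s'.nat nM 0 = m := by
      rw [ha.nat nM (by decide), ha1.nat nM (by decide), hm]
    have e3 : s'.real rKey = s.real rKey := by
      rw [ha.real rKey (by decide), ha1.real rKey (by decide)]
    simp only [State.setNat_nat_same, State.setNat_nat_of_ne (show nTree ≠ nV by decide),
      NatExp.eval, if_true, e1, h2, e2, e3, hv]
    set v := m - 1 - k with hvdef
    refine ⟨by omega, fun j hj => ?_, fun u hu hum => ?_⟩
    · rw [Function.update_of_ne (by omega), hleaf j hj]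
    · rcases (show v ≤ u by omega).eq_or_lt with rfl | hlt
      · exact nodeOK_update_self (by omega)
      · exact (hok u (by omega) hum).update (by omega) (by omega) (by omega)
  · rintro k s' ha ⟨hv, hleaf, hok⟩ hb
    have hpos : ¬ 0 < s'.nat nV 0 := hb
    exact ⟨fun v h2 h3 => hok v (by omega) h3, hleaf⟩
  · simp only [Test.cost, NatExp.cost]
    omega

/-- Removes the smallest key from the tree and adds its weight to `rAcc`. -/
def extractMin : Program :=
  .seq (.storeNat nE (.const 0) (.load nTree (.const 1))) <|
  .seq (.storeReal rAcc (.const 0) (.add (.var rAcc) (.load rWt (.var nE)))) <|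
  .seq (.storeReal rTau (.const 0) (.load rKey (.var nE))) <|
  .seq (.storeNat nTree (.add (.var nM) (.var nE)) (.var nM)) <|
  .seq (.storeNat nV (.const 0) (.half (.add (.var nM) (.var nE)))) <|
  .loop (.natLt (.const 0) (.var nV))
    (.seq updateNode (.storeNat nV (.const 0) (.half (.var nV))))

theorem WP.extractMin {s : State} {m e : ℕ} {E : Finset ℕ} (hm : s.nat nM 0 = m)
    (he : s.nat nTree 1 = e) (hem : e < m)
    (hok : ∀ v, 1 ≤ v → v < m → NodeOK (s.real rKey) m (s.nat nTree) v)
    (hleaf : ∀ i < m, s.nat nTree (m + i) = if i ∈ E then m else i) :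
    WP extractMin s (Nat.log 2 (2 * m) * 100 + 100) (fun s' =>
      s'.real rAcc 0 = s.real rAcc 0 + s.real rWt e ∧ s'.real rTau 0 = s.real rKey e ∧
      (∀ v, 1 ≤ v → v < m → NodeOK (s.real rKey) m (s'.nat nTree) v) ∧
      ∀ i < m, s'.nat nTree (m + i) = if i ∈ insert e E then m else i) := by
  refine WP.le (T := 4 + (10 + (10 + (10 + (10 +
    (Nat.log 2 (2 * m) * ((Test.natLt (.const 0) (.var nV)).cost + 1 + 80) +
      ((Test.natLt (.const 0) (.var nV)).cost + 1))))))) ?_ (by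
        simp only [Test.cost, NatExp.cost]; omega)
  refine WP.seq (WP.storeNat (Q := fun s' => s' = s.setNat nE 0 e) ?_) fun s1 _ h1 =>
    WP.seq (WP.le (WP.storeReal (Q := fun s' => s' = s1.setReal rAcc 0 (s.real rAcc 0 + s.real rWt e))
      ?_) ?_) fun s2 _ h2 =>
    WP.seq (WP.le (WP.storeReal (Q := fun s' => s' = s2.setReal rTau 0 (s.real rKey e)) ?_) ?_)
      fun s3 _ h3 =>
    WP.seq (WP.le (WP.storeNat (Q := fun s' => s' = s3.setNat nTree (m + e) m) ?_) ?_) fun s4 _ h4 =>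
    WP.seq (WP.le (WP.storeNat (Q := fun s' => s' = s4.setNat nV 0 ((m + e) / 2)) ?_) ?_)
      fun s5 _ h5 => ?_
  · simp [NatExp.eval, he]
  · subst h1
    simp [NatExp.eval, RealExp.eval, State.setNat_nat_same]
  · simp [NatExp.cost, RealExp.cost]
  · subst h2 h1
    simp [NatExp.eval, RealExp.eval, State.setNat_nat_same,
      State.setReal_real_of_ne (show rKey ≠ rAcc by decide)]
  · simp [NatExp.cost, RealExp.cost]
  · subst h3 h2 h1
    simp [NatExp.eval, State.setNat_nat_same, State.setNat_nat_of_ne (show nM ≠ nE by decide), hm]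
  · simp [NatExp.cost]
  · subst h4 h3 h2 h1
    simp [NatExp.eval, State.setNat_nat_same, State.setNat_nat_of_ne (show nM ≠ nE by decide), hm,
      State.setNat_nat_of_ne (show nM ≠ nTree by decide),
      State.setNat_nat_of_ne (show nE ≠ nTree by decide)]
  · simp [NatExp.cost]
  · have hkey : s5.real rKey = s.real rKey := by
      subst h5 h4 h3 h2 h1
      simp [State.setReal_real_of_ne (show rKey ≠ rAcc by decide),
        State.setReal_real_of_ne (show rKey ≠ rTau by decide)]
    have hM : s5.nat nM 0 = m := by
      subst h5 h4 h3 h2 h1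
      simp [State.setNat_nat_of_ne (show nM ≠ nV by decide),
        State.setNat_nat_of_ne (show nM ≠ nTree by decide),
        State.setNat_nat_of_ne (show nM ≠ nE by decide), hm]
    have hT : s5.nat nTree = Function.update (s.nat nTree) (m + e) m := by
      subst h5 h4 h3 h2 h1
      simp [State.setNat]
    have hV : s5.nat nV 0 = (m + e) / 2 := by
      subst h5
      simp [State.setNat_nat_same]
    have hacc : s5.real rAcc 0 = s.real rAcc 0 + s.real rWt e := by
      subst h5 h4 h3 h2 h1
      simp [State.setReal_real_of_ne (show rAcc ≠ rTau by decide), State.setReal_real_same]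
    have htau : s5.real rTau 0 = s.real rKey e := by
      subst h5 h4 h3 h2 h1
      simp [State.setReal_real_same]
    -- on the way from the leaf to the root, only the current node may violate the tree condition
    refine WP.loop (fun k s' => s'.nat nV 0 = (m + e) / 2 ^ (k + 1) ∧
      (∀ u, 1 ≤ u → u < m → u ≠ s'.nat nV 0 → NodeOK (s.real rKey) m (s'.nat nTree) u) ∧
      ∀ i < m, s'.nat nTree (m + i) = if i ∈ insert e E then m else i) ?_ ?_ ?_
    · refine ⟨by simpa using hV, fun u hu hum hne => ?_, fun i hi => ?_⟩
      · rw [hT]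
        exact (hok u hu hum).update (by omega) (by omega) (by omega)
      · rw [hT, Function.update_apply, hleaf i hi]
        by_cases hie : i = e
        · simp [hie]
        · simp [hie]
    · rintro k s' ha ⟨hv, hok', hleaf'⟩ hb
      have hpos : 0 < s'.nat nV 0 := hb
      have hk : 2 ^ (k + 1) ≤ 2 * m := by
        rw [hv] at hpos
        by_contra hcon
        rw [Nat.div_eq_of_lt (by omega)] at hpos
        omega
      have hvm : s'.nat nV 0 < m := by
        have : (m + e) / 2 ^ (k + 1) ≤ (m + e) / 2 ^ 1 :=
          Nat.div_le_div_left (Nat.pow_le_pow_right (by norm_num) (by omega)) (by norm_num)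
        omega
      refine ⟨Nat.lt_of_succ_le (Nat.le_log_of_pow_le (by norm_num) hk),
        WP.le (WP.seq WP.updateNode fun s6 ha6 h6 => WP.storeNat ?_) (by simp [NatExp.cost])⟩
      have e1 : s6.nat nV 0 = s'.nat nV 0 := by rw [ha6.nat nV (by decide)]
      have e2 : s'.nat nM 0 = m := by rw [ha.nat nM (by decide), hM]
      have e3 : s'.real rKey = s.real rKey := by rw [ha.real rKey (by decide), hkey]
      simp only [State.setNat_nat_same, State.setNat_nat_of_ne (show nTree ≠ nV by decide),
        NatExp.eval, if_true, e1, h6, e2, e3]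
      refine ⟨?_, fun u hu hum hne => ?_, fun i hi => ?_⟩
      · rw [hv, Nat.div_div_eq_div_mul, ← pow_succ]
      · by_cases huv : u = s'.nat nV 0
        · rw [huv]
          exact nodeOK_update_self (by omega)
        · exact (hok' u hu hum huv).update huv (by omega) (by omega)
      · rw [Function.update_of_ne (by omega), hleaf' i hi]
    · rintro k s' ha ⟨hv, hok', hleaf'⟩ hb
      have hpos : ¬ 0 < s'.nat nV 0 := hb
      refine ⟨?_, ?_, fun u hu hum => hok' u hu hum (by omega), hleaf'⟩
      · rw [ha.real rAcc (by decide), hacc]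
      · rw [ha.real rTau (by decide), htau]

/-- Extracts keys until half of the total weight is reached. -/
def selectMedian : Program :=
  .loop (.realLt (.add (.var rAcc) (.var rAcc)) (.var rW)) extractMin

/-- The last extracted key is a weighted median. -/
theorem WP.selectMedian {s : State} {m : ℕ} (hm1 : 1 ≤ m) (hm : s.nat nM 0 = m)
    (hw : ∀ i < m, 0 ≤ s.real rWt i) (hW : s.real rW 0 = ∑ i ∈ range m, s.real rWt i)
    (hacc : s.real rAcc 0 = 0)
    (hok : ∀ v, 1 ≤ v → v < m → NodeOK (s.real rKey) m (s.nat nTree) v)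
    (hleaf : ∀ i < m, s.nat nTree (m + i) = i) :
    WP selectMedian s (m * (Nat.log 2 (2 * m) * 100 + 120) + 20) (fun s' =>
      ∀ x, ∑ i ∈ range m, s.real rWt i * |s'.real rTau 0 - s.real rKey i| ≤
        ∑ i ∈ range m, s.real rWt i * |x - s.real rKey i|) := by
  set w := s.real rWt with hwdef
  set key := s.real rKey with hkeydef
  have hWn : 0 ≤ ∑ i ∈ range m, w i := sum_nonneg fun i hi => hw i (mem_range.1 hi)
  -- `E` is the set of the extracted indices, and `e` is the last of them: without it, less than half
  -- of the weight has been extracted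
  refine WP.le (WP.loop (N := m) (B := Nat.log 2 (2 * m) * 100 + 100) (fun k s' =>
    ∃ E ⊆ range m, #E = k ∧ s'.real rAcc 0 = ∑ i ∈ E, w i ∧
      (∀ v, 1 ≤ v → v < m → NodeOK key m (s'.nat nTree) v) ∧
      (∀ i < m, s'.nat nTree (m + i) = if i ∈ E then m else i) ∧
      (∀ i ∈ E, ∀ j ∈ range m \ E, key i ≤ key j) ∧
      (E = ∅ ∨ ∃ e ∈ E, s'.real rTau 0 = key e ∧ (∀ i ∈ E, key i ≤ key e) ∧
        2 * ∑ i ∈ E.erase e, w i < ∑ i ∈ range m, w i)) ?_ ?_ ?_) ?_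
  · exact ⟨∅, by simp, by simp, by simpa using hacc, hok, by simpa using hleaf, by simp,
      Or.inl rfl⟩
  · rintro k s' ha ⟨E, hE, hcard, hacc', hok', hleaf', hsort, -⟩ hb
    have hb' : s'.real rAcc 0 + s'.real rAcc 0 < s'.real rW 0 := hb
    rw [ha.real rW (by decide), hW, hacc'] at hb'
    obtain ⟨hroot, hmin⟩ := root_spec hm1 hok' hleaf'
    have hex : ∃ i < m, i ∉ E := by
      by_contra! hcon
      have : E = range m := subset_antisymm hE fun i hi => hcon i (mem_range.1 hi)
      rw [this] at hb'
      linarith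
    obtain ⟨i0, hi0, hi0E⟩ := hex
    obtain ⟨hem, heE⟩ := hroot.resolve_left (hmin i0 hi0 hi0E).1
    set e := s'.nat nTree 1 with he
    have hkey' : s'.real rKey = key := by rw [ha.real rKey (by decide)]
    have hw' : s'.real rWt = w := by rw [ha.real rWt (by decide)]
    have hins : insert e E ⊆ range m := insert_subset (mem_range.2 hem) hE
    refine ⟨?_, (WP.extractMin (E := E) (m := m) (by rw [ha.nat nM (by decide), hm]) he.symm hem
      (by rw [hkey']; exact hok') hleaf').post fun s2 ha2 h2 => ?_⟩
    · have := card_le_card hins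
      rw [card_insert_of_notMem heE, card_range] at this
      omega
    · rw [hkey', hw', hacc'] at h2
      obtain ⟨h3, h4, h5, h6⟩ := h2
      refine ⟨insert e E, hins, by rw [card_insert_of_notMem heE, hcard],
        by rw [h3, sum_insert heE, add_comm], h5, h6, ?_, Or.inr ⟨e, mem_insert_self _ _, h4, ?_, ?_⟩⟩
      · intro i hi j hj
        simp only [mem_sdiff, mem_insert, not_or, mem_range] at hi hj
        rcases hi with rfl | hi
        · exact (hmin j hj.1 hj.2.2).2
        · exact hsort i hi j (by simp [hj.1, hj.2.2])
      · intro i hi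
        rcases mem_insert.1 hi with rfl | hi
        · exact le_rfl
        · exact hsort i hi e (by simp [hem, heE])
      · rw [erase_insert heE]
        linarith
  · rintro k s' ha ⟨E, hE, hcard, hacc', hok', hleaf', hsort, htau⟩ hb x
    have hb' : ¬ s'.real rAcc 0 + s'.real rAcc 0 < s'.real rW 0 := hb
    rw [ha.real rW (by decide), hW, hacc'] at hb'
    rcases htau with rfl | ⟨e, heE, htau, hle, hlt⟩
    · -- if nothing has been extracted, then all weights are zero
      have hz : ∑ i ∈ range m, w i = 0 := le_antisymm (by simpa using hb') hWn
      have hz' := (sum_eq_zero_iff_of_nonneg fun i hi => hw i (mem_range.1 hi)).1 hz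
      rw [sum_eq_zero fun i hi => by rw [hz' i hi, zero_mul],
        sum_eq_zero fun i hi => by rw [hz' i hi, zero_mul]]
    · rw [htau]
      refine HDD.weightedMedian_le (A := E) (B := E.erase e) (fun i hi => hw i (mem_range.1 hi)) hE
        ((erase_subset _ _).trans hE) hle (by linarith) (fun i hi => ?_) hlt.le x
      by_cases hie : i = e
      · rw [hie]
      · simp only [mem_sdiff, mem_erase, not_and] at hi
        exact hsort e heE i (mem_sdiff.2 ⟨hi.1, hi.2 hie⟩)
  · simp only [Test.cost, NatExp.cost, RealExp.cost]
    nlinarith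

end RealRAM

/-! ### Projections by rank-one updates -/

namespace RealRAM

open Finset Module HDD

/-- The row that is being updated. -/
abbrev nI : ℕ := 9

/-- The vector of the tuple that is being processed. -/
abbrev nJ : ℕ := 10

/-- The standard basis vector whose residual is being used. -/
abbrev nK : ℕ := 11

/-- The hyperplane that is being processed. -/
abbrev nH : ℕ := 12

/-- The multiples of the dimension, as offsets of the rows of a matrix and of the points. -/
abbrev nRow : ℕ := 13

/-- The multiples of the dimension, as offsets of the normals. -/
abbrev nHRow : ℕ := 14

/-- The dimension of the span of the processed vectors. -/
abbrev nCnt : ℕ := 15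

/-- The normals of the hyperplanes. -/
abbrev rHA : ℕ := 7

/-- The offsets of the hyperplanes. -/
abbrev rHB : ℕ := 8

/-- The residuals of the standard basis vectors. -/
abbrev rQ : ℕ := 9

/-- A point on all processed hyperplanes. -/
abbrev rX : ℕ := 10

/-- The normal of the hyperplane that is being processed. -/
abbrev rA : ℕ := 11

/-- The offset of the hyperplane that is being processed. -/
abbrev rB : ℕ := 12

/-- The residual of `rA`. -/
abbrev rR : ℕ := 13

/-- A squared norm or an inner product. -/
abbrev rC : ℕ := 14

/-- An inner product. -/
abbrev rG : ℕ := 15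

/-- The current candidate. -/
abbrev rY : ℕ := 16

/-- The sum of the distances from the current candidate. -/
abbrev rD : ℕ := 17

/-- The rows of `rQ` are the residuals of the standard basis vectors with respect to `S`. -/
def Residuals (d : ℕ) (s : State) (S : Submodule ℝ (EuclideanSpace ℝ (Fin d))) : Prop :=
  ∀ k < d, vec d s rQ (k * d) = residual S (unitVec d k)

theorem vec_eq_of_forall {d : ℕ} {s s' : State} {A o : ℕ}
    (h : ∀ j < d, s'.real A (o + j) = s.real A (o + j)) : vec d s' A o = vec d s A o := by
  ext j
  exact h j j.2

theorem row_lt {d i k j : ℕ} (h : k < i) (hj : j < d) : k * d + j < i * d := by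
  have := Nat.mul_le_mul_right d (Nat.succ_le_of_lt h)
  rw [Nat.succ_mul] at this
  omega

/-- Initializes the rows of `rQ` with the standard basis vectors. -/
def initRows : Program :=
  .seq (.storeNat nCnt (.const 0) (.const 0)) <|
  forLoop nI dimE
    (.seq (scaleLoop rQ (.load nRow (.var nI)) (.const 0) rR (.const 0))
      (.storeReal rQ (.add (.load nRow (.var nI)) (.var nI)) (.const 1)))

theorem WP.initRows {d : ℕ} {s : State} (hd : s.nat nIn 1 = d)
    (hrow : ∀ i < d, s.nat nRow i = i * d) :
    WP initRows s (d * (70 * d + 70) + 30) (fun s' => Residuals d s' ⊥ ∧ s'.nat nCnt 0 = 0) := by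
  refine WP.le (T := 3 + (d * (2 + (70 * d + 30 + 10) + 10) + (2 + 10))) ?_ (by nlinarith)
  refine WP.seq (WP.storeNat (Q := fun s' => s'.nat nCnt 0 = 0) ?_) fun s1 ha1 h1 => ?_
  · simp [State.setNat_nat_same, NatExp.eval]
  have hd1 : s1.nat nIn 1 = d := by rw [ha1.nat nIn (by decide), hd]
  have hE : dimE.eval s1 = d := hd1
  refine WP.post (WP.forLoop (B := 70 * d + 30 + 10)
    (fun i s' => ∀ k < i, vec d s' rQ (k * d) = unitVec d k)
    hE (by decide) (by decide) (fun _ _ _ h => h) (by omega) ?_) ?_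
  · intro i s' hi ha hI h
    have hd' : s'.nat nIn 1 = d := by rw [ha.nat nIn (by decide), hd1]
    have hr : s'.nat nRow i = i * d := by
      rw [ha.nat nRow (by decide), ha1.nat nRow (by decide), hrow i hi]
    refine WP.seq (WP.scaleLoop hd' (by decide) (by decide) (by decide) (by decide) (by decide)
      (by decide)) fun s2 ha2 h2 => WP.le (WP.storeReal ?_) (by simp [NatExp.cost, RealExp.cost])
    have hr2 : s2.nat nRow i = i * d := by rw [ha2.nat nRow (by decide), hr]
    have hI2 : s2.nat nI 0 = i := by rw [ha2.nat nI (by decide), hI]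
    simp only [NatExp.eval, RealExp.eval, hI, hr, Int.cast_zero, zero_smul] at h2
    simp only [NatExp.eval, RealExp.eval, hI2, hr2, Int.cast_one]
    intro k hk
    rcases (Nat.lt_succ_iff.1 hk).lt_or_eq with hk | rfl
    · rw [← h k hk]
      refine vec_eq_of_forall fun j hj => ?_
      have := row_lt hk hj
      rw [State.setReal_real_same, if_neg (by omega)]
      exact h2.2 _ (Or.inl this)
    · ext j
      have := congrFun (congrArg WithLp.ofLp h2.1) j
      simp only [vec_apply] at this
      rw [vec_apply, State.setReal_real_same, unitVec_apply, this]
      simp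
  · intro s' ha h
    refine ⟨fun k hk => ?_, ?_⟩
    · rw [residual_bot]
      exact h k hk
    · rw [ha.nat nCnt (by decide), h1]

/-- Computes the residual of `rA`. -/
def computeResidual : Program :=
  forLoop nI dimE
    (.seq (dotLoop rQ (.load nRow (.var nI)) rA (.const 0) rG)
      (.storeReal rR (.var nI) (.var rG)))

theorem WP.computeResidual {d : ℕ} {s : State} (hd : s.nat nIn 1 = d)
    (hrow : ∀ i < d, s.nat nRow i = i * d) {S : Submodule ℝ (EuclideanSpace ℝ (Fin d))}
    (hQ : Residuals d s S) :
    WP computeResidual s (d * (50 * d + 60) + 20) (fun s' =>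
      vec d s' rR 0 = residual S (vec d s rA 0)) := by
  refine WP.le (T := d * (2 + (50 * d + 30 + 10) + 10) + (2 + 10)) ?_ (by nlinarith)
  have hE : dimE.eval s = d := hd
  refine WP.post (WP.forLoop (B := 50 * d + 30 + 10)
    (fun i s' => ∀ k (hk : k < d), k < i → s'.real rR k = residual S (vec d s rA 0) ⟨k, hk⟩)
    hE (by decide) (by decide) (fun _ _ _ h => h) (by omega) ?_) ?_
  · intro i s' hi ha hI h
    have hd' : s'.nat nIn 1 = d := by rw [ha.nat nIn (by decide), hd]
    have hr : s'.nat nRow i = i * d := by rw [ha.nat nRow (by decide), hrow i hi]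
    refine WP.seq (WP.dotLoop hd' (by decide) (by decide) (by decide) (by decide) (by decide))
      fun s2 ha2 h2 => WP.le (WP.storeReal ?_) (by simp [NatExp.cost, RealExp.cost])
    have hI2 : s2.nat nI 0 = i := by rw [ha2.nat nI (by decide), hI]
    simp only [NatExp.eval, hI, hr] at h2
    rw [vec_congr (ha.real rQ (by decide)), vec_congr (ha.real rA (by decide)), hQ i hi,
      inner_residual_comm, real_inner_comm, ← Fin.val_mk hi, inner_unitVec] at h2
    simp only [NatExp.eval, RealExp.eval, hI2, h2]
    intro k hk hki
    rw [State.setReal_real_same]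
    split_ifs with hk'
    · subst hk'; rfl
    · rw [ha2.real rR (by decide)]
      exact h k hk (by omega)
  · intro s' ha h
    ext j
    rw [vec_apply, zero_add]
    exact h j j.2 j.2

/-- Subtracts from the rows of `rQ` their components along `rR`. -/
def updateRows : Program :=
  forLoop nI dimE
    (axpyLoop rQ (.load nRow (.var nI)) rQ (.load nRow (.var nI))
      (.sub (.const 0) (.div (.load rR (.var nI)) (.var rC))) rR (.const 0))

theorem WP.updateRows {d : ℕ} {s : State} (hd : s.nat nIn 1 = d)
    (hrow : ∀ i < d, s.nat nRow i = i * d) {S : Submodule ℝ (EuclideanSpace ℝ (Fin d))}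
    (hQ : Residuals d s S) {a : EuclideanSpace ℝ (Fin d)} (hR : vec d s rR 0 = residual S a)
    (hC : s.real rC 0 = inner ℝ (residual S a) (residual S a)) :
    WP updateRows s (d * (70 * d + 60) + 20) (fun s' =>
      Residuals d s' (S ⊔ Submodule.span ℝ {a})) := by
  refine WP.le (T := d * (2 + (70 * d + 30) + 10) + (2 + 10)) ?_ (by nlinarith)
  have hE : dimE.eval s = d := hd
  refine WP.post (WP.forLoop (B := 70 * d + 30)
    (fun i s' => ∀ k < d, vec d s' rQ (k * d) =
      if k < i then residual (S ⊔ Submodule.span ℝ {a}) (unitVec d k)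
      else residual S (unitVec d k))
    hE (by decide) (by decide) (fun _ _ _ h => h) ?_ ?_) ?_
  · intro k hk
    rw [if_neg (by omega), hQ k hk]
  · intro i s' hi ha hI h
    have hd' : s'.nat nIn 1 = d := by rw [ha.nat nIn (by decide), hd]
    have hr : s'.nat nRow i = i * d := by rw [ha.nat nRow (by decide), hrow i hi]
    refine WP.post (WP.axpyLoop hd' (by decide) (by decide) (by decide) (by decide) (by decide)
      (Or.inr ⟨rfl, rfl⟩) (by decide) (by decide)) fun s2 ha2 h2 => ?_
    have hri : s.real rR i = inner ℝ (residual S a) (unitVec d i) := by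
      rw [← Fin.val_mk hi, inner_unitVec, ← hR, vec_apply, zero_add]
    simp only [NatExp.eval, RealExp.eval, hI, hr, ha.real rR (by decide), ha.real rC (by decide),
      vec_congr (ha.real rR (by decide)), hR, hC, hri] at h2
    intro k hk
    rcases lt_trichotomy k i with hki | rfl | hki
    · rw [if_pos (by omega), ← (h k hk).trans (if_pos hki)]
      exact vec_eq_of_forall fun j hj => h2.2 _ (Or.inl (row_lt hki hj))
    · rw [if_pos (by omega), h2.1, h k hk, if_neg (by omega), residual_sup]
      simp [sub_eq_add_neg]
    · rw [if_neg (by omega), ← (h k hk).trans (if_neg (by omega))]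
      refine vec_eq_of_forall fun j hj => h2.2 _ (Or.inr ?_)
      have := Nat.mul_le_mul_right d (Nat.succ_le_of_lt hki)
      rw [Nat.succ_mul] at this
      omega
  · intro s' ha h k hk
    rw [h k hk, if_pos hk]

/-- Updates the residuals, the common point and the dimension for one more vector. -/
def projectStep : Program :=
  .seq computeResidual <|
  .seq (dotLoop rR (.const 0) rR (.const 0) rC) <|
  .seq (dotLoop rA (.const 0) rX (.const 0) rG) <|
  .seq (axpyLoop rX (.const 0) rX (.const 0) (.div (.sub (.var rB) (.var rG)) (.var rC))
    rR (.const 0)) <|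
  .seq updateRows <|
  .ite (.realEq (.var rC) (.const 0)) .skip
    (.storeNat nCnt (.const 0) (.add (.var nCnt) (.const 1)))

theorem WP.projectStep {d : ℕ} {s : State} (hd : s.nat nIn 1 = d)
    (hrow : ∀ i < d, s.nat nRow i = i * d) {S : Submodule ℝ (EuclideanSpace ℝ (Fin d))}
    (hQ : Residuals d s S) {a : EuclideanSpace ℝ (Fin d)} (ha : vec d s rA 0 = a) :
    WP projectStep s (d * (120 * d + 300) + 200) (fun s' =>
      Residuals d s' (S ⊔ Submodule.span ℝ {a}) ∧
      vec d s' rX 0 = vec d s rX 0 + ((s.real rB 0 - inner ℝ a (vec d s rX 0)) /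
        inner ℝ (residual S a) (residual S a)) • residual S a ∧
      s'.nat nCnt 0 + finrank ℝ S =
        s.nat nCnt 0 + finrank ℝ (S ⊔ Submodule.span ℝ {a} : Submodule ℝ _)) := by
  refine WP.le (T := (d * (50 * d + 60) + 20) + ((50 * d + 30) + ((50 * d + 30) + ((70 * d + 30) +
    ((d * (70 * d + 60) + 20) + (4 + 1 + 6)))))) ?_ (by nlinarith)
  refine WP.seq (WP.computeResidual hd hrow hQ) fun s1 ha1 h1 => ?_
  rw [ha] at h1
  have hd1 : s1.nat nIn 1 = d := by rw [ha1.nat nIn (by decide), hd]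
  refine WP.seq (WP.dotLoop hd1 (by decide) (by decide) (by decide) (by decide) (by decide))
    fun s2 ha2 h2 => ?_
  simp only [NatExp.eval, h1] at h2
  have hd2 : s2.nat nIn 1 = d := by rw [ha2.nat nIn (by decide), hd1]
  refine WP.seq (WP.dotLoop hd2 (by decide) (by decide) (by decide) (by decide) (by decide))
    fun s3 ha3 h3 => ?_
  have hx2 : vec d s2 rX 0 = vec d s rX 0 := by
    rw [vec_congr (ha2.real rX (by decide)), vec_congr (ha1.real rX (by decide))]
  have hA2 : vec d s2 rA 0 = a := by
    rw [vec_congr (ha2.real rA (by decide)), vec_congr (ha1.real rA (by decide)), ha]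
  simp only [NatExp.eval, hx2, hA2] at h3
  have hd3 : s3.nat nIn 1 = d := by rw [ha3.nat nIn (by decide), hd2]
  refine WP.seq (WP.axpyLoop hd3 (by decide) (by decide) (by decide) (by decide) (by decide)
    (Or.inr ⟨rfl, rfl⟩) (by decide) (by decide)) fun s4 ha4 h4 => ?_
  have hR3 : vec d s3 rR 0 = residual S a := by
    rw [vec_congr (ha3.real rR (by decide)), vec_congr (ha2.real rR (by decide)), h1]
  have hC3 : s3.real rC 0 = inner ℝ (residual S a) (residual S a) := by
    rw [ha3.real rC (by decide), h2]
  have hB3 : s3.real rB = s.real rB := by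
    rw [ha3.real rB (by decide), ha2.real rB (by decide), ha1.real rB (by decide)]
  simp only [NatExp.eval, RealExp.eval, vec_congr (ha3.real rX (by decide)), hx2, hR3, hC3, hB3,
    h3] at h4
  have hd4 : s4.nat nIn 1 = d := by rw [ha4.nat nIn (by decide), hd3]
  have hrow4 : ∀ i < d, s4.nat nRow i = i * d := by
    rw [ha4.nat nRow (by decide), ha3.nat nRow (by decide), ha2.nat nRow (by decide),
      ha1.nat nRow (by decide)]
    exact hrow
  have hQ4 : Residuals d s4 S := by
    intro k hk
    rw [vec_congr (ha4.real rQ (by decide)), vec_congr (ha3.real rQ (by decide)),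
      vec_congr (ha2.real rQ (by decide)), vec_congr (ha1.real rQ (by decide))]
    exact hQ k hk
  refine WP.seq (WP.updateRows hd4 hrow4 hQ4 (a := a)
    (by rw [vec_congr (ha4.real rR (by decide)), hR3])
    (by rw [ha4.real rC (by decide), hC3])) fun s5 ha5 h5 => ?_
  have hX5 : vec d s5 rX 0 = vec d s4 rX 0 := vec_congr (ha5.real rX (by decide))
  have hn5 : s5.nat nCnt = s.nat nCnt := by
    rw [ha5.nat nCnt (by decide), ha4.nat nCnt (by decide), ha3.nat nCnt (by decide),
      ha2.nat nCnt (by decide), ha1.nat nCnt (by decide)]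
  have hC5 : s5.real rC 0 = inner ℝ (residual S a) (residual S a) := by
    rw [ha5.real rC (by decide), ha4.real rC (by decide), hC3]
  classical
  have hfin := finrank_sup_span_singleton S a
  refine WP.ite (fun hb => WP.le (WP.skip ?_) (by norm_num)) fun hb => WP.storeNat ?_
  · have hb' : s5.real rC 0 = ((0 : ℤ) : ℝ) := hb
    rw [hC5, Int.cast_zero, inner_self_eq_zero] at hb'
    rw [if_pos hb'] at hfin
    refine ⟨h5, by rw [hX5, h4.1], ?_⟩
    rw [hn5, hfin, add_zero]
  · have hb' : ¬ s5.real rC 0 = ((0 : ℤ) : ℝ) := hb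
    rw [hC5, Int.cast_zero, inner_self_eq_zero] at hb'
    rw [if_neg hb'] at hfin
    refine ⟨h5, by rw [← h4.1, ← hX5]; rfl, ?_⟩
    rw [State.setNat_nat_same]
    simp only [NatExp.eval, if_true, hn5]
    omega

/-- Processes `K` vectors, which are loaded one by one into `rA`, together with their offsets in
`rB`. The initial value of `rX` does not matter. -/
def projectAll (K : NatExp) (load : Program) : Program :=
  .seq initRows (forLoop nJ K (.seq load projectStep))

theorem WP.projectAll {d : ℕ} {K : NatExp} {load : Program} {s : State} {k T : ℕ}
    (hk : K.eval s = k) (hd : s.nat nIn 1 = d) (hrow : ∀ i < d, s.nat nRow i = i * d)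
    (hload : load.natWrites = [nL, nL]) (hload' : ∀ a ∈ load.realWrites, a ∈ [rA, rB])
    (hK : ∀ a ∈ K.reads, a ∈ [nIn]) (hcost : K.cost ≤ 10)
    {a : ℕ → EuclideanSpace ℝ (Fin d)} {b : ℕ → ℝ}
    (hstep : ∀ j s', j < k → Agree (projectAll K load) s s' → s'.nat nJ 0 = j →
      WP load s' T (fun s'' => vec d s'' rA 0 = a j ∧ s''.real rB 0 = b j)) :
    WP (projectAll K load) s (d * (70 * d + 70) +
        k * (T + d * (120 * d + 300) + 220) + 50) (fun s' =>
      Residuals d s' (spanBefore a (k)) ∧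
      s'.nat nCnt 0 = finrank ℝ (spanBefore a (k)) ∧
      ∀ z, (∀ j < k, inner ℝ (a j) z = b j) →
        z - vec d s' rX 0 ∈ (spanBefore a (k))ᗮ) := by
  refine WP.le (T := (d * (70 * d + 70) + 30) +
    (k * (K.cost + (T + (d * (120 * d + 300) + 200)) + 10) + (K.cost + 10))) ?_
    (by nlinarith [Nat.mul_le_mul_left k hcost])
  refine WP.seq (WP.initRows hd hrow) fun s1 ha1 h1 => ?_
  have hKr : ∀ a ∈ K.reads, a ∉ (RealRAM.forLoop nJ K (.seq load RealRAM.projectStep)).natWrites := by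
    intro a ha
    have := hK a ha
    simp only [List.mem_singleton] at this
    subst this
    simp only [natWrites_forLoop, Program.natWrites, hload]
    decide
  have hKr1 : ∀ a ∈ K.reads, a ∉ RealRAM.initRows.natWrites := by
    intro a ha
    have := hK a ha
    simp only [List.mem_singleton] at this
    subst this
    decide
  have hK1 : K.eval s1 = k := (ha1.natEval K hKr1).trans hk
  refine WP.forLoop (B := T + (d * (120 * d + 300) + 200)) (fun j s' =>
      Residuals d s' (spanBefore a j) ∧ s'.nat nCnt 0 = finrank ℝ (spanBefore a j) ∧
      ∀ z, (∀ i < j, inner ℝ (a i) z = b i) → z - vec d s' rX 0 ∈ (spanBefore a j)ᗮ)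
    hK1 ?_ hKr ?_ ?_ ?_
  · simp only [Program.natWrites, hload]
    decide
  · intro j s' v h
    rw [State.setNat_nat_of_ne (by decide)]
    exact h
  · rw [spanBefore_zero]
    exact ⟨h1.1, by rw [h1.2, finrank_bot], fun z _ => by simp⟩
  · rintro j s' hj ha hJ ⟨hres, hcnt, hz⟩
    have hmemn : ∀ x, x ≠ nL → x ≠ nJ → x ∉ RealRAM.projectStep.natWrites →
        x ∉ (RealRAM.forLoop nJ K (.seq load RealRAM.projectStep)).natWrites := by
      intro x h1 h2 h3
      simp only [natWrites_forLoop, Program.natWrites, hload, List.mem_cons, List.mem_append,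
        List.not_mem_nil, h1, h2, h3, or_self, not_false_eq_true]
    have hd' : s'.nat nIn 1 = d := by
      rw [ha.nat nIn (hmemn _ (by decide) (by decide) (by decide)), ha1.nat nIn (by decide), hd]
    have hrow' : ∀ i < d, s'.nat nRow i = i * d := by
      rw [ha.nat nRow (hmemn _ (by decide) (by decide) (by decide)), ha1.nat nRow (by decide)]
      exact hrow
    have hag : Agree (RealRAM.projectAll K load) s s' :=
      (ha1.mono (List.subset_append_left _ _) (List.subset_append_left _ _)).trans
        (ha.mono (List.subset_append_right _ _) (List.subset_append_right _ _))
    refine WP.seq (hstep j s' hj hag hJ) fun s2 ha2 h2 => ?_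
    have hln : ∀ x, x ≠ nL → x ∉ load.natWrites := fun x hx => by simp [hload, hx]
    have hlr : ∀ x, x ∉ [rA, rB] → x ∉ load.realWrites := fun x hx h => hx (hload' x h)
    refine WP.post (WP.projectStep (a := a j) (S := spanBefore a j)
      (by rw [ha2.nat nIn (hln _ (by decide)), hd'])
      (by rw [ha2.nat nRow (hln _ (by decide))]; exact hrow') (fun i hi => by
        rw [vec_congr (ha2.real rQ (hlr _ (by decide)))]
        exact hres i hi) h2.1) fun s3 ha3 h3 => ?_
    rw [← spanBefore_succ, vec_congr (ha2.real rX (hlr _ (by decide))),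
      ha2.nat nCnt (hln _ (by decide)), hcnt, h2.2] at h3
    refine ⟨h3.1, by omega, fun z hzj => ?_⟩
    have hzx := hz z fun i hi => hzj i (by omega)
    have := sub_smul_residual_mem (a j) hzx
    rw [← spanBefore_succ, inner_sub_right, hzj j (by omega)] at this
    rw [h3.2.1, ← sub_sub]
    exact this

/-! ### The sum of distances -/

/-- The array of hyperplanes in the memory `s` has `m` elements. -/
structure HypList (d m : ℕ) (s : State) : Prop where
  size : s.nat nM 0 = m
  row : ∀ h ≤ m, s.nat nHRow h = h * d

/-- The normal of the hyperplane number `h`. -/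
noncomputable def normal (d : ℕ) (s : State) (h : ℕ) : EuclideanSpace ℝ (Fin d) :=
  vec d s rHA (h * d)

/-- Computes the sum of the distances from `rY` to the hyperplanes. -/
def evalSum : Program :=
  .seq (.storeReal rD (.const 0) (.const 0)) <|
  forLoop nH (.var nM)
    (.seq (dotLoop rHA (.load nHRow (.var nH)) rY (.const 0) rG)
      (.storeReal rD (.const 0) (.add (.var rD)
        (.sqrt (.mul (.sub (.var rG) (.load rHB (.var nH)))
          (.sub (.var rG) (.load rHB (.var nH))))))))

theorem WP.evalSum {d m : ℕ} {s : State} (hd : s.nat nIn 1 = d) (hm : HypList d m s) :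
    WP evalSum s (m * (50 * d + 80) + 20) (fun s' =>
      s'.real rD 0 = distSum m (normal d s) (s.real rHB) (vec d s rY 0)) := by
  refine WP.le (T := 3 + (m * (2 + (50 * d + 30 + 30) + 10) + (2 + 10))) ?_ (by nlinarith)
  refine WP.seq (WP.storeReal (Q := fun s' => s'.real rD 0 = 0) ?_) fun s1 ha1 h1 => ?_
  · simp [State.setReal_real_same, NatExp.eval, RealExp.eval]
  have hM1 : (NatExp.var nM).eval s1 = m := by
    have := ha1.nat nM (by decide)
    simp [NatExp.eval, this, hm.size]
  refine WP.forLoop (B := 50 * d + 30 + 30)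
    (fun h s' => s'.real rD 0 = distSum h (normal d s) (s.real rHB) (vec d s rY 0))
    hM1 (by decide) (by decide) (fun _ _ _ h => h) (by simpa [distSum] using h1) ?_
  intro h s' hh ha hH hI
  have hd' : s'.nat nIn 1 = d := by rw [ha.nat nIn (by decide), ha1.nat nIn (by decide), hd]
  have hr : s'.nat nHRow h = h * d := by
    rw [ha.nat nHRow (by decide), ha1.nat nHRow (by decide), hm.row h hh.le]
  refine WP.seq (WP.dotLoop hd' (by decide) (by decide) (by decide) (by decide) (by decide))
    fun s2 ha2 h2 => WP.le (WP.storeReal ?_) (by simp [NatExp.cost, RealExp.cost])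
  simp only [NatExp.eval, hH, hr] at h2
  rw [vec_congr (ha.real rHA (by decide)), vec_congr (ha1.real rHA (by decide)),
    vec_congr (ha.real rY (by decide)), vec_congr (ha1.real rY (by decide))] at h2
  rw [State.setReal_real_same]
  simp only [NatExp.eval, RealExp.eval, if_true, h2, ha2.nat nH (by decide), hH,
    ha2.real rD (by decide), hI, ha2.real rHB (by decide), ha.real rHB (by decide),
    ha1.real rHB (by decide)]
  rw [Real.sqrt_mul_self_eq_abs, distSum, distSum, sum_range_succ]
  rfl

end RealRAM

/-! ### Collecting the hyperplanes -/

namespace RealRAM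

open Finset Module HDD

/-- The flag for a hyperplane that is already in the list. -/
abbrev nFound : ℕ := 16

/-- The coordinates of the points. -/
abbrev rPt : ℕ := 0

/-- The unit normal of the hyperplane spanned by the current tuple of points. -/
abbrev rU : ℕ := 18

/-- The memory `s` holds the points `pt 0, …, pt (n - 1)` of dimension `d`. -/
structure Env (d n : ℕ) (pt : ℕ → EuclideanSpace ℝ (Fin d)) (s : State) : Prop where
  card : s.nat nIn 0 = n
  dim : s.nat nIn 1 = d
  row : ∀ i < n + d, s.nat nRow i = i * d
  point : ∀ i < n, vec d s rPt (i * d) = pt i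

theorem Env.agree {d n : ℕ} {pt : ℕ → EuclideanSpace ℝ (Fin d)} {s s' : State} {p : Program}
    (h : Env d n pt s) (ha : Agree p s s') (h1 : nIn ∉ p.natWrites) (h2 : nRow ∉ p.natWrites)
    (h3 : rPt ∉ p.realWrites) : Env d n pt s' where
  card := by rw [ha.nat _ h1, h.card]
  dim := by rw [ha.nat _ h1, h.dim]
  row := by rw [ha.nat _ h2]; exact h.row
  point := fun i hi => by rw [vec_congr (ha.real _ h3), h.point i hi]

theorem HypList.agree {d m : ℕ} {s s' : State} {p : Program} (h : HypList d m s)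
    (ha : Agree p s s') (h1 : nM ∉ p.natWrites) (h2 : nHRow ∉ p.natWrites) : HypList d m s' where
  size := by rw [ha.nat _ h1, h.size]
  row := by rw [ha.nat _ h2]; exact h.row

/-- The tuple with the code `c`: the base-`n` digits of `c`. -/
def tup (n c : ℕ) : ℕ → ℕ := fun j => c / n ^ j % n

variable {d n : ℕ} {pt : ℕ → EuclideanSpace ℝ (Fin d)}

/-- The list of hyperplanes in the memory has no repetitions, all its elements are spanned by
affinely independent tuples with codes in `A`, and it contains all hyperplanes spanned by affinely
independent tuples with codes in `B`. -/
def Collected (n : ℕ) (pt : ℕ → EuclideanSpace ℝ (Fin d)) (A B : Set ℕ) (m : ℕ) (s : State) :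
    Prop :=
  HypList d m s ∧ ∃ hs : ℕ → AffineSubspace ℝ (EuclideanSpace ℝ (Fin d)),
    (∀ i < m, IsHyperplane (hs i) (normal d s i) (s.real rHB i)) ∧
    (∀ i < m, ∀ j < m, hs i = hs j → i = j) ∧
    (∀ i < m, ∃ c ∈ A, finrank ℝ (tupleDir pt (tup n c)) + 1 = d ∧
      hs i = tupleSpan pt (tup n c)) ∧
    ∀ c ∈ B, finrank ℝ (tupleDir pt (tup n c)) + 1 = d → ∃ i < m, hs i = tupleSpan pt (tup n c)

theorem Collected.agree {A B : Set ℕ} {m : ℕ} {s s' : State} {p : Program}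
    (h : Collected n pt A B m s) (ha : Agree p s s') (h1 : nM ∉ p.natWrites)
    (h2 : nHRow ∉ p.natWrites) (h3 : rHA ∉ p.realWrites) (h4 : rHB ∉ p.realWrites) :
    Collected n pt A B m s' := by
  obtain ⟨hl, hs, h5, h6⟩ := h
  refine ⟨hl.agree ha h1 h2, hs, fun i hi => ?_, h6⟩
  rw [normal, vec_congr (ha.real _ h3), ha.real _ h4]
  exact h5 i hi

theorem Collected.mono {A A' B B' : Set ℕ} {m : ℕ} {s : State} (h : Collected n pt A B m s)
    (hA : A ⊆ A') (hB : ∀ c ∈ B', finrank ℝ (tupleDir pt (tup n c)) + 1 = d → c ∈ B) :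
    Collected n pt A' B' m s := by
  obtain ⟨hl, hs, h5, h6, h7, h8⟩ := h
  refine ⟨hl, hs, h5, h6, fun i hi => ?_, fun c hc hr => h8 c (hB c hc hr) hr⟩
  obtain ⟨c, hc, hh⟩ := h7 i hi
  exact ⟨c, hA hc, hh⟩

theorem tup_lt (hn : 1 ≤ n) (c j : ℕ) : tup n c j < n := Nat.mod_lt _ hn

theorem Collected.card_le (hd : 1 ≤ d) (hn : 1 ≤ n) {P : Finset (EuclideanSpace ℝ (Fin d))}
    (hP : P = (range n).image pt) {A B : Set ℕ} {m : ℕ} {s : State}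
    (h : Collected n pt A B m s) : m ≤ #(hyperplanes P) := by
  obtain ⟨hl, hs, h5, h6, h7, h8⟩ := h
  have := card_le_card_of_injOn (s := range m) (t := hyperplanes P) hs (fun i hi => ?_)
    fun i hi j hj => h6 i (by simpa using hi) j (by simpa using hj)
  · simpa using this
  · obtain ⟨c, -, hr, hc⟩ := h7 i (by simpa using hi)
    exact (mem_hyperplanes hd hP).2 ⟨tup n c, fun j _ => tup_lt hn c j, hr, hc⟩

theorem Collected.enumerates (hd : 1 ≤ d) (hn : 1 ≤ n) {P : Finset (EuclideanSpace ℝ (Fin d))}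
    (hP : P = (range n).image pt) {A : Set ℕ} {m : ℕ} {s : State}
    (h : Collected n pt A (Set.Iio (n ^ d)) m s) :
    Enumerates P m (normal d s) (s.real rHB) := by
  obtain ⟨hl, hs, h5, h6, h7, h8⟩ := h
  refine ⟨hs, h5, h6, fun x => ?_⟩
  rw [mem_hyperplanes hd hP]
  constructor
  · rintro ⟨g, hg, hr, rfl⟩
    obtain ⟨c, hc, hcg⟩ := exists_digits n d g hg
    have hdir : tupleDir pt g = tupleDir pt (tup n c) :=
      spanBefore_congr fun j hj => by simp only [tup, hcg j hj, hcg 0 hd]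
    have hspan : tupleSpan pt g = tupleSpan pt (tup n c) := by
      rw [tupleSpan, tupleSpan,
        show (fun j => pt (g j)) '' Set.Iio d = (fun j => pt (tup n c j)) '' Set.Iio d from
          Set.image_congr fun j hj => by simp only [tup, hcg j hj]]
    rw [hspan]
    exact h8 c hc (hdir ▸ hr)
  · rintro ⟨i, hi, rfl⟩
    obtain ⟨c, -, hr, hc⟩ := h7 i hi
    exact ⟨tup n c, fun j _ => tup_lt hn c j, hr, hc⟩

/-- Searches the list for the hyperplane with the unit normal `rU` and the offset `rB`. In dimension
one, different tuples span different hyperplanes, and the search is omitted, because it would take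
quadratic time. -/
def findHyperplane : Program :=
  .seq (.storeNat nFound (.const 0) (.const 0)) <|
  .ite (.natLt (.const 1) dimE)
    (forLoop nH (.var nM)
      (.seq (dotLoop rU (.const 0) rHA (.load nHRow (.var nH)) rG)
        (.ite (.and (.realEq (.mul (.var rG) (.var rG)) (.const 1))
            (.realEq (.var rB) (.mul (.var rG) (.load rHB (.var nH)))))
          (.storeNat nFound (.const 0) (.const 1)) .skip)))
    .skip

/-- The coincidence test for the hyperplane number `h`: the unit normals and the offsets agree up to
a common sign. -/
def Coincides (d : ℕ) (s : State) (h : ℕ) : Prop :=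
  inner ℝ (vec d s rU 0) (normal d s h) * inner ℝ (vec d s rU 0) (normal d s h) = (1 : ℝ) ∧
    s.real rB 0 = inner ℝ (vec d s rU 0) (normal d s h) * s.real rHB h

theorem WP.findHyperplane {m : ℕ} {s : State} (hd : s.nat nIn 1 = d) (hd1 : 1 ≤ d)
    (hm : HypList d m s) :
    WP findHyperplane s ((d - 1) * (m * (50 * d + 80)) + 30) (fun s' =>
      (1 < d → (s'.nat nFound 0 = 0 ↔ ∀ h < m, ¬ Coincides d s h)) ∧
      (¬ 1 < d → s'.nat nFound 0 = 0)) := by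
  have hdd : d = 1 ∨ 1 < d := by omega
  refine WP.le (T := 3 + ((Test.natLt (.const 1) dimE).cost + 1 +
    ((d - 1) * (m * (2 + (50 * d + 30 + 30) + 10)) + (2 + 10)))) ?_ (by
      simp only [Test.cost, NatExp.cost]
      have : (d - 1) * (m * (2 + (50 * d + 30 + 30) + 10)) ≤ (d - 1) * (m * (50 * d + 80)) :=
        Nat.mul_le_mul_left _ (Nat.mul_le_mul_left _ (by omega))
      omega)
  refine WP.seq (WP.storeNat (Q := fun s' => s'.nat nFound 0 = 0) ?_) fun s1 ha1 h1 => ?_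
  · simp [State.setNat_nat_same, NatExp.eval]
  have hdim : dimE.eval s1 = d := by simp [NatExp.eval, ha1.nat nIn (by decide), hd]
  refine WP.ite (fun hb => ?_) fun hb => ?_
  · have hlt : 1 < d := by
      have : 1 < dimE.eval s1 := hb
      rwa [hdim] at this
    have hM1 : (NatExp.var nM).eval s1 = m := by
      have := ha1.nat nM (by decide)
      simp [NatExp.eval, this, hm.size]
    refine WP.le (WP.post (WP.forLoop (B := 50 * d + 30 + 30) (n := m)
      (fun h s' => s'.nat nFound 0 = 0 ↔ ∀ i < h, ¬ Coincides d s i)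
      hM1 (by decide) (by decide) (fun _ _ _ h => by rwa [State.setNat_nat_of_ne (by decide)])
      (by simpa using h1) ?_) fun s' _ h => ⟨fun _ => h, fun h => absurd hlt h⟩) ?_
    · intro h s' hh ha hH hI
      have hd' : s'.nat nIn 1 = d := by rw [ha.nat nIn (by decide), ha1.nat nIn (by decide), hd]
      have hr : s'.nat nHRow h = h * d := by
        rw [ha.nat nHRow (by decide), ha1.nat nHRow (by decide), hm.row h hh.le]
      refine WP.seq (WP.dotLoop hd' (by decide) (by decide) (by decide) (by decide) (by decide))
        fun s2 ha2 h2 => WP.le (T := 30) ?_ (by norm_num)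
      simp only [NatExp.eval, hH, hr] at h2
      rw [vec_congr (ha.real rHA (by decide)), vec_congr (ha1.real rHA (by decide)),
        vec_congr (ha.real rU (by decide)), vec_congr (ha1.real rU (by decide))] at h2
      have hH2 : s2.nat nH 0 = h := by rw [ha2.nat nH (by decide), hH]
      have hB2 : s2.real rB = s.real rB := by
        rw [ha2.real rB (by decide), ha.real rB (by decide), ha1.real rB (by decide)]
      have hHB2 : s2.real rHB = s.real rHB := by
        rw [ha2.real rHB (by decide), ha.real rHB (by decide), ha1.real rHB (by decide)]
      have hF2 : s2.nat nFound = s'.nat nFound := ha2.nat nFound (by decide)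
      have hiff : Test.Holds s2 (.and (.realEq (.mul (.var rG) (.var rG)) (.const 1))
            (.realEq (.var rB) (.mul (.var rG) (.load rHB (.var nH))))) ↔ Coincides d s h := by
        simp only [Test.Holds, RealExp.eval, NatExp.eval, h2, hH2, hB2, hHB2, Int.cast_one]
        rfl
      have hsucc : (∀ i < h + 1, ¬ Coincides d s i) ↔
          (∀ i < h, ¬ Coincides d s i) ∧ ¬ Coincides d s h := by
        constructor
        · exact fun H => ⟨fun i hi => H i (by omega), H h (by omega)⟩
        · rintro ⟨H, H'⟩ i hi
          rcases (Nat.lt_succ_iff.1 hi).lt_or_eq with hi | rfl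
          · exact H i hi
          · exact H'
      refine WP.le (WP.ite (T := 4) (fun hb => WP.le (WP.storeNat ?_) (by simp [NatExp.cost]))
        fun hb => WP.le (WP.skip ?_) (by norm_num)) (by simp [Test.cost, RealExp.cost, NatExp.cost])
      · rw [hsucc, State.setNat_nat_same]
        simp only [NatExp.eval, if_true]
        have := hiff.1 hb
        tauto
      · rw [hsucc, hF2, hI]
        have := mt hiff.2 hb
        tauto
    · have : 1 * (m * (2 + (50 * d + 30 + 30) + 10)) ≤
          (d - 1) * (m * (2 + (50 * d + 30 + 30) + 10)) :=
        Nat.mul_le_mul_right _ (by omega)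
      rw [one_mul] at this
      exact Nat.add_le_add_right this _
  · have hlt : ¬ 1 < d := by
      have : ¬ 1 < dimE.eval s1 := hb
      rwa [hdim] at this
    exact WP.le (WP.skip ⟨fun h => absurd h hlt, fun _ => h1⟩) (by omega)

/-- Appends the hyperplane with the unit normal `rU` and the offset `rB` to the list. -/
def appendHyperplane : Program :=
  .seq (scaleLoop rHA (.load nHRow (.var nM)) (.const 1) rU (.const 0)) <|
  .seq (.storeReal rHB (.var nM) (.var rB)) <|
  .seq (.storeNat nHRow (.add (.var nM) (.const 1)) (.add (.load nHRow (.var nM)) dimE)) <|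
  .storeNat nM (.const 0) (.add (.var nM) (.const 1))

theorem WP.appendHyperplane {m : ℕ} {s : State} (hd : s.nat nIn 1 = d) (hm : HypList d m s) :
    WP appendHyperplane s (70 * d + 70) (fun s' => HypList d (m + 1) s' ∧
      (∀ h < m, normal d s' h = normal d s h ∧ s'.real rHB h = s.real rHB h) ∧
      normal d s' m = vec d s rU 0 ∧ s'.real rHB m = s.real rB 0) := by
  refine WP.le (T := (70 * d + 30) + (10 + (15 + 10))) ?_ (by omega)
  have hrm : s.nat nHRow m = m * d := hm.row m le_rfl
  refine WP.seq (WP.scaleLoop hd (by decide) (by decide) (by decide) (by decide) (by decide)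
    (by decide)) fun s1 ha1 h1 => ?_
  simp only [NatExp.eval, RealExp.eval, hm.size, hrm, Int.cast_one, one_smul] at h1
  have hM1 : s1.nat nM 0 = m := by rw [ha1.nat nM (by decide), hm.size]
  refine WP.seq (WP.le (WP.storeReal (Q := fun s' => s' = s1.setReal rHB m (s.real rB 0)) ?_)
    (by simp [NatExp.cost, RealExp.cost])) fun s2 _ h2 => ?_
  · simp [NatExp.eval, RealExp.eval, hM1, ha1.real rB (by decide)]
  refine WP.seq (WP.le (WP.storeNat (Q := fun s' => s' = s2.setNat nHRow (m + 1) (m * d + d)) ?_)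
    (by simp [NatExp.cost])) fun s3 _ h3 => ?_
  · subst h2
    simp [NatExp.eval, hM1, ha1.nat nHRow (by decide), ha1.nat nIn (by decide), hrm, hd]
  refine WP.le (WP.storeNat ?_) (by simp [NatExp.cost])
  subst h3 h2
  simp only [NatExp.eval, State.setNat_nat_of_ne (show nM ≠ nHRow by decide), State.setReal_nat, hM1]
  refine ⟨⟨by simp [State.setNat_nat_same], fun h hh => ?_⟩, fun h hh => ⟨?_, ?_⟩, ?_, ?_⟩
  · rw [State.setNat_nat_of_ne (by decide), State.setNat_nat_same]
    split_ifs with hhm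
    · rw [hhm, Nat.succ_mul]
    · rw [State.setReal_nat, ha1.nat nHRow (by decide)]
      exact hm.row h (by omega)
  · refine vec_eq_of_forall fun j hj => ?_
    simp only [State.setNat_real, State.setReal_real_of_ne (show rHA ≠ rHB by decide)]
    exact h1.2 _ (Or.inl (row_lt hh hj))
  · simp only [State.setNat_real, State.setReal_real_same]
    rw [if_neg (by omega), ha1.real rHB (by decide)]
  · rw [← h1.1]
    refine vec_eq_of_forall fun j hj => ?_
    simp only [State.setNat_real, State.setReal_real_of_ne (show rHA ≠ rHB by decide)]
  · simp only [State.setNat_real, State.setReal_real_same, if_true]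

/-- Adds the hyperplane spanned by the current tuple to the list, if the residual of the standard
basis vector number `nK` is a normal and the hyperplane is new. -/
def addHyperplane : Program :=
  .seq (dotLoop rQ (.load nRow (.var nK)) rQ (.load nRow (.var nK)) rC) <|
  .ite (.realEq (.var rC) (.const 0)) .skip <|
  .seq (scaleLoop rU (.const 0) (.div (.const 1) (.sqrt (.var rC))) rQ (.load nRow (.var nK))) <|
  .seq (dotLoop rU (.const 0) rPt (.load nRow (.load nIdx (.const 0))) rB) <|
  .seq findHyperplane <|
  .ite (.natEq (.var nFound) (.const 0)) appendHyperplane .skip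

/-- In dimension one, tuples with different codes span different hyperplanes. -/
theorem tupleSpan_ne_of_dim_one (hd : d = 1) (hn : 1 ≤ n) (hpt : Set.InjOn pt (Set.Iio n))
    {c c' : ℕ} (hc : c < n ^ d) (hlt : c' < c) : tupleSpan pt (tup n c') ≠ tupleSpan pt (tup n c) := by
  intro h
  have hmem := mem_tupleSpan (by omega) pt (tup n c)
  have himg : (fun j => pt (tup n c' j)) '' Set.Iio d = {pt (tup n c' 0)} := by
    ext x
    simp only [Set.mem_image, Set.mem_Iio, Set.mem_singleton_iff]
    constructor
    · rintro ⟨j, hj, rfl⟩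
      rw [show j = 0 by omega]
    · rintro rfl
      exact ⟨0, by omega, rfl⟩
  rw [← h, tupleSpan, himg, AffineSubspace.mem_affineSpan_singleton] at hmem
  have := hpt (tup_lt hn c 0) (tup_lt hn c' 0) hmem
  rw [hd, pow_one] at hc
  simp only [tup, pow_zero, Nat.div_one] at this
  rw [Nat.mod_eq_of_lt hc, Nat.mod_eq_of_lt (hlt.trans hc)] at this
  omega

theorem WP.addHyperplane {s : State} (hd1 : 1 ≤ d) (hn : 1 ≤ n) (hpt : Set.InjOn pt (Set.Iio n))
    (henv : Env d n pt s) {A B : Set ℕ} {M : ℕ}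
    (hM : ∀ m, Collected n pt A B m s → m ≤ M)
    (hcol : ∃ m, Collected n pt A B m s) {c k : ℕ} (hc : c < n ^ d) (hk : k < d)
    (hk' : s.nat nK 0 = k) (hidx : s.nat nIdx 0 = tup n c 0)
    (hrank : finrank ℝ (tupleDir pt (tup n c)) + 1 = d)
    (hres : Residuals d s (tupleDir pt (tup n c))) (hA : ¬ 1 < d → ∀ c' ∈ A, c' < c) :
    WP addHyperplane s ((d - 1) * (M * (50 * d + 80)) + (240 * d + 300)) (fun s' =>
      ∃ m, Collected n pt (insert c A)
        (B ∪ {c' | c' = c ∧ residual (tupleDir pt (tup n c)) (unitVec d k) ≠ 0}) m s') := by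
  obtain ⟨m, hcol⟩ := hcol
  have hmM : m ≤ M := hM m hcol
  set S := tupleDir pt (tup n c) with hS
  set v := residual S (unitVec d k) with hv
  refine WP.le (T := (50 * d + 30) + ((4 + 1) + ((70 * d + 30) + ((50 * d + 30) +
    (((d - 1) * (M * (50 * d + 80)) + 30) + ((4 + 1) + (70 * d + 70))))))) ?_ (by omega)
  refine WP.seq (WP.dotLoop henv.dim (by decide) (by decide) (by decide) (by decide) (by decide))
    fun s1 ha1 h1 => ?_
  simp only [NatExp.eval, hk', henv.row k (by omega), hres k hk, ← hv] at h1
  have henv1 := henv.agree ha1 (by decide) (by decide) (by decide)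
  have hcol1 := hcol.agree ha1 (by decide) (by decide) (by decide) (by decide)
  refine WP.ite (fun hb => WP.le (WP.skip ⟨m, hcol1.mono (Set.subset_insert _ _) ?_⟩) (by omega))
    fun hb => ?_
  · have hb' : s1.real rC 0 = ((0 : ℤ) : ℝ) := hb
    rw [h1, Int.cast_zero, inner_self_eq_zero] at hb'
    rintro c' (hc' | ⟨-, h⟩) -
    · exact hc'
    · exact absurd hb' h
  have hv0 : v ≠ 0 := by
    have hb' : ¬ s1.real rC 0 = ((0 : ℤ) : ℝ) := hb
    rwa [h1, Int.cast_zero, inner_self_eq_zero] at hb'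
  refine WP.seq (WP.scaleLoop henv1.dim (by decide) (by decide) (by decide) (by decide) (by decide)
    (by decide)) fun s2 ha2 h2 => ?_
  have hnorm : Real.sqrt (inner ℝ v v) = ‖v‖ := by
    rw [real_inner_self_eq_norm_sq, Real.sqrt_sq (norm_nonneg _)]
  simp only [NatExp.eval, RealExp.eval, ha1.nat nK (by decide), hk', ha1.nat nRow (by decide),
    henv.row k (by omega), vec_congr (ha1.real rQ (by decide)), hres k hk, ← hv, h1, hnorm,
    Int.cast_one] at h2
  have henv2 := henv1.agree ha2 (by decide) (by decide) (by decide)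
  have hcol2 := hcol1.agree ha2 (by decide) (by decide) (by decide) (by decide)
  set u := (1 / ‖v‖) • v with hu
  have hu1 : ‖u‖ = 1 := by
    rw [hu, norm_smul, Real.norm_eq_abs, abs_of_nonneg (by positivity), one_div,
      inv_mul_cancel₀ (norm_ne_zero_iff.2 hv0)]
  have huS : u ∈ Sᗮ := Submodule.smul_mem _ _ (residual_mem _ _)
  have hhyp := isHyperplane_tupleSpan hd1 hrank huS hu1
  refine WP.seq (WP.dotLoop henv2.dim (by decide) (by decide) (by decide) (by decide) (by decide))
    fun s3 ha3 h3 => ?_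
  have hidx2 : s2.nat nIdx 0 = tup n c 0 := by
    rw [ha2.nat nIdx (by decide), ha1.nat nIdx (by decide), hidx]
  have hlt0 := tup_lt hn c 0
  simp only [NatExp.eval, h2.1, hidx2, henv2.row _ (show tup n c 0 < n + d by omega),
    henv2.point _ hlt0] at h3
  have henv3 := henv2.agree ha3 (by decide) (by decide) (by decide)
  have hcol3 := hcol2.agree ha3 (by decide) (by decide) (by decide) (by decide)
  have hU3 : vec d s3 rU 0 = u := by rw [vec_congr (ha3.real rU (by decide)), h2.1]
  refine WP.seq (WP.le (WP.findHyperplane henv3.dim hd1 hcol3.1) (by gcongr)) fun s4 ha4 h4 => ?_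
  have henv4 := henv3.agree ha4 (by decide) (by decide) (by decide)
  have hcol4 := hcol3.agree ha4 (by decide) (by decide) (by decide) (by decide)
  obtain ⟨hl3, hs, h5, h6, h7, h8⟩ := hcol3
  have hiff : ∀ i < m, Coincides d s3 i ↔ tupleSpan pt (tup n c) = hs i := by
    intro i hi
    rw [hhyp.eq_iff (h5 i hi), Coincides, hU3, h3]
  have hB4 : s4.real rB 0 = inner ℝ u (pt (tup n c 0)) := by
    rw [ha4.real rB (by decide), h3]
  have hU4 : vec d s4 rU 0 = u := by rw [vec_congr (ha4.real rU (by decide)), hU3]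
  have h54 : ∀ i < m, IsHyperplane (hs i) (normal d s4 i) (s4.real rHB i) := by
    intro i hi
    rw [normal, vec_congr (ha4.real rHA (by decide)), ha4.real rHB (by decide)]
    exact h5 i hi
  refine WP.ite (fun hb => ?_) fun hb => WP.le (WP.skip ⟨m, hcol4.1, hs, h54, h6, fun i hi => ?_,
    fun c' hc' hr => ?_⟩) (by omega)
  · have hb' : s4.nat nFound 0 = 0 := hb
    -- in dimension one, where the search is omitted, the hyperplane is new because the code is
    have hnew : ∀ i < m, hs i ≠ tupleSpan pt (tup n c) := by
      intro i hi heq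
      by_cases hd2 : 1 < d
      · exact (h4.1 hd2).1 hb' i hi ((hiff i hi).2 heq.symm)
      · obtain ⟨c', hc', -, hc''⟩ := h7 i hi
        exact tupleSpan_ne_of_dim_one (by omega) hn hpt hc (hA hd2 c' hc') (hc''.symm.trans heq)
    refine WP.post (WP.appendHyperplane henv4.dim hcol4.1) fun s5 _ h9 => ?_
    obtain ⟨hl5, hold, hnm, hbm⟩ := h9
    refine ⟨m + 1, hl5, fun i => if i < m then hs i else tupleSpan pt (tup n c), fun i hi => ?_,
      fun i hi j hj => ?_, fun i hi => ?_, fun c' hc' hr => ?_⟩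
    · rcases (Nat.lt_succ_iff.1 hi).lt_or_eq with hi | rfl
      · beta_reduce
        rw [if_pos hi, (hold i hi).1, (hold i hi).2]
        exact h54 i hi
      · beta_reduce
        rw [if_neg (by omega), hnm, hbm, hU4, hB4]
        exact hhyp
    · rcases (Nat.lt_succ_iff.1 hi).lt_or_eq with hi | rfl <;>
        rcases (Nat.lt_succ_iff.1 hj).lt_or_eq with hj | rfl
      · beta_reduce
        rw [if_pos hi, if_pos hj]
        exact h6 i hi j hj
      · beta_reduce
        rw [if_pos hi, if_neg (by omega)]
        exact fun h => absurd h (hnew i hi)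
      · beta_reduce
        rw [if_neg (by omega), if_pos hj]
        exact fun h => absurd h.symm (hnew j hj)
      · exact fun _ => rfl
    · rcases (Nat.lt_succ_iff.1 hi).lt_or_eq with hi | rfl
      · beta_reduce
        rw [if_pos hi]
        obtain ⟨c', hc', h⟩ := h7 i hi
        exact ⟨c', Set.mem_insert_of_mem _ hc', h⟩
      · beta_reduce
        rw [if_neg (by omega)]
        exact ⟨c, Set.mem_insert _ _, hrank, rfl⟩
    · rcases hc' with hc' | ⟨rfl, -⟩
      · obtain ⟨i, hi, h⟩ := h8 c' hc' hr
        exact ⟨i, by omega, by beta_reduce; rw [if_pos hi, h]⟩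
      · exact ⟨m, by omega, by beta_reduce; rw [if_neg (by omega)]⟩
  · obtain ⟨c', hc', h⟩ := h7 i hi
    exact ⟨c', Set.mem_insert_of_mem _ hc', h⟩
  · have hb' : ¬ s4.nat nFound 0 = 0 := hb
    rcases hc' with hc' | ⟨rfl, -⟩
    · exact h8 c' hc' hr
    · by_cases hd2 : 1 < d
      · have := mt (h4.1 hd2).2 hb'
        push Not at this
        obtain ⟨i, hi, h⟩ := this
        exact ⟨i, hi, ((hiff i hi).1 h).symm⟩
      · exact absurd (h4.2 hd2) hb'

/-- Loads the difference between a point of the current tuple and its first point. -/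
def loadDifference : Program :=
  .seq (axpyLoop rA (.const 0) rPt (.load nRow (.load nIdx (.var nJ))) (.const (-1))
    rPt (.load nRow (.load nIdx (.const 0))))
    (.storeReal rB (.const 0) (.const 0))

/-- Processes a tuple of points: if it spans a hyperplane, the nonzero residuals of the standard
basis vectors are normals of it. -/
def processPoints : Program :=
  .seq (projectAll dimE loadDifference) <|
  .ite (.natEq (.add (.var nCnt) (.const 1)) dimE) (forLoop nK dimE addHyperplane) .skip

theorem WP.processPoints {s : State} (hd1 : 1 ≤ d) (hn : 1 ≤ n) (hpt : Set.InjOn pt (Set.Iio n))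
    (henv : Env d n pt s) {M c : ℕ} (hM : ∀ A B m s', Collected n pt A B m s' → m ≤ M)
    (hcol : ∃ m, Collected n pt (Set.Iio c) (Set.Iio c) m s) (hc : c < n ^ d)
    (hidx : ∀ j < d, s.nat nIdx j = c / n ^ j % n) :
    WP processPoints s (d * ((d - 1) * (M * (50 * d + 80))) + d * (d * (120 * d + 1000) + 1000) + 200)
      (fun s' => ∃ m, Collected n pt (Set.Iio (c + 1)) (Set.Iio (c + 1)) m s') := by
  set S := tupleDir pt (tup n c) with hS
  have hE : ∀ {s'}, Env d n pt s' → dimE.eval s' = d := fun h => h.dim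
  refine WP.le (T := (d * (70 * d + 70) + d * ((70 * d + 40) + d * (120 * d + 300) + 220) + 50) +
    (7 + 1 + (d * (2 + ((d - 1) * (M * (50 * d + 80)) + (240 * d + 300)) + 10) + (2 + 10)))) ?_
    (by
      generalize (d - 1) * (M * (50 * d + 80)) = X
      nlinarith [Nat.zero_le (d * X)])
  refine WP.seq (WP.projectAll (hE henv) henv.dim (fun i hi => henv.row i (by omega)) rfl
    (by decide) (by decide) (by decide) (a := fun j => pt (tup n c j) - pt (tup n c 0))
    (b := fun _ => 0) ?_) fun s1 ha1 h1 => ?_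
  · intro j s' hj ha hJ
    have henv' := henv.agree ha (by decide) (by decide) (by decide)
    have hidx' : ∀ i < d, s'.nat nIdx i = tup n c i := by
      rw [ha.nat nIdx (by decide)]; exact hidx
    refine WP.le (WP.seq (WP.axpyLoop henv'.dim (by decide) (by decide) (by decide) (by decide)
      (by decide) (Or.inl (by decide)) (by decide) (by decide)) fun s2 ha2 h2 =>
      WP.storeReal ⟨?_, ?_⟩) (T := 70 * d + 30 + 3) (by omega)
    · have hltj := tup_lt hn c j
      have hlt0 := tup_lt hn c 0
      simp only [NatExp.eval, RealExp.eval, hJ, hidx' j hj, hidx' 0 (by omega),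
        henv'.row _ (show tup n c j < n + d by omega), henv'.point _ hltj,
        henv'.row _ (show tup n c 0 < n + d by omega), henv'.point _ hlt0] at h2
      rw [show vec d (s2.setReal rB ((NatExp.const 0).eval s2) ((RealExp.const 0).eval s2)) rA 0 =
        vec d s2 rA 0 from vec_congr (State.setReal_real_of_ne (by decide)), h2.1]
      simp [sub_eq_add_neg]
    · simp [State.setReal_real_same, NatExp.eval, RealExp.eval]
  · have henv1 := henv.agree ha1 (by decide) (by decide) (by decide)
    obtain ⟨hres, hcnt, -⟩ := h1
    have hSS : spanBefore (fun j => pt (tup n c j) - pt (tup n c 0)) d = S := rfl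
    rw [hSS] at hres hcnt
    obtain ⟨m, hcol⟩ := hcol
    have hcol1 := hcol.agree ha1 (by decide) (by decide) (by decide) (by decide)
    have htest : Test.Holds s1 (.natEq (.add (.var nCnt) (.const 1)) dimE) ↔
        finrank ℝ S + 1 = d := by
      simp only [Test.Holds, NatExp.eval, hcnt, henv1.dim]
    have hsucc : ∀ c', c' < c + 1 ↔ c' < c ∨ c' = c := fun c' => by omega
    refine WP.ite (fun hb => ?_) fun hb => WP.le (WP.skip ⟨m, hcol1.mono ?_ ?_⟩) (by omega)
    · have hrank := htest.1 hb
      -- after `k` directions, the hyperplane of the tuple is in the list if one of these directions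
      -- has a nonzero residual
      refine WP.post (WP.forLoop (n := d) (B := (d - 1) * (M * (50 * d + 80)) + (240 * d + 300))
        (fun k s' => ∃ m, Collected n pt {c' | c' < c ∨ c' = c ∧ 0 < k}
          {c' | c' < c ∨ c' = c ∧ ∃ k' < k, residual S (unitVec d k') ≠ 0} m s')
        (hE henv1) (by decide) (by decide) ?_ ?_ ?_) ?_
      · rintro k s' v ⟨m, hl, h⟩
        refine ⟨m, ⟨?_, ?_⟩, h⟩
        · rw [State.setNat_nat_of_ne (by decide)]; exact hl.size
        · rw [State.setNat_nat_of_ne (by decide)]; exact hl.row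
      · refine ⟨m, hcol1.mono (fun c' h => Or.inl h) ?_⟩
        rintro c' (h | ⟨-, k', hk', -⟩) -
        · exact h
        · omega
      · intro k s' hk ha hK hI
        have henv' := henv1.agree ha (by decide) (by decide) (by decide)
        refine WP.post (WP.addHyperplane hd1 hn hpt henv' (fun m h => hM _ _ m _ h) hI hc hk hK
          (by rw [ha.nat nIdx (by decide), ha1.nat nIdx (by decide)]; exact hidx 0 (by omega))
          hrank (fun i hi => by
            rw [vec_congr (ha.real rQ (by decide))]; exact hres i hi) ?_) ?_
        · rintro hd2 c' (h | ⟨-, h⟩)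
          · exact h
          · omega
        · rintro s2 - ⟨m2, h2⟩
          refine ⟨m2, h2.mono ?_ ?_⟩
          · rintro c' (rfl | h | ⟨h, -⟩)
            · exact Or.inr ⟨rfl, by omega⟩
            · exact Or.inl h
            · exact Or.inr ⟨h, by omega⟩
          · rintro c' (h | ⟨rfl, k', hk', h⟩) -
            · exact Or.inl (Or.inl h)
            · rcases (Nat.lt_succ_iff.1 hk').lt_or_eq with hk' | rfl
              · exact Or.inl (Or.inr ⟨rfl, k', hk', h⟩)
              · exact Or.inr ⟨rfl, h⟩
      · rintro s' - ⟨m', h⟩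
        obtain ⟨k', hk', hk0⟩ := exists_residual_ne_zero (S := S) (by
          intro htop
          rw [htop, finrank_top, finrank_euclideanSpace_fin] at hrank
          omega)
        refine ⟨m', h.mono ?_ ?_⟩
        · rintro c' (h | ⟨rfl, -⟩)
          · exact Nat.lt_succ_of_lt h
          · exact Nat.lt_succ_self _
        · intro c' hc' _
          exact ((hsucc c').1 hc').imp id fun h => ⟨h, k', hk', hk0⟩
    · exact fun c' h => Nat.lt_succ_of_lt h
    · intro c' hc' hr
      rcases (hsucc c').1 hc' with h | rfl
      · exact h
      · exact absurd (htest.2 hr) hb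

/-- Computes the list of all hyperplanes, from all `d`-tuples of points. -/
def collectHyperplanes : Program := forTuples dimE (.load nIn (.const 0)) processPoints

theorem WP.collectHyperplanes {s : State} (hd1 : 1 ≤ d) (hn : 1 ≤ n)
    (hpt : Set.InjOn pt (Set.Iio n)) (henv : Env d n pt s) {M : ℕ}
    (hM : ∀ A B m s', Collected n pt A B m s' → m ≤ M) (hl : HypList d 0 s) :
    WP collectHyperplanes s (n ^ d * (d * ((d - 1) * (M * (50 * d + 80))) +
        d * (d * (120 * d + 1000) + 1050) + 270) + d * 50 + 70)
      (fun s' => ∃ m, Collected n pt (Set.Iio (n ^ d)) (Set.Iio (n ^ d)) m s') := by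
  have hE : dimE.eval s = d := henv.dim
  have hN : (NatExp.load nIn (.const 0)).eval s = n := henv.card
  refine WP.le (WP.post (WP.forTuples
    (B := d * ((d - 1) * (M * (50 * d + 80))) + d * (d * (120 * d + 1000) + 1000) + 200)
    (fun c s' => ∃ m, Collected n pt (Set.Iio c) (Set.Iio c) m s') (by decide) (by decide)
    (by decide) (by decide) (by rw [hN]; exact hn) ?_ ?_ ?_) (Q' := _) ?_) ?_
  · rintro c s' s'' ⟨m, hcol, h⟩ hr hna
    refine ⟨m, ⟨?_, ?_⟩, ?_⟩
    · rw [hna _ (by decide)]; exact hcol.size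
    · rw [hna _ (by decide)]; exact hcol.row
    · simpa only [normal, vec_congr (congrFun hr rHA), hr] using h
  · exact ⟨0, hl, fun _ => ⊤, by simp, by simp, by simp, by simp⟩
  · intro c s' hc ha hdig hI
    rw [hE, hN] at hc hdig
    exact WP.processPoints hd1 hn hpt (henv.agree ha (by decide) (by decide) (by decide)) hM hI hc hdig
  · rintro s' - ⟨m, h⟩
    rw [hE, hN] at h
    exact ⟨m, h⟩
  · rw [hE, hN]
    generalize d * ((d - 1) * (M * (50 * d + 80))) = X
    have : d * (d * (120 * d + 1000) + 1050) = d * (d * (120 * d + 1000) + 1000) + d * 50 := by ring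
    rw [this]
    have : X + d * (d * (120 * d + 1000) + 1000) + 200 + d * 50 + 70 =
      X + (d * (d * (120 * d + 1000) + 1000) + d * 50) + 270 := by ring
    rw [this]

end RealRAM

/-! ### The line searches -/

namespace RealRAM

open Finset Module HDD

/-- The output point. -/
abbrev rOut : ℕ := 1

/-- The sum of the distances from the output point. -/
abbrev rBest : ℕ := 19

variable {d m : ℕ} {a : ℕ → EuclideanSpace ℝ (Fin d)} {b : ℕ → ℝ}

/-- The list of hyperplanes in the memory `s` has the normals `a` and the offsets `b`. -/
structure Listed (d m : ℕ) (a : ℕ → EuclideanSpace ℝ (Fin d)) (b : ℕ → ℝ) (s : State) : Prop where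
  list : HypList d m s
  normal : normal d s = a
  offset : s.real rHB = b
  dim : s.nat nIn 1 = d
  row : ∀ i < d, s.nat nRow i = i * d

theorem Listed.agree {s s' : State} {p : Program} (h : Listed d m a b s) (ha : Agree p s s')
    (h1 : nM ∉ p.natWrites) (h2 : nHRow ∉ p.natWrites) (h3 : nIn ∉ p.natWrites)
    (h4 : nRow ∉ p.natWrites) (h5 : rHA ∉ p.realWrites) (h6 : rHB ∉ p.realWrites) :
    Listed d m a b s' where
  list := h.list.agree ha h1 h2
  normal := by
    rw [← h.normal]
    exact funext fun i => vec_congr (ha.real _ h5)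
  offset := by rw [ha.real _ h6, h.offset]
  dim := by rw [ha.nat _ h3, h.dim]
  row := by rw [ha.nat _ h4]; exact h.row

theorem Listed.vec_eq {s : State} (h : Listed d m a b s) (i : ℕ) : vec d s rHA (i * d) = a i := by
  rw [← h.normal]; rfl

/-- Prepares the search on the line through `rX` in the direction of the row `nK` of `rQ`: the keys
are the parameters of the intersections with the hyperplanes, the weights are the rates of change of
the distances. -/
def computeKeys : Program :=
  .seq (.storeReal rW (.const 0) (.const 0)) <|
  .seq (.storeReal rAcc (.const 0) (.const 0)) <|
  forLoop nH (.var nM) <|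
  .seq (dotLoop rHA (.load nHRow (.var nH)) rQ (.load nRow (.var nK)) rC) <|
  .seq (dotLoop rHA (.load nHRow (.var nH)) rX (.const 0) rG) <|
  .seq (.storeReal rWt (.var nH) (.sqrt (.mul (.var rC) (.var rC)))) <|
  .seq (.storeReal rKey (.var nH) (.div (.sub (.load rHB (.var nH)) (.var rG)) (.var rC))) <|
  .seq (.storeReal rW (.const 0) (.add (.var rW) (.load rWt (.var nH)))) <|
  .storeNat nTree (.add (.var nM) (.var nH)) (.var nH)

/-- The first `i` keys, weights and leaves of the tournament tree have been stored. -/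
def KeysUpTo (m : ℕ) (a : ℕ → EuclideanSpace ℝ (Fin d)) (b : ℕ → ℝ)
    (x v : EuclideanSpace ℝ (Fin d)) (i : ℕ) (s : State) : Prop :=
  (∀ h < i, s.real rWt h = |inner ℝ (a h) v|) ∧
  (∀ h < i, s.real rKey h = (b h - inner ℝ (a h) x) / inner ℝ (a h) v) ∧
  s.real rW 0 = ∑ h ∈ range i, |inner ℝ (a h) v| ∧
  (∀ h < i, s.nat nTree (m + h) = h)

theorem WP.computeKeys {s : State} {k : ℕ} (hl : Listed d m a b s) (hk : k < d)
    (hK : s.nat nK 0 = k) :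
    WP computeKeys s (m * (100 * d + 200) + 30) (fun s' =>
      KeysUpTo m a b (vec d s rX 0) (vec d s rQ (k * d)) m s' ∧ s'.real rAcc 0 = 0) := by
  refine WP.le (T := 3 + (3 + (m * (2 + ((50 * d + 30) + ((50 * d + 30) + (15 + (15 + (15 + 15)))))
    + 10) + (2 + 10)))) ?_ (by nlinarith)
  refine WP.seq (WP.storeReal (Q := fun s' => s'.real rW 0 = 0) ?_) fun s1 ha1 h1 => ?_
  · simp [State.setReal_real_same, NatExp.eval, RealExp.eval]
  refine WP.seq (WP.storeReal (Q := fun s' => s'.real rAcc 0 = 0) ?_) fun s2 ha2 h2 => ?_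
  · simp [State.setReal_real_same, NatExp.eval, RealExp.eval]
  have hl2 := (hl.agree ha1 (by decide) (by decide) (by decide) (by decide) (by decide)
    (by decide)).agree ha2 (by decide) (by decide) (by decide) (by decide) (by decide) (by decide)
  have hM2 : (NatExp.var nM).eval s2 = m := hl2.list.size
  set x := vec d s rX 0 with hx
  set v := vec d s rQ (k * d) with hv
  have hx2 : vec d s2 rX 0 = x := by
    rw [vec_congr (ha2.real rX (by decide)), vec_congr (ha1.real rX (by decide))]
  have hv2 : vec d s2 rQ (k * d) = v := by
    rw [vec_congr (ha2.real rQ (by decide)), vec_congr (ha1.real rQ (by decide))]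
  refine WP.forLoop (B := (50 * d + 30) + ((50 * d + 30) + (15 + (15 + (15 + 15)))))
    (fun i s' => KeysUpTo m a b x v i s' ∧ s'.real rAcc 0 = 0) hM2 (by decide) (by decide)
    ?_ ?_ ?_
  · rintro i s' w ⟨⟨h3, h4, h5, h6⟩, h7⟩
    exact ⟨⟨h3, h4, h5, by rwa [State.setNat_nat_of_ne (by decide)]⟩, h7⟩
  · refine ⟨⟨by simp, by simp, ?_, by simp⟩, h2⟩
    rw [ha2.real rW (by decide), h1, range_zero, sum_empty]
  · rintro i s' hi ha hH ⟨⟨h3, h4, h5, h6⟩, h7⟩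
    have hl' := hl2.agree ha (by decide) (by decide) (by decide) (by decide) (by decide) (by decide)
    have hK' : s'.nat nK 0 = k := by
      rw [ha.nat nK (by decide), ha2.nat nK (by decide), ha1.nat nK (by decide), hK]
    refine WP.seq (WP.dotLoop hl'.dim (by decide) (by decide) (by decide) (by decide) (by decide))
      fun s3 ha3 hC => ?_
    simp only [NatExp.eval, hH, hK', hl'.list.row i hi.le, hl'.row k hk, hl'.vec_eq,
      vec_congr (ha.real rQ (by decide)), hv2] at hC
    have hl3 := hl'.agree ha3 (by decide) (by decide) (by decide) (by decide) (by decide)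
      (by decide)
    have hH3 : s3.nat nH 0 = i := by rw [ha3.nat nH (by decide), hH]
    refine WP.seq (WP.dotLoop hl3.dim (by decide) (by decide) (by decide) (by decide) (by decide))
      fun s4 ha4 hG => ?_
    simp only [NatExp.eval, hH3, hl3.list.row i hi.le, hl3.vec_eq,
      vec_congr (ha3.real rX (by decide)), vec_congr (ha.real rX (by decide)), hx2] at hG
    have hl4 := hl3.agree ha4 (by decide) (by decide) (by decide) (by decide) (by decide)
      (by decide)
    have hH4 : s4.nat nH 0 = i := by rw [ha4.nat nH (by decide), hH3]
    have hC4 : s4.real rC 0 = inner ℝ (a i) v := by rw [ha4.real rC (by decide), hC]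
    have hWt4 : s4.real rWt = s'.real rWt := by
      rw [ha4.real rWt (by decide), ha3.real rWt (by decide)]
    have hKey4 : s4.real rKey = s'.real rKey := by
      rw [ha4.real rKey (by decide), ha3.real rKey (by decide)]
    have hW4 : s4.real rW 0 = s'.real rW 0 := by
      rw [ha4.real rW (by decide), ha3.real rW (by decide)]
    have hA4 : s4.real rAcc 0 = 0 := by
      rw [ha4.real rAcc (by decide), ha3.real rAcc (by decide), h7]
    have hT4 : s4.nat nTree = s'.nat nTree := by
      rw [ha4.nat nTree (by decide), ha3.nat nTree (by decide)]
    refine WP.seq (WP.le (WP.storeReal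
      (Q := fun s' => s' = s4.setReal rWt i |inner ℝ (a i) v|) ?_)
      (by simp [NatExp.cost, RealExp.cost])) fun s5 _ e5 => ?_
    · simp [NatExp.eval, RealExp.eval, hH4, hC4, Real.sqrt_mul_self_eq_abs]
    refine WP.seq (WP.le (WP.storeReal (Q := fun s' => s' = s5.setReal rKey i
      ((b i - inner ℝ (a i) x) / inner ℝ (a i) v)) ?_)
      (by simp [NatExp.cost, RealExp.cost])) fun s6 _ e6 => ?_
    · subst e5
      simp [NatExp.eval, RealExp.eval, hH4, hC4, hG, hl4.offset,
        State.setReal_real_of_ne (show rHB ≠ rWt by decide),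
        State.setReal_real_of_ne (show rG ≠ rWt by decide),
        State.setReal_real_of_ne (show rC ≠ rWt by decide)]
    refine WP.seq (WP.le (WP.storeReal (Q := fun s' => s' = s6.setReal rW 0
      (∑ h ∈ range (i + 1), |inner ℝ (a h) v|)) ?_)
      (by simp [NatExp.cost, RealExp.cost])) fun s7 _ e7 => ?_
    · subst e6 e5
      simp [NatExp.eval, RealExp.eval, hH4, hW4, h5, sum_range_succ, State.setReal_real_same,
        State.setReal_real_of_ne (show rW ≠ rWt by decide),
        State.setReal_real_of_ne (show rW ≠ rKey by decide),
        State.setReal_real_of_ne (show rWt ≠ rKey by decide)]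
    refine WP.le (WP.storeNat ?_) (by simp [NatExp.cost])
    subst e7 e6 e5
    simp only [NatExp.eval, State.setReal_nat, hl4.list.size, hH4]
    refine ⟨⟨fun h hh => ?_, fun h hh => ?_, ?_, fun h hh => ?_⟩, ?_⟩
    · simp only [State.setNat_real, State.setReal_real_of_ne (show rWt ≠ rW by decide),
        State.setReal_real_of_ne (show rWt ≠ rKey by decide), State.setReal_real_same, hWt4]
      split_ifs with hhi
      · rw [hhi]
      · exact h3 h (by omega)
    · simp only [State.setNat_real, State.setReal_real_of_ne (show rKey ≠ rW by decide),
        State.setReal_real_of_ne (show rKey ≠ rWt by decide), State.setReal_real_same, hKey4]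
      split_ifs with hhi
      · rw [hhi]
      · exact h4 h (by omega)
    · simp only [State.setNat_real, State.setReal_real_same, if_true]
    · simp only [State.setNat_nat_same, State.setReal_nat, hT4]
      split_ifs with hhi
      · omega
      · exact h6 h (by omega)
    · simp only [State.setNat_real, State.setReal_real_of_ne (show rAcc ≠ rW by decide),
        State.setReal_real_of_ne (show rAcc ≠ rKey by decide),
        State.setReal_real_of_ne (show rAcc ≠ rWt by decide), hA4]

/-- Stores in `rY` a point with the least sum of distances on the line through `rX` in the direction
of the row `nK` of `rQ`. -/
def searchLine : Program :=
  .seq computeKeys <|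
  .seq buildTree <|
  .seq selectMedian <|
  axpyLoop rY (.const 0) rX (.const 0) (.var rTau) rQ (.load nRow (.var nK))

/-- The sum of distances on the line is a constant plus the weighted sum of distances to the keys
(`distSum_line`), so that a weighted median of the keys is the parameter of a best point. -/
theorem WP.searchLine {s : State} {k : ℕ} (hl : Listed d m a b s) (hm : 1 ≤ m) (hk : k < d)
    (hK : s.nat nK 0 = k) :
    WP searchLine s (m * (100 * d + Nat.log 2 (2 * m) * 100 + 420) + 70 * d + 100) (fun s' =>
      ∀ t : ℝ, distSum m a b (vec d s' rY 0) ≤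
        distSum m a b (vec d s rX 0 + t • vec d s rQ (k * d))) := by
  refine WP.le (T := (m * (100 * d + 200) + 30) + ((m * 100 + 20) +
    ((m * (Nat.log 2 (2 * m) * 100 + 120) + 20) + (70 * d + 30)))) ?_ (by
      generalize Nat.log 2 (2 * m) = l
      nlinarith)
  refine WP.seq (WP.computeKeys hl hk hK) fun s1 ha1 h1 => ?_
  obtain ⟨⟨hwt, hkey, hW, hleaf⟩, hacc⟩ := h1
  have hl1 := hl.agree ha1 (by decide) (by decide) (by decide) (by decide) (by decide) (by decide)
  refine WP.seq (WP.buildTree hl1.list.size) fun s2 ha2 h2 => ?_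
  have hl2 := hl1.agree ha2 (by decide) (by decide) (by decide) (by decide) (by decide) (by decide)
  have hkey2 : s2.real rKey = s1.real rKey := ha2.real rKey (by decide)
  have hwt2 : s2.real rWt = s1.real rWt := ha2.real rWt (by decide)
  refine WP.seq (WP.selectMedian hm hl2.list.size (fun i hi => ?_) ?_ ?_ (by rw [hkey2]; exact h2.1)
    fun i hi => ?_) fun s3 ha3 h3 => ?_
  · rw [hwt2, hwt i hi]
    exact abs_nonneg _
  · rw [ha2.real rW (by decide), hW, hwt2]
    exact sum_congr rfl fun i hi => (hwt i (mem_range.1 hi)).symm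
  · rw [ha2.real rAcc (by decide), hacc]
  · rw [h2.2 _ (by omega), hleaf i hi]
  have hl3 := hl2.agree ha3 (by decide) (by decide) (by decide) (by decide) (by decide) (by decide)
  refine WP.post (WP.axpyLoop hl3.dim (by decide) (by decide) (by decide) (by decide) (by decide)
    (Or.inl (by decide)) (by decide) (by decide)) fun s4 ha4 h4 t => ?_
  have hK3 : s3.nat nK 0 = k := by
    rw [ha3.nat nK (by decide), ha2.nat nK (by decide), ha1.nat nK (by decide), hK]
  have hX3 : vec d s3 rX 0 = vec d s rX 0 := by
    rw [vec_congr (ha3.real rX (by decide)), vec_congr (ha2.real rX (by decide)),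
      vec_congr (ha1.real rX (by decide))]
  have hQ3 : vec d s3 rQ (k * d) = vec d s rQ (k * d) := by
    rw [vec_congr (ha3.real rQ (by decide)), vec_congr (ha2.real rQ (by decide)),
      vec_congr (ha1.real rQ (by decide))]
  simp only [NatExp.eval, RealExp.eval, hK3, hl3.row k hk, hX3, hQ3] at h4
  obtain ⟨C, hC⟩ := distSum_line (m := m) (a := a) (b := b) (vec d s rX 0) (vec d s rQ (k * d))
  rw [h4.1, hC, hC]
  have h5 := h3 t
  rw [hkey2, hwt2] at h5
  have h6 : ∀ x : ℝ, ∑ i ∈ range m, s1.real rWt i * |x - s1.real rKey i| = ∑ h ∈ range m,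
      |inner ℝ (a h) (vec d s rQ (k * d))| * |x - (b h - inner ℝ (a h) (vec d s rX 0)) /
        inner ℝ (a h) (vec d s rQ (k * d))| := by
    intro x
    refine sum_congr rfl fun i hi => ?_
    rw [hwt i (mem_range.1 hi), hkey i (mem_range.1 hi)]
  rw [h6, h6] at h5
  linarith

/-- Makes `rY` the output point if it is better than the current one. -/
def updateBest : Program :=
  .seq evalSum <|
  .ite (.realLt (.var rD) (.var rBest))
    (.seq (.storeReal rBest (.const 0) (.var rD))
      (scaleLoop rOut (.const 0) (.const 1) rY (.const 0)))
    .skip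

/-- The cell `rBest` holds the sum of the distances from the output point, which is at most `r`. -/
def BestLe (m : ℕ) (a : ℕ → EuclideanSpace ℝ (Fin d)) (b : ℕ → ℝ) (r : ℝ) (s : State) : Prop :=
  s.real rBest 0 = distSum m a b (vec d s rOut 0) ∧ s.real rBest 0 ≤ r

theorem BestLe.agree {r : ℝ} {s s' : State} {p : Program} (h : BestLe m a b r s) (ha : Agree p s s')
    (h1 : rBest ∉ p.realWrites) (h2 : rOut ∉ p.realWrites) : BestLe m a b r s' := by
  rwa [BestLe, ha.real _ h1, vec_congr (ha.real _ h2)]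

theorem WP.updateBest {s : State} {r : ℝ} (hl : Listed d m a b s) (hb : BestLe m a b r s) :
    WP updateBest s (m * (50 * d + 80) + 70 * d + 80) (fun s' =>
      BestLe m a b r s' ∧ s'.real rBest 0 ≤ s.real rBest 0 ∧
        s'.real rBest 0 ≤ distSum m a b (vec d s rY 0)) := by
  refine WP.le (T := (m * (50 * d + 80) + 20) + (6 + (5 + (70 * d + 30)))) ?_ (by omega)
  refine WP.seq (WP.evalSum hl.dim hl.list) fun s1 ha1 h1 => ?_
  rw [hl.normal, hl.offset] at h1
  have hl1 := hl.agree ha1 (by decide) (by decide) (by decide) (by decide) (by decide) (by decide)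
  have hb1 := hb.agree ha1 (by decide) (by decide)
  have hY1 : vec d s1 rY 0 = vec d s rY 0 := vec_congr (ha1.real rY (by decide))
  have hB1 : s1.real rBest 0 = s.real rBest 0 := by rw [ha1.real rBest (by decide)]
  refine WP.ite (fun hlt => ?_) fun hlt => WP.le (WP.skip ⟨hb1, hB1.le, ?_⟩) (by omega)
  · have hlt' : s1.real rD 0 < s1.real rBest 0 := hlt
    refine WP.seq (WP.le (WP.storeReal (Q := fun s' => s'.real rBest 0 = s1.real rD 0) ?_)
      (by simp [NatExp.cost, RealExp.cost])) fun s2 ha2 h2 => ?_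
    · simp [NatExp.eval, RealExp.eval, State.setReal_real_same]
    have hl2 := hl1.agree ha2 (by decide) (by decide) (by decide) (by decide) (by decide)
      (by decide)
    refine WP.post (WP.scaleLoop hl2.dim (by decide) (by decide) (by decide) (by decide) (by decide)
      (by decide)) fun s3 ha3 h3 => ?_
    simp only [NatExp.eval, RealExp.eval, Int.cast_one, one_smul,
      vec_congr (ha2.real rY (by decide)), hY1] at h3
    have hB3 : s3.real rBest 0 = distSum m a b (vec d s rY 0) := by
      rw [ha3.real rBest (by decide), h2, h1]
    refine ⟨⟨by rw [hB3, h3.1], ?_⟩, ?_, hB3.le⟩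
    · have := hb1.2
      rw [hB3, ← h1]
      linarith
    · rw [hB3, ← h1, ← hB1]
      exact hlt'.le
  · have hlt' : ¬ s1.real rD 0 < s1.real rBest 0 := hlt
    rw [← h1]
    exact not_lt.1 hlt'

/-- Loads a hyperplane of the current tuple. -/
def loadHyperplane : Program :=
  .seq (scaleLoop rA (.const 0) (.const 1) rHA (.load nHRow (.load nIdx (.var nJ))))
    (.storeReal rB (.const 0) (.load rHB (.load nIdx (.var nJ))))

/-- Searches the lines through a common point of the hyperplanes of the current tuple, one line for
each residual of a standard basis vector. -/
def processNormals : Program :=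
  .seq (projectAll (.sub dimE (.const 1)) loadHyperplane) <|
  forLoop nK dimE (.seq searchLine updateBest)

/-- No line given by the hyperplanes number `g 0, …, g (d - 2)` contains a point with a smaller
sum of distances than `r`. -/
def LinesGe (m : ℕ) (a : ℕ → EuclideanSpace ℝ (Fin d)) (b : ℕ → ℝ) (r : ℝ) (g : ℕ → ℕ) : Prop :=
  ∀ k < d, ∃ x, (∀ z, (∀ j < d - 1, inner ℝ (a (g j)) z = b (g j)) →
      z - x ∈ (spanBefore (fun j => a (g j)) (d - 1))ᗮ) ∧
    ∀ t : ℝ, r ≤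
      distSum m a b (x + t • residual (spanBefore (fun j => a (g j)) (d - 1)) (unitVec d k))

theorem LinesGe.mono {r r' : ℝ} {g : ℕ → ℕ} (h : LinesGe m a b r g) (hr : r' ≤ r) :
    LinesGe m a b r' g := by
  intro k hk
  obtain ⟨x, hx, hx'⟩ := h k hk
  exact ⟨x, hx, fun t => hr.trans (hx' t)⟩

theorem WP.processNormals {s : State} {r : ℝ} {g : ℕ → ℕ} (hl : Listed d m a b s)
    (hb : BestLe m a b r s) (hm : 1 ≤ m) (hidx : ∀ j < d - 1, s.nat nIdx j = g j)
    (hg : ∀ j < d - 1, g j < m) :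
    WP processNormals s
      (d * (m * (150 * d + Nat.log 2 (2 * m) * 100 + 500)) + d * (d * (120 * d + 1000) + 1000) + 100)
      (fun s' => BestLe m a b r s' ∧ s'.real rBest 0 ≤ s.real rBest 0 ∧
        LinesGe m a b (s'.real rBest 0) g) := by
  set S := spanBefore (fun j => a (g j)) (d - 1) with hS
  have hK : (NatExp.sub dimE (.const 1)).eval s = d - 1 := by
    simp only [NatExp.eval, hl.dim]
  refine WP.le (T := (d * (70 * d + 70) + (d - 1) * ((70 * d + 40) + d * (120 * d + 300) + 220) + 50)
    + (d * (2 + ((m * (100 * d + Nat.log 2 (2 * m) * 100 + 420) + 70 * d + 100) +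
      (m * (50 * d + 80) + 70 * d + 80)) + 10) + (2 + 10))) ?_ ?_
  · refine WP.seq (WP.projectAll hK hl.dim hl.row rfl (by decide) (by decide) (by decide)
      (a := fun j => a (g j)) (b := fun j => b (g j)) ?_) fun s1 ha1 h1 => ?_
    · intro j s' hj ha hJ
      have hl' := hl.agree ha (by decide) (by decide) (by decide) (by decide) (by decide)
        (by decide)
      have hidx' : s'.nat nIdx j = g j := by rw [ha.nat nIdx (by decide)]; exact hidx j hj
      refine WP.le (T := 70 * d + 30 + 6) ?_ (by omega)
      refine WP.seq (WP.scaleLoop hl'.dim (by decide) (by decide) (by decide) (by decide)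
        (by decide) (by decide)) fun s2 ha2 h2 => WP.storeReal ⟨?_, ?_⟩
      · simp only [NatExp.eval, RealExp.eval, hJ, hidx', hl'.list.row _ (hg j hj).le, hl'.vec_eq,
          Int.cast_one, one_smul] at h2
        rw [← h2.1]
        exact vec_congr (State.setReal_real_of_ne (by decide))
      · simp [State.setReal_real_same, NatExp.eval, RealExp.eval, ha2.nat nJ (by decide), hJ,
          ha2.nat nIdx (by decide), hidx', ha2.real rHB (by decide), hl'.offset]
    · obtain ⟨hres, -, hx⟩ := h1
      have hl1 := hl.agree ha1 (by decide) (by decide) (by decide) (by decide) (by decide)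
        (by decide)
      have hb1 := hb.agree ha1 (by decide) (by decide)
      have hE : dimE.eval s1 = d := hl1.dim
      refine WP.post (WP.forLoop (B := (m * (100 * d + Nat.log 2 (2 * m) * 100 + 420) + 70 * d + 100)
          + (m * (50 * d + 80) + 70 * d + 80))
        (fun k s' => BestLe m a b r s' ∧ s'.real rBest 0 ≤ s.real rBest 0 ∧
          ∀ k' < k, ∀ t : ℝ, s'.real rBest 0 ≤
            distSum m a b (vec d s1 rX 0 + t • residual S (unitVec d k')))
        hE (by decide) (by decide) (fun _ _ _ h => h) ?_ ?_) ?_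
      · exact ⟨hb1, (congrFun (ha1.real rBest (by decide)) 0).le, by simp⟩
      · rintro k s' hk ha hk' ⟨hb', hle', hlines⟩
        have hl' := hl1.agree ha (by decide) (by decide) (by decide) (by decide) (by decide)
          (by decide)
        refine WP.seq (WP.searchLine hl' hm hk hk') fun s2 ha2 h2 => ?_
        rw [vec_congr (ha.real rX (by decide)), vec_congr (ha.real rQ (by decide)), hres k hk] at h2
        refine WP.post (WP.updateBest (hl'.agree ha2 (by decide) (by decide) (by decide) (by decide)
          (by decide) (by decide)) (hb'.agree ha2 (by decide) (by decide))) fun s3 ha3 h3 => ?_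
        obtain ⟨h4, h5, h6⟩ := h3
        rw [ha2.real rBest (by decide)] at h5
        refine ⟨h4, h5.trans hle', fun k' hkk t => ?_⟩
        rcases (Nat.lt_succ_iff.1 hkk).lt_or_eq with hkk | rfl
        · exact h5.trans (hlines k' hkk t)
        · exact h6.trans (h2 t)
      · rintro s' - ⟨h2, h3, h4⟩
        exact ⟨h2, h3, fun k hk => ⟨vec d s1 rX 0, hx, h4 k hk⟩⟩
  · generalize Nat.log 2 (2 * m) = l
    have : (d - 1) * ((70 * d + 40) + d * (120 * d + 300) + 220) ≤
      d * ((70 * d + 40) + d * (120 * d + 300) + 220) := Nat.mul_le_mul_right _ (Nat.sub_le _ _)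
    nlinarith [Nat.zero_le (d * m)]

theorem LinesGe.congr {r : ℝ} {g g' : ℕ → ℕ} (h : LinesGe m a b r g)
    (hg : ∀ j < d - 1, g j = g' j) : LinesGe m a b r g' := by
  intro k hk
  obtain ⟨x, hx, hx'⟩ := h k hk
  have hS : spanBefore (fun j => a (g j)) (d - 1) = spanBefore (fun j => a (g' j)) (d - 1) :=
    spanBefore_congr fun j hj => by simp only [hg j hj]
  rw [hS] at hx hx'
  exact ⟨x, fun z hz => hx z fun j hj => by rw [hg j hj]; exact hz j hj, hx'⟩

/-- Searches the lines of all `(d - 1)`-tuples of hyperplanes. The enumeration of tuples needs a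
nonempty range of entries, hence the test. -/
def searchAll : Program :=
  .ite (.natLt (.const 0) (.var nM))
    (forTuples (.sub dimE (.const 1)) (.var nM) processNormals) .skip

theorem WP.searchAll {s : State} {r : ℝ} (hd : 1 ≤ d) (hl : Listed d m a b s)
    (hb : BestLe m a b r s) :
    WP searchAll s
      (m ^ (d - 1) * (d * (m * (150 * d + Nat.log 2 (2 * m) * 100 + 500)) +
        d * (d * (120 * d + 1000) + 1050) + 200) + d * 50 + 100)
      (fun s' => BestLe m a b r s' ∧
        (∀ g : ℕ → ℕ, (∀ j < d - 1, g j < m) → LinesGe m a b (s'.real rBest 0) g)) := by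
  by_cases hm : 1 ≤ m
  · have hK : (NatExp.sub dimE (.const 1)).eval s = d - 1 := by simp only [NatExp.eval, hl.dim]
    have hN : (NatExp.var nM).eval s = m := hl.list.size
    set B := d * (m * (150 * d + Nat.log 2 (2 * m) * 100 + 500)) +
      d * (d * (120 * d + 1000) + 1000) + 100 with hB
    have hft := WP.forTuples (K := .sub dimE (.const 1)) (N := .var nM) (p := RealRAM.processNormals)
      (s := s) (B := B) (fun c s' => BestLe m a b r s' ∧
        ∀ c' < c, LinesGe m a b (s'.real rBest 0) fun j => c' / m ^ j % m) (by decide) (by decide)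
      (by decide) (by decide) (by rw [hN]; exact hm) ?_ ?_ ?_
    · refine WP.le (WP.ite (fun _ => WP.post hft ?_) fun h => ?_) ?_
      · rintro s' - ⟨h1, h2⟩
        rw [hK, hN] at h2
        refine ⟨h1, fun g hg => ?_⟩
        obtain ⟨c, hc, hcg⟩ := exists_digits m (d - 1) g hg
        exact (h2 c hc).congr hcg
      · exact absurd (show 0 < (NatExp.var nM).eval s by rw [hN]; exact hm) h
      · rw [hK, hN]
        simp only [Test.cost, NatExp.cost]
        have : m ^ (d - 1) * (B + (d - 1) * 50 + 70) ≤ m ^ (d - 1) *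
            (d * (m * (150 * d + Nat.log 2 (2 * m) * 100 + 500)) +
              d * (d * (120 * d + 1000) + 1050) + 200) := by
          refine Nat.mul_le_mul_left _ ?_
          have : d * (d * (120 * d + 1000) + 1050) = d * (d * (120 * d + 1000) + 1000) + d * 50 := by
            ring
          omega
        omega
    · rintro c s' s'' ⟨h1, h2⟩ hr -
      rw [BestLe, vec_congr (congrFun hr rOut), hr]
      exact ⟨h1, h2⟩
    · exact ⟨hb, by simp⟩
    · intro c s' hc ha hdig hI
      rw [hK, hN] at hc hdig
      refine WP.post (WP.processNormals (hl.agree ha (by decide) (by decide) (by decide) (by decide)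
        (by decide) (by decide)) hI.1 hm hdig fun j _ => Nat.mod_lt _ hm) ?_
      rintro s2 - ⟨h1, h2, h3⟩
      refine ⟨h1, fun c' hc' => ?_⟩
      rcases (Nat.lt_succ_iff.1 hc').lt_or_eq with hc' | rfl
      · exact (hI.2 c' hc').mono h2
      · exact h3
  · refine WP.le (WP.ite (T := 1) (fun h => ?_) fun _ => WP.skip ⟨hb, fun g hg => ?_⟩) ?_
    · have : 0 < s.nat nM 0 := h
      rw [hl.list.size] at this
      exact absurd this hm
    · -- without hyperplanes, the only tuple is the empty one in dimension one
      intro k hk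
      have hd1 : d = 1 := by
        by_contra hne
        exact absurd (hg 0 (by omega)) (by omega)
      have hm0 : m = 0 := by omega
      subst hd1 hm0
      refine ⟨0, fun z _ => ?_, fun t => ?_⟩
      · simp
      · rw [hb.1]
        simp [distSum]
    · simp only [Test.cost, NatExp.cost]
      omega

end RealRAM

/-! ### The program -/

namespace RealRAM

open Finset Module HDD

/-- Stores the multiples of the dimension. -/
def initTable : Program :=
  forLoop nI (.add (.load nIn (.const 0)) dimE)
    (.storeNat nRow (.add (.var nI) (.const 1)) (.add (.load nRow (.var nI)) dimE))

theorem WP.initTable {d n : ℕ} {s : State} (hn : s.nat nIn 0 = n) (hd : s.nat nIn 1 = d)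
    (h0 : s.nat nRow 0 = 0) :
    WP initTable s ((n + d) * 30 + 20) (fun s' => ∀ i < n + d, s'.nat nRow i = i * d) := by
  have hN : (NatExp.add (.load nIn (.const 0)) dimE).eval s = n + d := by
    simp only [NatExp.eval, hn, hd]
  refine WP.le (WP.post (WP.forLoop (B := 15) (fun k s' => ∀ i ≤ k, s'.nat nRow i = i * d) hN
    (by decide) (by decide) ?_ ?_ ?_) fun s' _ h i hi => h i hi.le) ?_
  · intro k s' v h
    rwa [State.setNat_nat_of_ne (by decide)]
  · intro i hi
    rw [Nat.le_zero.1 hi, h0, zero_mul]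
  · intro k s' hk ha hI h
    refine WP.le (WP.storeNat fun i hi => ?_) (by simp [NatExp.cost])
    simp only [State.setNat_nat_same, NatExp.eval, hI, h k le_rfl, ha.nat nIn (by decide), hd]
    split_ifs with hik
    · rw [hik, Nat.succ_mul]
    · exact h i (by omega)
  · simp only [NatExp.cost]
    nlinarith

/-- Makes the first point the output point. -/
def initBest : Program :=
  .seq (scaleLoop rY (.const 0) (.const 1) rPt (.const 0)) <|
  .seq evalSum <|
  .seq (.storeReal rBest (.const 0) (.var rD))
    (scaleLoop rOut (.const 0) (.const 1) rPt (.const 0))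

theorem WP.initBest {d m : ℕ} {a : ℕ → EuclideanSpace ℝ (Fin d)} {b : ℕ → ℝ} {s : State}
    (hl : Listed d m a b s) :
    WP initBest s (m * (50 * d + 80) + 140 * d + 90)
      (BestLe m a b (distSum m a b (vec d s rPt 0))) := by
  refine WP.le (T := (70 * d + 30) + ((m * (50 * d + 80) + 20) + (5 + (70 * d + 30)))) ?_ (by omega)
  refine WP.seq (WP.scaleLoop hl.dim (by decide) (by decide) (by decide) (by decide) (by decide)
    (by decide)) fun s1 ha1 h1 => ?_
  simp only [NatExp.eval, RealExp.eval, Int.cast_one, one_smul] at h1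
  have hl1 := hl.agree ha1 (by decide) (by decide) (by decide) (by decide) (by decide) (by decide)
  refine WP.seq (WP.evalSum hl1.dim hl1.list) fun s2 ha2 h2 => ?_
  rw [hl1.normal, hl1.offset, h1.1] at h2
  have hl2 := hl1.agree ha2 (by decide) (by decide) (by decide) (by decide) (by decide) (by decide)
  refine WP.seq (WP.le (WP.storeReal (Q := fun s' => s'.real rBest 0 = s2.real rD 0) ?_)
    (by simp [NatExp.cost, RealExp.cost])) fun s3 ha3 h3 => ?_
  · simp [NatExp.eval, RealExp.eval, State.setReal_real_same]
  have hl3 := hl2.agree ha3 (by decide) (by decide) (by decide) (by decide) (by decide) (by decide)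
  refine WP.post (WP.scaleLoop hl3.dim (by decide) (by decide) (by decide) (by decide) (by decide)
    (by decide)) fun s4 ha4 h4 => ?_
  simp only [NatExp.eval, RealExp.eval, Int.cast_one, one_smul, vec_congr (ha3.real rPt (by decide)),
    vec_congr (ha2.real rPt (by decide)), vec_congr (ha1.real rPt (by decide))] at h4
  have hB : s4.real rBest 0 = distSum m a b (vec d s rPt 0) := by
    rw [ha4.real rBest (by decide), h3, h2]
  exact ⟨by rw [hB, h4.1], hB.le⟩

/-- The program that computes a median: it lists the hyperplanes, takes the first point as a first
candidate, and improves it by searching all lines. -/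
def medianProgram : Program :=
  .seq initTable <| .seq collectHyperplanes <| .seq initBest searchAll

/-- A bound for the number of steps of `medianProgram` for `n` points in dimension `d` that
determine `M` hyperplanes. The summands belong to the four parts of the program. -/
def stepBound (d n M : ℕ) : ℕ :=
  ((n + d) * 30 + 20) +
  ((n ^ d * (d * ((d - 1) * (M * (50 * d + 80))) + d * (d * (120 * d + 1000) + 1050) + 270) +
      d * 50 + 70) +
  ((M * (50 * d + 80) + 140 * d + 90) +
  (M ^ (d - 1) * (d * (M * (150 * d + Nat.log 2 (2 * M) * 100 + 500)) +
    d * (d * (120 * d + 1000) + 1050) + 200) + d * 50 + 100)))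

theorem vec_input {d n : ℕ} (p : Fin n → EuclideanSpace ℝ (Fin d)) {i : ℕ} (hi : i < n) :
    vec d (input p) rPt (i * d) = p ⟨i, hi⟩ := by
  ext j
  have hlt := row_lt hi j.2
  rw [vec_apply, input]
  simp only [true_and]
  rw [dif_pos hlt]
  have hd : 0 < d := by have := j.2; omega
  have h1 : Fin.divNat (⟨i * d + j, hlt⟩ : Fin (n * d)) = ⟨i, hi⟩ := by
    ext
    rw [Fin.coe_divNat]
    show (i * d + j) / d = i
    rw [mul_comm, Nat.mul_add_div hd, Nat.div_eq_of_lt j.2, add_zero]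
  have h2 : Fin.modNat (⟨i * d + j, hlt⟩ : Fin (n * d)) = j := by
    ext
    rw [Fin.coe_modNat]
    show (i * d + j) % d = j
    rw [mul_comm, Nat.mul_add_mod, Nat.mod_eq_of_lt j.2]
  rw [h1, h2]

theorem WP.medianProgram {d n : ℕ} (hd : 1 ≤ d) (hn : 1 ≤ n)
    (p : Fin n ↪ EuclideanSpace ℝ (Fin d)) :
    WP medianProgram (input p) (stepBound d n #(hyperplanes (univ.map p)))
      (fun s => IsMedian (univ.map p) (output d s)) := by
  set s := input p with hs
  set P := univ.map p with hPdef
  set M := #(hyperplanes P) with hM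
  set pt : ℕ → EuclideanSpace ℝ (Fin d) := fun i => vec d s rPt (i * d) with hpt
  have hpt' : ∀ i (hi : i < n), pt i = p ⟨i, hi⟩ := fun i hi => vec_input p hi
  have hP : P = (range n).image pt := by
    ext x
    simp only [hPdef, mem_map, mem_univ, true_and, mem_image, mem_range]
    constructor
    · rintro ⟨i, rfl⟩
      exact ⟨i, i.2, hpt' i i.2⟩
    · rintro ⟨i, hi, rfl⟩
      exact ⟨⟨i, hi⟩, (hpt' i hi).symm⟩
  have hinj : Set.InjOn pt (Set.Iio n) := by
    intro i hi j hj h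
    rw [hpt' i hi, hpt' j hj] at h
    exact congrArg Fin.val (p.injective h)
  have hn0 : s.nat nIn 0 = n := rfl
  have hd0 : s.nat nIn 1 = d := rfl
  refine WP.seq (WP.initTable hn0 hd0 rfl) fun s1 ha1 h1 => ?_
  have henv1 : Env d n pt s1 := ⟨by rw [ha1.nat nIn (by decide), hn0],
    by rw [ha1.nat nIn (by decide), hd0], h1, fun i _ => vec_congr (ha1.real rPt (by decide))⟩
  refine WP.seq (WP.collectHyperplanes hd hn hinj henv1 (M := M)
    (fun A B m s' h => h.card_le hd hn hP) ⟨?_, ?_⟩) fun s2 ha2 ⟨m, h2⟩ => ?_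
  · rw [ha1.nat nM (by decide)]; rfl
  · intro h hh
    rw [ha1.nat nHRow (by decide), Nat.le_zero.1 hh, zero_mul]; rfl
  have henv2 := henv1.agree ha2 (by decide) (by decide) (by decide)
  have hmM : m ≤ M := h2.card_le hd hn hP
  have hl2 : Listed d m (normal d s2) (s2.real rHB) s2 :=
    ⟨h2.1, rfl, rfl, henv2.dim, fun i hi => henv2.row i (by omega)⟩
  refine WP.seq (WP.le (WP.initBest hl2) (by gcongr)) fun s3 ha3 h3 => ?_
  have hl3 := hl2.agree ha3 (by decide) (by decide) (by decide) (by decide) (by decide) (by decide)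
  refine WP.le (WP.post (WP.searchAll hd hl3 h3) ?_) (by
    have := Nat.log_mono_right (b := 2) (Nat.mul_le_mul_left 2 hmM)
    gcongr)
  rintro s4 - ⟨hb4, h4⟩
  have hout : output d s4 = vec d s4 rOut 0 := by
    ext j
    simp [output]
  have hp0 : vec d s2 rPt 0 = pt 0 := by
    have := henv2.point 0 (by omega)
    rwa [zero_mul] at this
  rw [hout]
  refine (h2.enumerates hd hn hP).isMedian hd hP (q := pt 0) ?_ ?_ ?_
  · rw [hP]
    exact mem_image_of_mem _ (mem_range.2 (by omega))
  · rw [← hb4.1, ← hp0]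
    exact hb4.2
  · rw [← hb4.1]
    exact h4

/-! ### The running time -/

theorem sq_le_two_pow {d : ℕ} (hd : 1 ≤ d) : d ^ 2 ≤ 2 ^ (d * (d - 1)) := by
  have h : d ≤ 2 ^ (d - 1) := by
    have := Nat.lt_two_pow_self (n := d - 1)
    omega
  rcases hd.eq_or_lt with rfl | hd
  · simp
  · calc d ^ 2 ≤ d ^ d := Nat.pow_le_pow_right (by omega) hd
      _ ≤ (2 ^ (d - 1)) ^ d := Nat.pow_le_pow_left h d
      _ = 2 ^ (d * (d - 1)) := by rw [← pow_mul, mul_comm]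

theorem sq_le_two_mul_two_pow (d : ℕ) : d ^ 2 ≤ 2 * 2 ^ d := by
  induction d with
  | zero => simp
  | succ k ih =>
    rcases Nat.lt_or_ge k 3 with hk | hk
    · interval_cases k <;> simp
    · rw [pow_succ 2 k]
      nlinarith

theorem mul_pow_le_of_mul_factorial_le {d n M : ℕ} (hd : 1 ≤ d) (hM : M * d.factorial ≤ n ^ d) :
    d * M ^ d ≤ n ^ d ^ 2 := by
  calc d * M ^ d ≤ d.factorial ^ d * M ^ d := by
        refine Nat.mul_le_mul_right _ ((Nat.self_le_factorial d).trans ?_)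
        exact Nat.le_self_pow (by omega) _
    _ = (M * d.factorial) ^ d := by rw [mul_pow, mul_comm]
    _ ≤ (n ^ d) ^ d := Nat.pow_le_pow_left hM d
    _ = n ^ d ^ 2 := by rw [← pow_mul, ← sq]

/-- The number of hyperplanes is at most `n ^ d / d!`, and the factorial makes up for the surplus
factors `d` of the vector operations; elsewhere they are absorbed by a surplus power of `n`. -/
theorem stepBound_le {d n M : ℕ} (hd : 1 ≤ d) (hn : 2 ≤ n) (hM : M * d.factorial ≤ n ^ d) :
    stepBound d n M ≤ 20000 * (d * n ^ d ^ 2) + 100 * (d * M ^ d * Nat.log 2 (2 * M)) := by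
  have hdd : d + d * (d - 1) = d ^ 2 := by
    obtain ⟨e, rfl⟩ : ∃ e, d = e + 1 := ⟨d - 1, by omega⟩
    rw [Nat.add_sub_cancel]
    ring
  set X := n ^ d ^ 2 with hX
  have hX1 : 1 ≤ X := Nat.one_le_pow _ _ (by omega)
  have hpow : ∀ k ≤ d ^ 2, n ^ k ≤ X := fun k hk => Nat.pow_le_pow_right (by omega) hk
  have hnX : n ≤ X := by simpa using hpow 1 (Nat.one_le_pow _ _ hd)
  have hndX : n ^ d ≤ X := hpow d (by omega)
  have hMn : M ≤ n ^ d := (Nat.le_mul_of_pos_right _ (Nat.factorial_pos _)).trans hM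
  -- `hA`, `hB` bound the enumeration of the point tuples and the search for repetitions, `hC`,
  -- `hD` the line searches and the projections
  have hA : n ^ d * d ^ 2 ≤ X := by
    calc n ^ d * d ^ 2 ≤ n ^ d * n ^ (d * (d - 1)) :=
          Nat.mul_le_mul_left _ ((sq_le_two_pow hd).trans (Nat.pow_le_pow_left hn _))
      _ = X := by rw [← pow_add, hdd]
  have hB : n ^ d * ((d - 1) * (M * d)) ≤ X := by
    rcases hd.eq_or_lt with rfl | hd2
    · simp
    · have h1 : (d - 1) * d ≤ d.factorial := by
        obtain ⟨e, rfl⟩ : ∃ e, d = e + 2 := ⟨d - 2, by omega⟩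
        rw [Nat.factorial_succ, Nat.factorial_succ]
        calc (e + 2 - 1) * (e + 2) = (e + 1 + 1) * ((e + 1) * 1) := by
              rw [show e + 2 - 1 = e + 1 by omega]; ring
          _ ≤ _ := Nat.mul_le_mul_left _ (Nat.mul_le_mul_left _ (Nat.factorial_pos _))
      calc n ^ d * ((d - 1) * (M * d)) = n ^ d * (M * ((d - 1) * d)) := by ring
        _ ≤ n ^ d * n ^ d := Nat.mul_le_mul_left _ ((Nat.mul_le_mul_left _ h1).trans hM)
        _ = n ^ (d + d) := (pow_add _ _ _).symm
        _ ≤ X := hpow _ (by nlinarith)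
  have hD : M ^ (d - 1) * d ^ 2 ≤ 2 * X := by
    calc M ^ (d - 1) * d ^ 2 ≤ (n ^ d) ^ (d - 1) * (2 * n ^ d) :=
          Nat.mul_le_mul (Nat.pow_le_pow_left hMn _) ((sq_le_two_mul_two_pow d).trans
            (Nat.mul_le_mul_left _ (Nat.pow_le_pow_left hn _)))
      _ = 2 * X := by rw [hX, ← hdd, pow_add, pow_mul]; ring
  have hC : d * M ^ d ≤ X := mul_pow_le_of_mul_factorial_le hd hM
  have hMd : M ^ (d - 1) * M = M ^ d := by rw [← pow_succ, Nat.sub_add_cancel hd]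
  have hcube : d * (120 * d + 1000) + 1050 ≤ 2170 * d ^ 2 := by nlinarith
  set Y := d * X with hY
  have hXY : X ≤ Y := Nat.le_mul_of_pos_left _ hd
  have hdY : d ≤ Y := Nat.le_mul_of_pos_right _ hX1
  have e1 : n ^ d * (d * ((d - 1) * (M * (50 * d + 80))) + d * (d * (120 * d + 1000) + 1050) + 270) ≤
      2570 * Y := by
    calc _ ≤ n ^ d * (d * ((d - 1) * (M * (130 * d))) + d * (2170 * d ^ 2) + 270) := by
          gcongr
          omega
      _ = 130 * (d * (n ^ d * ((d - 1) * (M * d)))) + 2170 * (d * (n ^ d * d ^ 2)) +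
          270 * n ^ d := by ring
      _ ≤ 130 * (d * X) + 2170 * (d * X) + 270 * X := by gcongr
      _ ≤ 2570 * Y := by omega
  have e2 : M * (50 * d + 80) ≤ 130 * Y := by
    calc M * (50 * d + 80) ≤ X * (130 * d) := Nat.mul_le_mul (hMn.trans hndX) (by omega)
      _ = 130 * Y := by rw [hY]; ring
  have e3 : M ^ (d - 1) * (d * (M * (150 * d + Nat.log 2 (2 * M) * 100 + 500)) +
      d * (d * (120 * d + 1000) + 1050) + 200) ≤
      5400 * Y + 100 * (d * M ^ d * Nat.log 2 (2 * M)) := by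
    have h2 : M ^ (d - 1) ≤ 2 * X :=
      (Nat.le_mul_of_pos_right _ (by positivity)).trans hD
    calc _ ≤ M ^ (d - 1) * (d * (M * (150 * d + Nat.log 2 (2 * M) * 100 + 500)) +
          d * (2170 * d ^ 2) + 200) := by gcongr
      _ = 150 * (d * (d * (M ^ (d - 1) * M))) + 500 * (d * (M ^ (d - 1) * M)) +
          100 * (d * (M ^ (d - 1) * M) * Nat.log 2 (2 * M)) + 2170 * (d * (M ^ (d - 1) * d ^ 2)) +
          200 * M ^ (d - 1) := by ring
      _ ≤ 150 * (d * X) + 500 * X + 100 * (d * M ^ d * Nat.log 2 (2 * M)) +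
          2170 * (d * (2 * X)) + 200 * (2 * X) := by
        rw [hMd]
        gcongr
      _ ≤ _ := by
        rw [show d * (2 * X) = 2 * Y by rw [hY]; ring]
        omega
  rw [stepBound]
  omega

/-- The height of the tournament tree. -/
theorem log_two_mul_le {d n M : ℕ} (hn : 2 ≤ n) (hM : M ≤ n ^ d) :
    (Nat.log 2 (2 * M) : ℝ) ≤ 1 + 2 * (d * Real.log n) := by
  have hlog := Real.log_two_gt_d9
  have hlogn : 0 ≤ Real.log n := Real.log_natCast_nonneg n
  rcases Nat.eq_zero_or_pos M with rfl | hpos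
  · simp only [mul_zero, Nat.log_zero_right, Nat.cast_zero]
    positivity
  · have h1 : (2 : ℝ) ^ Nat.log 2 (2 * M) ≤ 2 * (n : ℝ) ^ d := by
      have := (Nat.pow_log_le_self 2 (x := 2 * M) (by omega)).trans (Nat.mul_le_mul_left 2 hM)
      exact_mod_cast this
    have h2 := Real.log_le_log (by positivity) h1
    have hn0 : (n : ℝ) ≠ 0 := by positivity
    rw [Real.log_pow, Real.log_mul (by norm_num) (pow_ne_zero _ hn0), Real.log_pow] at h2
    have hdl : 0 ≤ (d : ℝ) * Real.log n := by positivity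
    by_contra! hcon
    nlinarith

end RealRAM

theorem mainTheorem2 :
    ∃ (prog : RealRAM.Program) (C : ℝ), ∀ (d n : ℕ), 1 ≤ d → 1 ≤ n →
      ∀ p : Fin n ↪ EuclideanSpace ℝ (Fin d),
        ∃ (t : ℕ) (s : RealRAM.State),
          RealRAM.Runs prog (RealRAM.input p) t s ∧
          HDD.IsMedian (Finset.univ.map p) (RealRAM.output d s) ∧
          (2 ≤ n → (t : ℝ) ≤ C * ((d : ℝ) * (n : ℝ) ^ (d ^ 2) * Real.log (n : ℝ))) := by
  -- the constant is not optimized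
  refine ⟨RealRAM.medianProgram, 50000, fun d n hd hn p => ?_⟩
  obtain ⟨t, s, hrun, ht, hmed⟩ := RealRAM.WP.medianProgram hd hn p
  refine ⟨t, s, hrun, hmed, fun hn2 => ?_⟩
  have hM := HDD.card_hyperplanes_mul_factorial_le (Finset.univ.map p)
  rw [Finset.card_map, Finset.card_univ, Fintype.card_fin] at hM
  set M := (HDD.hyperplanes (Finset.univ.map p)).card with hMdef
  have h1 := ht.trans (RealRAM.stepBound_le hd hn2 hM)
  have hMn : M ≤ n ^ d := (Nat.le_mul_of_pos_right _ (Nat.factorial_pos _)).trans hM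
  have h2 := RealRAM.log_two_mul_le hn2 hMn
  have h3 := RealRAM.mul_pow_le_of_mul_factorial_le hd hM
  have h1' : (t : ℝ) ≤ 20000 * (d * (n : ℝ) ^ d ^ 2) + 100 * (d * (M : ℝ) ^ d * Nat.log 2 (2 * M)) := by
    exact_mod_cast h1
  have h3' : (d : ℝ) * (M : ℝ) ^ d ≤ (n : ℝ) ^ d ^ 2 := by exact_mod_cast h3
  have hlog : 1 / 2 ≤ Real.log n := by
    have h4 := Real.log_two_gt_d9
    have h5 : Real.log 2 ≤ Real.log n := Real.log_le_log (by norm_num) (by exact_mod_cast hn2)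
    linarith
  have hd' : (1 : ℝ) ≤ d := by exact_mod_cast hd
  set X := (n : ℝ) ^ d ^ 2 with hX
  have hX0 : 0 ≤ X := by positivity
  have h6 : (d : ℝ) * (M : ℝ) ^ d * Nat.log 2 (2 * M) ≤ X * (1 + 2 * (d * Real.log n)) :=
    mul_le_mul h3' h2 (by positivity) hX0
  have h7 : X ≤ d * X := le_mul_of_one_le_left hX0 hd'
  have h8 : d * X * (1 / 2) ≤ d * X * Real.log n := by gcongr
  nlinarith
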